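/- Let $A=\bigoplus_{n\in\mathbb{Z}}A_n$ be a commutative $\mathbb{Z}$-graded ring, let $I^+ := A_{>0}\cdot A$ be the ideal generated by the homogeneous elements of positive degree, and assume that $I^+$ is finitely generated, by homogeneous elements $f_1,\dots,f_r$. Let ${\rm Gr}(A)$ be the abelian category of $\mathbb{Z}$-graded $A$-modules and degree-preserving $A$-linear maps. *Notation.* Let ${\rm Tor}^+\subset{\rm Gr}(A)$ be the Serre subcategory of those $M$ such that for every homogeneous $x\in M$ and every $f\in I^+$ there is $n>0$ with $f^nx=0$; let ${\rm Q}^+{\rm Gr}(A):={\rm Gr}(A)/{\rm Tor}^+$ be the Serre quotient, with exact quotient functor $\phi^*:{\rm Gr}(A)\to{\rm Q}^+{\rm Gr}(A)$. For $\spadesuit\in\{\varnothing,+,-,b\}$ and an abelian category $\mathcal{C}$, let $\mathcal{D}^\spadesuit(\mathcal{C})\subset\mathcal{D}(\mathcal{C})$ be the full subcategory of complexes whose cohomology is arbitrary, bounded below, bounded above, bounded, respectively; write again $\phi^*$ for the induced exact functors $\mathcal{D}^\spadesuit({\rm Gr}(A))\to\mathcal{D}^\spadesuit({\rm Q}^+{\rm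 Gr}(A))$, and let $\mathcal{D}^\spadesuit_{{\rm Tor}^+}({\rm Gr}(A))\subset \mathcal{D}^\spadesuit({\rm Gr}(A))$ be the full subcategory of complexes with cohomology in ${\rm Tor}^+$. For $M\in{\rm Gr}(A)$ let $${\bm R}\Gamma_{I^+}(M)=\Bigl[M\xrightarrow{d^0}\prod_{i_0}M_{f_{i_0}}\xrightarrow{d^1}\prod_{i_0<i_1}M_{f_{i_0}f_{i_1}}\to\cdots\to M_{f_1\cdots f_r}\Bigr]$$ be the extended Čech complex, with $M$ in degree $0$ and $d^m$ the alternating sum of the localization maps, and let $$\check{\mathcal{C}}_{I^+}(M)=\Bigl[\prod_{i_0}M_{f_{i_0}}\xrightarrow{-d^1}\prod_{i_0<i_1}M_{f_{i_0}f_{i_1}}\xrightarrow{-d^2}\cdots\to M_{f_1\cdots f_r}\Bigr]$$ be the Čech complex, with $\prod_{i_0} M_{f_{i_0}}$ in degree $0$; on complexes of graded modules take total complexes. Both constructions preserve quasi-isomorphisms and so give functors ${\bm R}\Gamma_{I^+},\check{\mathcal{C}}_{I^+}:\mathcal{D}({\rm Gr}(A))\to\mathcal{D}({\rm Gr}(A))$.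 Let $\mathcal{D}^\spadesuit_{I^+\text{-triv}}({\rm Gr}(A))\subset\mathcal{D}^\spadesuit({\rm Gr}(A))$ be the full subcategory of all $M$ with ${\bm R}\Gamma_{I^+}(M)\simeq0$. *Statement.* 1. For each $\spadesuit\in\{\varnothing,+,-,b\}$, ${\rm Tor}^+\subset{\rm Gr}(A)$ is $\mathcal{D}^\spadesuit$-localizing: the functor $\phi^*:\mathcal{D}^\spadesuit({\rm Gr}(A))\to\mathcal{D}^\spadesuit({\rm Q}^+{\rm Gr}(A))$ has a right adjoint ${\bm R}\phi_*$ such that the counit $\phi^*\circ{\bm R}\phi_*\Rightarrow{\rm id}$ is an isomorphism. 2. The functor ${\bm R}\phi_*:\mathcal{D}({\rm Q}^+{\rm Gr}(A))\to\mathcal{D}({\rm Gr}(A))$ is fully faithful, and for each $\spadesuit$ its restriction to $\mathcal{D}^\spadesuit({\rm Q}^+{\rm Gr}(A))$ is isomorphic to the functor ${\bm R}\phi_*$ of (1) followed by the inclusion $\mathcal{D}^\spadesuit({\rm Gr}(A))\subset\mathcal{D}({\rm Gr}(A))$. 3. For each $\spadesuit$ there is a semi-orthogonal decomposition $$\mathcal{D}^\spadesuit({\rm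 Gr}(A))=\bigl\langle\,{\bm R}\phi_*(\mathcal{D}^\spadesuit({\rm Q}^+{\rm Gr}(A)))\,,\;\mathcal{D}^\spadesuit_{{\rm Tor}^+}({\rm Gr}(A))\,\bigr\rangle .$$ Here $\mathcal{D}=\langle\mathcal{E}_1,\mathcal{E}_2\rangle$ means that $\mathcal{E}_1,\mathcal{E}_2$ are full triangulated subcategories of $\mathcal{D}$ with ${\rm Hom}_{\mathcal D}(E_2,E_1)=0$ for all $E_i\in\mathcal{E}_i$, and that each $X\in\mathcal{D}$ sits in an exact triangle $E_2\to X\to E_1\to E_2[1]$ with $E_i\in\mathcal{E}_i$. 4. For each $\spadesuit$, the functor $\check{\mathcal{C}}_{I^+}$ maps $\mathcal{D}^\spadesuit({\rm Gr}(A))$ to itself, and ${\bm R}\phi_*\circ\phi^*\cong\check{\mathcal{C}}_{I^+}$ as functors $\mathcal{D}^\spadesuit({\rm Gr}(A))\to\mathcal{D}^\spadesuit({\rm Gr}(A))$. 5. For each $\spadesuit$, the subcategory $\mathcal{D}^\spadesuit_{I^+\text{-triv}}({\rm Gr}(A))$ is triangulated, and $\phi^*$ restricts to an exact equivalence $\mathcal{D}^\spadesuit_{I^+\text{-triv}}({\rm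 Gr}(A))\xrightarrow{\simeq}\mathcal{D}^\spadesuit({\rm Q}^+{\rm Gr}(A))$ with quasi-inverse ${\bm R}\phi_*$. -/

import Mathlib

open CategoryTheory CategoryTheory.Limits

universe u w w'

noncomputable section

/-- A graded module over the `ℤ`-graded commutative ring `A = ⨁ 𝒜 n`: an `A`-module `M` with
additive subgroups `M_j` such that `M = ⨁ M_j` and `A_i • M_j ⊆ M_{i+j}`. -/
structure GrMod {A : Type u} [CommRing A] (𝒜 : ℤ → AddSubgroup A) where
  carrier : Type u
  [addCommGroup : AddCommGroup carrier]
  [module : Module A carrier]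
  deg : ℤ → AddSubgroup carrier
  isInternal : DirectSum.IsInternal deg
  smul_mem : ∀ {i j : ℤ} {a : A} {x : carrier}, a ∈ 𝒜 i → x ∈ deg j → a • x ∈ deg (i + j)

namespace GrMod

variable {A : Type u} [CommRing A] {𝒜 : ℤ → AddSubgroup A}

instance : CoeSort (GrMod 𝒜) (Type u) := ⟨GrMod.carrier⟩
instance (M : GrMod 𝒜) : AddCommGroup M := M.addCommGroup
instance (M : GrMod 𝒜) : Module A M := M.module

/-- The projection of a graded module onto its component of degree `i`. -/
def proj (M : GrMod 𝒜) (i : ℤ) : M →+ M :=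
  letI := M.isInternal.chooseDecomposition
  (M.deg i).subtype.comp
    ((DFinsupp.evalAddMonoidHom i).comp (DirectSum.decomposeAddEquiv M.deg).toAddMonoidHom)

lemma proj_mem (M : GrMod 𝒜) (i : ℤ) (x : M) : M.proj i x ∈ M.deg i := by
  simp [proj]

lemma proj_of_mem (M : GrMod 𝒜) {i : ℤ} {x : M} (hx : x ∈ M.deg i) : M.proj i x = x := by
  let _ := M.isInternal.chooseDecomposition
  exact DirectSum.decompose_of_mem_same M.deg hx

lemma proj_of_mem_ne (M : GrMod 𝒜) {i j : ℤ} {x : M} (hx : x ∈ M.deg i) (h : i ≠ j) :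
    M.proj j x = 0 := by
  let _ := M.isInternal.chooseDecomposition
  exact DirectSum.decompose_of_mem_ne M.deg hx h

lemma mem_closure (M : GrMod 𝒜) (x : M) :
    x ∈ AddSubgroup.closure {y : M | ∃ i, y ∈ M.deg i} := by
  let _ := M.isInternal.chooseDecomposition
  induction x using DirectSum.Decomposition.inductionOn M.deg with
  | zero => exact zero_mem _
  | homogeneous m => exact AddSubgroup.subset_closure ⟨_, m.2⟩
  | add m m' h h' => exact add_mem h h'

lemma ext_proj (M : GrMod 𝒜) {x y : M} (h : ∀ i, M.proj i x = M.proj i y) : x = y := by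
  let _ := M.isInternal.chooseDecomposition
  refine (DirectSum.decompose M.deg).injective (DFinsupp.ext fun i => Subtype.ext (h i))

/-- A criterion for a family of subgroups to be a grading. -/
lemma isInternal_of_proj {X : Type*} [AddCommGroup X] (deg : ℤ → AddSubgroup X)
    (p : ℤ → X →+ X)
    (h₁ : ∀ i x, x ∈ deg i → p i x = x) (h₂ : ∀ i j x, x ∈ deg i → i ≠ j → p j x = 0)
    (h₃ : ∀ x, x ∈ AddSubgroup.closure {y : X | ∃ i, y ∈ deg i}) :
    DirectSum.IsInternal deg := by
  classical
  constructor
  · rw [injective_iff_map_eq_zero]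
    intro x hx
    have key : ∀ (z : DirectSum ℤ fun i => deg i) (j : ℤ),
        p j (DirectSum.coeAddMonoidHom deg z) = (z j : X) := by
      intro z j
      induction z using DirectSum.induction_on with
      | zero => simp
      | of i x =>
        rw [DirectSum.coeAddMonoidHom_of]
        by_cases h : i = j
        · subst h
          rw [h₁ _ _ x.2, DirectSum.of_eq_same]
        · rw [h₂ _ _ _ x.2 h, DirectSum.of_eq_of_ne _ _ _ (Ne.symm h)]; rfl
      | add x y hx hy => rw [map_add, map_add, hx, hy]; rfl
    refine DFinsupp.ext fun j => Subtype.ext ?_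
    have := key x j
    rw [hx, map_zero] at this
    exact this.symm
  · intro x
    induction h₃ x using AddSubgroup.closure_induction with
    | mem y hy =>
      obtain ⟨i, hi⟩ := hy
      exact ⟨DirectSum.of (fun i => deg i) i ⟨y, hi⟩, by simp⟩
    | zero => exact ⟨0, map_zero _⟩
    | add y z _ _ hy hz =>
      obtain ⟨a, rfl⟩ := hy
      obtain ⟨b, rfl⟩ := hz
      exact ⟨a + b, map_add _ _ _⟩
    | neg y _ hy =>
      obtain ⟨a, rfl⟩ := hy
      exact ⟨-a, map_neg _ _⟩

/-- Morphisms of graded modules: `A`-linear maps of degree `0`. -/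
@[ext]
structure Hom (M N : GrMod 𝒜) where
  lin : M →ₗ[A] N
  map_deg : ∀ {i : ℤ} {x : M}, x ∈ M.deg i → lin x ∈ N.deg i

/-- The category `Gr(A)` of graded `A`-modules. -/
instance : Category (GrMod 𝒜) where
  Hom := Hom
  id M := ⟨LinearMap.id, fun h => h⟩
  comp f g := ⟨g.lin ∘ₗ f.lin, fun h => g.map_deg (f.map_deg h)⟩

@[ext]
lemma hom_ext {M N : GrMod 𝒜} {f g : M ⟶ N} (h : ∀ x, f.lin x = g.lin x) : f = g :=
  Hom.ext (LinearMap.ext h)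

@[simp] lemma id_lin (M : GrMod 𝒜) : Hom.lin (𝟙 M) = LinearMap.id := rfl

@[simp] lemma comp_lin {M N P : GrMod 𝒜} (f : M ⟶ N) (g : N ⟶ P) :
    Hom.lin (f ≫ g) = g.lin ∘ₗ f.lin := rfl

lemma lin_injective {M N : GrMod 𝒜} :
    Function.Injective (fun f : M ⟶ N => f.lin) := fun _ _ h => Hom.ext h

variable {M N P : GrMod 𝒜}

instance : Zero (M ⟶ N) := ⟨⟨0, fun _ => zero_mem _⟩⟩
instance : Add (M ⟶ N) :=
  ⟨fun f g => ⟨f.lin + g.lin, fun h => add_mem (f.map_deg h) (g.map_deg h)⟩⟩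
instance : Neg (M ⟶ N) := ⟨fun f => ⟨-f.lin, fun h => neg_mem (f.map_deg h)⟩⟩
instance : Sub (M ⟶ N) :=
  ⟨fun f g => ⟨f.lin - g.lin, fun h => sub_mem (f.map_deg h) (g.map_deg h)⟩⟩
instance : SMul ℕ (M ⟶ N) :=
  ⟨fun n f => ⟨n • f.lin, fun h => nsmul_mem (f.map_deg h) n⟩⟩
instance : SMul ℤ (M ⟶ N) :=
  ⟨fun n f => ⟨n • f.lin, fun h => zsmul_mem (f.map_deg h) n⟩⟩

instance : AddCommGroup (M ⟶ N) :=
  Function.Injective.addCommGroup (fun f : M ⟶ N => f.lin) lin_injective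
    rfl (fun _ _ => rfl) (fun _ => rfl) (fun _ _ => rfl) (fun _ _ => rfl) (fun _ _ => rfl)

@[simp] lemma zero_lin : Hom.lin (0 : M ⟶ N) = 0 := rfl
@[simp] lemma add_lin (f g : M ⟶ N) : Hom.lin (f + g) = f.lin + g.lin := rfl
@[simp] lemma neg_lin (f : M ⟶ N) : Hom.lin (-f) = -f.lin := rfl
@[simp] lemma sub_lin (f g : M ⟶ N) : Hom.lin (f - g) = f.lin - g.lin := rfl
@[simp] lemma zsmul_lin (n : ℤ) (f : M ⟶ N) : Hom.lin (n • f) = n • f.lin := rfl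

instance : Preadditive (GrMod 𝒜) where
  add_comp _ _ _ f f' g := by ext x; simp
  comp_add _ _ _ f g g' := by ext x; simp

lemma hom_proj (f : M ⟶ N) (i : ℤ) (x : M) : f.lin (M.proj i x) = N.proj i (f.lin x) := by
  induction M.mem_closure x using AddSubgroup.closure_induction with
  | mem y hy =>
    obtain ⟨j, hj⟩ := hy
    by_cases h : j = i
    · subst h
      rw [M.proj_of_mem hj, N.proj_of_mem (f.map_deg hj)]
    · rw [M.proj_of_mem_ne hj h, N.proj_of_mem_ne (f.map_deg hj) h, map_zero]
  | zero => simp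
  | add y z _ _ hy hz => simp only [map_add, hy, hz]
  | neg y _ hy => simp only [map_neg, hy]

/-- An isomorphism from a bijective morphism. -/
lemma isIso_of_bijective (f : M ⟶ N) (hf : Function.Bijective f.lin) : IsIso f := by
  let e := LinearEquiv.ofBijective f.lin hf
  refine ⟨⟨⟨e.symm.toLinearMap, fun {i x} hx => ?_⟩, ?_, ?_⟩⟩
  · have : e.symm x = M.proj i (e.symm x) := by
      apply hf.1
      rw [hom_proj]
      change e (e.symm x) = N.proj i (e (e.symm x))
      rw [e.apply_symm_apply, N.proj_of_mem hx]
    change e.symm x ∈ M.deg i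
    rw [this]
    exact M.proj_mem _ _
  · ext x; exact e.symm_apply_apply x
  · ext x; exact e.apply_symm_apply x

/-- The kernel of a morphism, as a graded module. -/
def ker (f : M ⟶ N) : GrMod 𝒜 where
  carrier := LinearMap.ker f.lin
  deg i := (M.deg i).comap (LinearMap.ker f.lin).subtype.toAddMonoidHom
  isInternal := by
    have hp : ∀ (i : ℤ) (x : LinearMap.ker f.lin), M.proj i x ∈ LinearMap.ker f.lin := by
      intro i x
      rw [LinearMap.mem_ker, hom_proj, x.2, map_zero]
    refine isInternal_of_proj _
      (fun i => AddMonoidHom.mk' (fun x => ⟨M.proj i x, hp i x⟩)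
        (fun x y => Subtype.ext (map_add _ _ _)))
      (fun i x hx => Subtype.ext (M.proj_of_mem hx))
      (fun i j x hx h => Subtype.ext (M.proj_of_mem_ne hx h)) ?_
    intro x
    let _ := M.isInternal.chooseDecomposition
    classical
    have hx : x = ∑ i ∈ (DirectSum.decompose M.deg (x : M)).support,
        (⟨M.proj i x, hp i x⟩ : LinearMap.ker f.lin) := by
      apply Subtype.ext
      rw [AddSubmonoidClass.coe_finsetSum]
      exact (DirectSum.sum_support_decompose M.deg (x : M)).symm
    rw [hx]
    exact sum_mem fun i _ => AddSubgroup.subset_closure ⟨i, M.proj_mem i x⟩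
  smul_mem ha hx := M.smul_mem ha hx

/-- The inclusion of the kernel. -/
def kerι (f : M ⟶ N) : ker f ⟶ M := ⟨(LinearMap.ker f.lin).subtype, fun h => h⟩

lemma kerι_comp (f : M ⟶ N) : kerι f ≫ f = 0 := by
  ext x; exact x.2

/-- `ker f` is a kernel of `f`. -/
def kerIsLimit (f : M ⟶ N) : IsLimit (KernelFork.ofι (kerι f) (kerι_comp f)) :=
  KernelFork.IsLimit.ofι _ _
    (fun g hg => ⟨LinearMap.codRestrict _ g.lin fun x => congrArg (fun k => Hom.lin k x) hg,
      fun h => g.map_deg h⟩)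
    (fun g hg => rfl)
    (fun g hg m hm => by
      subst hm
      rfl)

/-- The cokernel of a morphism, as a graded module. -/
def coker (f : M ⟶ N) : GrMod 𝒜 where
  carrier := N ⧸ LinearMap.range f.lin
  deg i := (N.deg i).map (LinearMap.range f.lin).mkQ.toAddMonoidHom
  isInternal := by
    refine isInternal_of_proj _
      (fun i => QuotientAddGroup.map _ _ (N.proj i) (by
        rintro _ ⟨x, rfl⟩
        exact ⟨M.proj i x, hom_proj _ _ _⟩)) ?_ ?_ ?_
    · rintro i _ ⟨x, hx, rfl⟩
      exact congrArg (LinearMap.range f.lin).mkQ (N.proj_of_mem hx)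
    · rintro i j _ ⟨x, hx, rfl⟩ h
      exact (congrArg (LinearMap.range f.lin).mkQ (N.proj_of_mem_ne hx h)).trans (map_zero _)
    · intro x
      obtain ⟨x, rfl⟩ := (LinearMap.range f.lin).mkQ_surjective x
      induction N.mem_closure x using AddSubgroup.closure_induction with
      | mem y hy =>
        obtain ⟨j, hj⟩ := hy
        exact AddSubgroup.subset_closure ⟨j, y, hj, rfl⟩
      | zero => rw [map_zero]; exact zero_mem _
      | add y z _ _ hy hz => rw [map_add]; exact add_mem hy hz
      | neg y _ hy => rw [map_neg]; exact neg_mem hy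
  smul_mem := by
    rintro i j a _ ha ⟨x, hx, rfl⟩
    exact ⟨a • x, N.smul_mem ha hx, map_smul (LinearMap.range f.lin).mkQ a x⟩

/-- The projection onto the cokernel. -/
def cokerπ (f : M ⟶ N) : N ⟶ coker f :=
  ⟨(LinearMap.range f.lin).mkQ, fun {_ x} h => ⟨x, h, rfl⟩⟩

lemma cokerπ_surjective (f : M ⟶ N) : Function.Surjective (cokerπ f).lin :=
  (LinearMap.range f.lin).mkQ_surjective

lemma comp_cokerπ (f : M ⟶ N) : f ≫ cokerπ f = 0 := by
  ext x
  exact (Submodule.Quotient.mk_eq_zero _).2 ⟨x, rfl⟩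

/-- `coker f` is a cokernel of `f`. -/
def cokerIsColimit (f : M ⟶ N) : IsColimit (CokernelCofork.ofπ (cokerπ f) (comp_cokerπ f)) :=
  CokernelCofork.IsColimit.ofπ _ _
    (fun g hg => ⟨(LinearMap.range f.lin).liftQ g.lin (by
        rintro _ ⟨x, rfl⟩
        exact congrArg (fun k => Hom.lin k x) hg), by
        rintro i _ ⟨x, hx, rfl⟩
        exact g.map_deg hx⟩)
    (fun g hg => rfl)
    (fun g hg m hm => by
      subst hm
      ext x
      obtain ⟨x, rfl⟩ := cokerπ_surjective f x
      rfl)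

/-- The product of a finite family of graded modules. -/
def pi {ι : Type} [Finite ι] (M : ι → GrMod 𝒜) : GrMod 𝒜 where
  carrier := ∀ i, M i
  deg j := AddSubgroup.pi Set.univ fun i => (M i).deg j
  isInternal := by
    classical
    have := Fintype.ofFinite ι
    refine isInternal_of_proj _
      (fun j => AddMonoidHom.mk' (fun x i => (M i).proj j (x i))
        (fun x y => funext fun i => map_add _ _ _))
      (fun j x hx => funext fun i => (M i).proj_of_mem (hx i trivial))
      (fun j k x hx h => funext fun i => (M i).proj_of_mem_ne (hx i trivial) h) ?_
    intro x
    rw [← Finset.univ_sum_single x]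
    refine sum_mem fun i _ => ?_
    generalize x i = y
    induction (M i).mem_closure y using AddSubgroup.closure_induction with
    | mem y hy =>
      obtain ⟨j, hj⟩ := hy
      refine AddSubgroup.subset_closure ⟨j, fun k _ => ?_⟩
      by_cases h : k = i
      · subst h
        simpa using hj
      · simp only [Pi.single_eq_of_ne h]
        exact ((M k).deg j).zero_mem
    | zero => rw [Pi.single_zero]; exact zero_mem _
    | add y z _ _ hy hz => rw [Pi.single_add]; exact add_mem hy hz
    | neg y _ hy => rw [Pi.single_neg]; exact neg_mem hy
  smul_mem ha hx := fun i hi => (M i).smul_mem ha (hx i hi)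

/-- The projections of a finite product. -/
def piπ {ι : Type} [Finite ι] (M : ι → GrMod 𝒜) (i : ι) : pi M ⟶ M i :=
  ⟨LinearMap.proj i, fun h => h i trivial⟩

/-- `pi M` is a product. -/
def piIsLimit {ι : Type} [Finite ι] (M : ι → GrMod 𝒜) : IsLimit (Fan.mk (pi M) (piπ M)) :=
  Fan.IsLimit.mk _
    (fun s => ⟨LinearMap.pi fun i => (s.proj i).lin, fun h i _ => (s.proj i).map_deg h⟩)
    (fun s i => rfl)
    (fun s m hm => by
      ext x
      funext i
      exact congrArg (fun k => Hom.lin k x) (hm i))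

instance : HasKernels (GrMod 𝒜) := ⟨fun f => ⟨_, kerIsLimit f⟩⟩
instance : HasCokernels (GrMod 𝒜) := ⟨fun f => ⟨_, cokerIsColimit f⟩⟩
instance : HasFiniteProducts (GrMod 𝒜) where
  out n :=
    ⟨fun F => by
      have : HasLimit (Discrete.functor (F.obj ∘ Discrete.mk)) := ⟨_, piIsLimit _⟩
      exact hasLimit_of_iso (Discrete.natIsoFunctor (F := F)).symm⟩

lemma mono_iff_injective (f : M ⟶ N) : Mono f ↔ Function.Injective f.lin := by
  constructor
  · intro h
    rw [← LinearMap.ker_eq_bot, LinearMap.ker_eq_bot']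
    intro x hx
    have : kerι f = 0 := by rw [← cancel_mono f, kerι_comp, zero_comp]
    exact congrArg (fun k => Hom.lin k (⟨x, hx⟩ : LinearMap.ker f.lin)) this
  · intro h
    refine ⟨fun a b hab => ?_⟩
    ext x
    exact h (congrArg (fun k => Hom.lin k x) hab)

lemma epi_iff_surjective (f : M ⟶ N) : Epi f ↔ Function.Surjective f.lin := by
  constructor
  · intro h
    rw [← LinearMap.range_eq_top, eq_top_iff]
    intro x _
    have : cokerπ f = 0 := by rw [← cancel_epi f, comp_cokerπ, comp_zero]
    exact (Submodule.Quotient.mk_eq_zero _).1 (congrArg (fun k => Hom.lin k x) this)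
  · intro h
    refine ⟨fun a b hab => ?_⟩
    ext x
    obtain ⟨x, rfl⟩ := h x
    exact congrArg (fun k => Hom.lin k x) hab

/-- `Gr(A)` is an abelian category. -/
instance : Abelian (GrMod 𝒜) where
  normalMonoOfMono {M N} f hf := ⟨{
    Z := coker f
    g := cokerπ f
    w := comp_cokerπ f
    isLimit :=
      have hf := (mono_iff_injective f).1 hf
      have hr : ∀ {P : GrMod 𝒜} (g : P ⟶ N), g ≫ cokerπ f = 0 →
          ∀ x, g.lin x ∈ LinearMap.range f.lin := fun g hg x =>
        (Submodule.Quotient.mk_eq_zero _).1 (congrArg (fun k => Hom.lin k x) hg)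
      let e := LinearEquiv.ofInjective f.lin hf
      have he : ∀ y, f.lin (e.symm y) = y := fun y => congrArg Subtype.val (e.apply_symm_apply y)
      KernelFork.IsLimit.ofι _ _
        (fun g hg => ⟨e.symm.toLinearMap ∘ₗ LinearMap.codRestrict _ g.lin (hr g hg), by
          intro i x hx
          have h : M.proj i (e.symm ⟨g.lin x, hr g hg x⟩) = e.symm ⟨g.lin x, hr g hg x⟩ := by
            apply hf
            rw [hom_proj, he, N.proj_of_mem (g.map_deg hx)]
          change e.symm ⟨g.lin x, hr g hg x⟩ ∈ M.deg i
          rw [← h]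
          exact M.proj_mem _ _⟩)
        (fun g hg => by
          ext x
          exact he ⟨g.lin x, hr g hg x⟩)
        (fun g hg m hm => by
          subst hm
          ext x
          apply hf
          exact (he ⟨f.lin (m.lin x), _⟩).symm) }⟩
  normalEpiOfEpi {M N} f hf := ⟨{
    W := ker f
    g := kerι f
    w := kerι_comp f
    isColimit :=
      have hf := (epi_iff_surjective f).1 hf
      let e := LinearMap.quotKerEquivOfSurjective f.lin hf
      have he : ∀ x, e.symm (f.lin x) = Submodule.Quotient.mk x := fun x => by
        rw [LinearEquiv.symm_apply_eq]; rfl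
      have hk : ∀ {P : GrMod 𝒜} (g : M ⟶ P), kerι f ≫ g = 0 →
          LinearMap.ker f.lin ≤ LinearMap.ker g.lin := fun g hg x hx => by
        have := congrArg (fun k : ker f ⟶ _ => k.lin (⟨x, hx⟩ : LinearMap.ker f.lin)) hg
        exact this
      have hd : ∀ {P : GrMod 𝒜} (g : M ⟶ P) (hg : kerι f ≫ g = 0) (x : M),
          ((LinearMap.ker f.lin).liftQ g.lin (hk g hg)) (e.symm (f.lin x)) = g.lin x :=
        fun g hg x => by rw [he]; rfl
      CokernelCofork.IsColimit.ofπ _ _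
        (fun g hg => ⟨(LinearMap.ker f.lin).liftQ g.lin (hk g hg) ∘ₗ e.symm.toLinearMap, by
          intro i y hy
          obtain ⟨x, rfl⟩ := hf y
          rw [← N.proj_of_mem hy, ← hom_proj]
          change ((LinearMap.ker f.lin).liftQ g.lin (hk g hg)) (e.symm (f.lin _)) ∈ _
          rw [hd g hg]
          exact g.map_deg (M.proj_mem _ _)⟩)
        (fun g hg => by
          ext x
          exact hd g hg x)
        (fun g hg m hm => by
          ext y
          obtain ⟨x, rfl⟩ := hf y
          exact (congrArg (fun k => Hom.lin k x) hm).trans (hd g hg x).symm) }⟩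

end GrMod

namespace GrMod

variable {A : Type u} [CommRing A] {𝒜 : ℤ → AddSubgroup A}

/-! ### Exactness in terms of elements -/

lemma exact_iff (S : ShortComplex (GrMod 𝒜)) :
    S.Exact ↔ ∀ x : S.X₂, S.g.lin x = 0 → ∃ y : S.X₁, S.f.lin y = x := by
  have hι : Function.Injective (kernel.ι S.g).lin := (mono_iff_injective _).1 inferInstance
  have hk : ∀ y, (kernel.ι S.g).lin ((kernel.lift S.g S.f S.zero).lin y) = S.f.lin y := fun y =>
    congrArg (fun k => Hom.lin k y) (kernel.lift_ι S.g S.f S.zero)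
  rw [ShortComplex.exact_iff_epi_kernel_lift, epi_iff_surjective]
  constructor
  · intro h x hx
    have e : (kernel.ι S.g).lin ((kernel.lift S.g (kerι S.g) (kerι_comp _)).lin
        (⟨x, hx⟩ : LinearMap.ker S.g.lin)) = x :=
      congrArg (fun k : ker S.g ⟶ _ => k.lin (⟨x, hx⟩ : LinearMap.ker S.g.lin))
        (kernel.lift_ι S.g (kerι S.g) (kerι_comp _))
    obtain ⟨y, hy⟩ := h ((kernel.lift S.g (kerι S.g) (kerι_comp _)).lin
        (⟨x, hx⟩ : LinearMap.ker S.g.lin))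
    exact ⟨y, by rw [← hk, hy, e]⟩
  · intro h x
    obtain ⟨y, hy⟩ := h ((kernel.ι S.g).lin x)
      (congrArg (fun k => Hom.lin k x) (kernel.condition S.g))
    exact ⟨y, hι (by rw [hk, hy])⟩

lemma comp_apply_zero {M N P : GrMod 𝒜} {f : M ⟶ N} {g : N ⟶ P} (h : f ≫ g = 0) (x : M) :
    g.lin (f.lin x) = 0 :=
  congrArg (fun k => Hom.lin k x) h

lemma proj_smul (M : GrMod 𝒜) {e : ℤ} {a : A} (ha : a ∈ 𝒜 e) (j : ℤ) (x : M) :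
    M.proj (e + j) (a • x) = a • M.proj j x := by
  induction M.mem_closure x using AddSubgroup.closure_induction with
  | mem y hy =>
    obtain ⟨i, hi⟩ := hy
    by_cases h : i = j
    · subst h
      rw [M.proj_of_mem hi, M.proj_of_mem (M.smul_mem ha hi)]
    · rw [M.proj_of_mem_ne hi h, M.proj_of_mem_ne (M.smul_mem ha hi) (by omega), smul_zero]
  | zero => simp
  | add y z _ _ hy hz => simp only [map_add, smul_add, hy, hz]
  | neg y _ hy => simp only [map_neg, smul_neg, hy]

/-! ### Positively torsion modules -/

end GrMod

section Torsion

variable {A : Type u} [CommRing A]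

/-- An element `x` of a module is `I^∞`-torsion if every `f ∈ I` has a positive power
annihilating `x`. -/
def IsPowTorsion (I : Ideal A) {X : Type*} [AddCommGroup X] [Module A X] (x : X) : Prop :=
  ∀ f ∈ I, ∃ n : ℕ, 0 < n ∧ f ^ n • x = 0

lemma IsPowTorsion.add {I : Ideal A} {X : Type*} [AddCommGroup X] [Module A X] {x y : X}
    (hx : IsPowTorsion I x) (hy : IsPowTorsion I y) : IsPowTorsion I (x + y) := by
  intro f hf
  obtain ⟨n, hn, h⟩ := hx f hf
  obtain ⟨m, hm, h'⟩ := hy f hf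
  refine ⟨n + m, by omega, ?_⟩
  rw [smul_add, pow_add, mul_smul, mul_smul, h', smul_zero, add_zero, smul_comm, h, smul_zero]

/-- The graded ideal `I⁺ = A_{>0} · A` generated by the elements of positive degree. -/
def idealPos (𝒜 : ℤ → AddSubgroup A) : Ideal A := Ideal.span {a | ∃ i : ℤ, 0 < i ∧ a ∈ 𝒜 i}

/-- The full subcategory `Tor⁺ ⊆ Gr(A)` of positively torsion graded modules: every homogeneous
element is `(I⁺)^∞`-torsion. -/
def torPos (𝒜 : ℤ → AddSubgroup A) : ObjectProperty (GrMod 𝒜) :=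
  fun M => ∀ (i : ℤ) (x : M), x ∈ M.deg i → IsPowTorsion (idealPos 𝒜) x

variable {𝒜 : ℤ → AddSubgroup A}

lemma torPos_iff (M : GrMod 𝒜) : torPos 𝒜 M ↔ ∀ x : M, IsPowTorsion (idealPos 𝒜) x := by
  refine ⟨fun h x => ?_, fun h i x _ => h x⟩
  induction M.mem_closure x using AddSubgroup.closure_induction with
  | mem y hy =>
    obtain ⟨i, hi⟩ := hy
    exact h i y hi
  | zero => exact fun f _ => ⟨1, one_pos, smul_zero _⟩
  | add y z _ _ hy hz => exact hy.add hz
  | neg y _ hy =>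
    intro f hf
    obtain ⟨n, hn, h⟩ := hy f hf
    exact ⟨n, hn, by rw [smul_neg, h, neg_zero]⟩

/-- `Tor⁺` is a Serre subcategory of `Gr(A)`. -/
instance : (torPos 𝒜).IsSerreClass where
  exists_zero := ⟨_, isZero_zero (GrMod 𝒜), fun i x _ f _ => ⟨1, one_pos, by
    have : x = 0 := congrArg (fun k => GrMod.Hom.lin k x)
      ((isZero_zero (GrMod 𝒜)).eq_of_src (𝟙 _) 0)
    rw [this, smul_zero]⟩⟩
  prop_of_mono {M N} g _ hN := by
    rw [torPos_iff] at hN ⊢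
    intro x f hf
    obtain ⟨n, hn, h⟩ := hN (g.lin x) f hf
    refine ⟨n, hn, (GrMod.mono_iff_injective g).1 inferInstance ?_⟩
    rw [map_smul, h, map_zero]
  prop_of_epi {M N} g _ hM := by
    rw [torPos_iff] at hM ⊢
    intro y f hf
    obtain ⟨x, rfl⟩ := (GrMod.epi_iff_surjective g).1 inferInstance y
    obtain ⟨n, hn, h⟩ := hM x f hf
    exact ⟨n, hn, by rw [← map_smul, h, map_zero]⟩
  prop_X₂_of_shortExact {S} hS h₁ h₃ := by
    rw [torPos_iff] at h₁ h₃ ⊢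
    intro x f hf
    obtain ⟨n, hn, h⟩ := h₃ (S.g.lin x) f hf
    obtain ⟨y, hy⟩ := (GrMod.exact_iff S).1 hS.exact (f ^ n • x) (by rw [map_smul, h])
    obtain ⟨m, hm, h'⟩ := h₁ y f hf
    exact ⟨m + n, by omega, by rw [pow_add, mul_smul, ← hy, ← map_smul, h', map_zero]⟩

end Torsion

/-! ### Localization of graded modules at a homogeneous element -/

namespace GrMod

variable {A : Type u} [CommRing A] {𝒜 : ℤ → AddSubgroup A}

open LocalizedModule (mk_eq mk_add_mk mk_neg zero_mk smul'_mk)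

/-- The fraction `x / f ^ n` in `M_f`. -/
abbrev frac {f : A} {X : Type*} [AddCommGroup X] [Module A X] (x : X) (n : ℕ) :
    LocalizedModule (Submonoid.powers f) X :=
  LocalizedModule.mk x ⟨f ^ n, n, rfl⟩

lemma exists_frac {f : A} {X : Type*} [AddCommGroup X] [Module A X]
    (y : LocalizedModule (Submonoid.powers f) X) : ∃ (x : X) (n : ℕ), y = frac x n := by
  induction y using LocalizedModule.induction_on with
  | _ x s =>
    obtain ⟨_, n, rfl⟩ := s
    exact ⟨x, n, rfl⟩

lemma frac_add {f : A} {X : Type*} [AddCommGroup X] [Module A X] (x y : X) (n m : ℕ) :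
    (frac x n : LocalizedModule (Submonoid.powers f) X) + frac y m =
      frac (f ^ m • x + f ^ n • y) (n + m) := by
  rw [mk_add_mk]
  congr 1
  exact Subtype.ext (pow_add f n m).symm

lemma frac_add_same {f : A} {X : Type*} [AddCommGroup X] [Module A X] (x y : X) (n : ℕ) :
    (frac (x + y) n : LocalizedModule (Submonoid.powers f) X) = frac x n + frac y n := by
  rw [mk_add_mk, ← smul_add, LocalizedModule.mk_cancel_common_left]

variable [SetLike.GradedMonoid 𝒜] {f : A} {e : ℤ}

lemma pow_mem_deg (hf : f ∈ 𝒜 e) (n : ℕ) : f ^ n ∈ 𝒜 (n * e) := by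
  simpa using SetLike.pow_mem_graded n hf

lemma frac_proj_eq (M : GrMod 𝒜) (hf : f ∈ 𝒜 e) (i : ℤ)
    {x y : M} {s t : Submonoid.powers f} (h : LocalizedModule.mk x s = LocalizedModule.mk y t)
    {n m : ℕ} (hn : f ^ n = s) (hm : f ^ m = t) :
    LocalizedModule.mk (M.proj (n * e + i) x) s = LocalizedModule.mk (M.proj (m * e + i) y) t := by
  rw [mk_eq] at h ⊢
  obtain ⟨⟨_, k, rfl⟩, h⟩ := h
  refine ⟨⟨f ^ k, k, rfl⟩, ?_⟩
  obtain ⟨_, hs⟩ := s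
  obtain ⟨_, ht⟩ := t
  dsimp only at hn hm
  subst hn hm
  simp only [Submonoid.smul_def] at h ⊢
  have hp := fun l => pow_mem_deg hf l
  rw [← M.proj_smul (hp m), ← M.proj_smul (hp n), ← M.proj_smul (hp k), ← M.proj_smul (hp k), h]
  congr 2
  ring

/-- The subgroup of `M_f` of the elements of degree `i`: the fractions `m / f ^ n` with
`m ∈ M_{i + n e}`, where `e` is the degree of `f`. -/
def locDeg (hf : f ∈ 𝒜 e) (M : GrMod 𝒜) (i : ℤ) :
    AddSubgroup (LocalizedModule (Submonoid.powers f) M) where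
  carrier := {x | ∃ (n : ℕ) (m : M), m ∈ M.deg (n * e + i) ∧ x = frac m n}
  zero_mem' := ⟨0, 0, zero_mem _, (zero_mk _).symm⟩
  neg_mem' := by
    rintro _ ⟨n, m, hm, rfl⟩
    exact ⟨n, -m, neg_mem hm, mk_neg.symm⟩
  add_mem' := by
    rintro _ _ ⟨n, m, hm, rfl⟩ ⟨n', m', hm', rfl⟩
    refine ⟨n + n', f ^ n' • m + f ^ n • m', add_mem ?_ ?_, frac_add _ _ _ _⟩
    · have := M.smul_mem (pow_mem_deg hf n') hm
      rwa [show (n' : ℤ) * e + (n * e + i) = (n + n' : ℕ) * e + i by push_cast; ring] at this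
    · have := M.smul_mem (pow_mem_deg hf n) hm'
      rwa [show (n : ℤ) * e + (n' * e + i) = (n + n' : ℕ) * e + i by push_cast; ring] at this

/-- The underlying function of the projection of `M_f` onto its component of degree `i`. -/
def locProjFun (hf : f ∈ 𝒜 e) (M : GrMod 𝒜) (i : ℤ)
    (x : LocalizedModule (Submonoid.powers f) M) : LocalizedModule (Submonoid.powers f) M :=
  x.liftOn (fun p => LocalizedModule.mk (M.proj (p.2.2.choose * e + i) p.1) p.2)
    (fun p q h => M.frac_proj_eq hf i (mk_eq.2 h) p.2.2.choose_spec q.2.2.choose_spec)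

lemma locProjFun_frac (hf : f ∈ 𝒜 e) (M : GrMod 𝒜) (i : ℤ) (x : M) (n : ℕ) :
    locProjFun hf M i (frac x n) = frac (M.proj (n * e + i) x) n :=
  M.frac_proj_eq hf i (x := x) (s := ⟨f ^ n, n, rfl⟩) rfl
    (⟨f ^ n, n, rfl⟩ : Submonoid.powers f).2.choose_spec rfl

/-- The projection of `M_f` onto its component of degree `i`. -/
def locProj (hf : f ∈ 𝒜 e) (M : GrMod 𝒜) (i : ℤ) :
    LocalizedModule (Submonoid.powers f) M →+ LocalizedModule (Submonoid.powers f) M :=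
  AddMonoidHom.mk' (locProjFun hf M i) (by
    intro x y
    obtain ⟨x, n, rfl⟩ := exists_frac x
    obtain ⟨y, m, rfl⟩ := exists_frac y
    rw [frac_add, locProjFun_frac, locProjFun_frac, locProjFun_frac, frac_add, map_add,
      ← M.proj_smul (pow_mem_deg hf n), ← M.proj_smul (pow_mem_deg hf m)]
    congr 4 <;> · push_cast; ring)

lemma locProj_frac (hf : f ∈ 𝒜 e) (M : GrMod 𝒜) (i : ℤ) (x : M) (n : ℕ) :
    locProj hf M i (frac x n) = frac (M.proj (n * e + i) x) n :=
  locProjFun_frac hf M i x n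

/-- The localization `M_f` of a graded module at a homogeneous element `f` of degree `e`. -/
def locObj (hf : f ∈ 𝒜 e) (M : GrMod 𝒜) : GrMod 𝒜 where
  carrier := LocalizedModule (Submonoid.powers f) M
  deg := locDeg hf M
  isInternal := by
    refine isInternal_of_proj _ (locProj hf M) ?_ ?_ ?_
    · rintro i _ ⟨n, m, hm, rfl⟩
      rw [locProj_frac, M.proj_of_mem hm]
    · rintro i j _ ⟨n, m, hm, rfl⟩ h
      rw [locProj_frac, M.proj_of_mem_ne hm (by omega)]
      exact zero_mk _
    · intro x
      obtain ⟨x, n, rfl⟩ := exists_frac x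
      induction M.mem_closure x using AddSubgroup.closure_induction with
      | mem y hy =>
        obtain ⟨j, hj⟩ := hy
        refine AddSubgroup.subset_closure ⟨j - n * e, n, y, ?_, rfl⟩
        rwa [add_sub_cancel]
      | zero => rw [frac, zero_mk]; exact zero_mem _
      | add y z _ _ hy hz =>
        rw [frac_add_same]
        exact add_mem hy hz
      | neg y _ hy =>
        have : (frac (-y) n : LocalizedModule (Submonoid.powers f) M) = -frac y n := mk_neg
        rw [this]
        exact neg_mem hy
  smul_mem := by
    rintro i j a _ ha ⟨n, m, hm, rfl⟩
    refine ⟨n, a • m, ?_, smul'_mk _ _ _⟩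
    have := M.smul_mem ha hm
    rwa [show i + (n * e + j) = n * e + (i + j) by ring] at this

/-- The map `M_f ⟶ N_f` induced by a morphism of graded modules. -/
def locMap (hf : f ∈ 𝒜 e) {M N : GrMod 𝒜} (g : M ⟶ N) : locObj hf M ⟶ locObj hf N where
  lin := IsLocalizedModule.map (Submonoid.powers f)
    (LocalizedModule.mkLinearMap (Submonoid.powers f) M)
    (LocalizedModule.mkLinearMap (Submonoid.powers f) N) g.lin
  map_deg := by
    rintro i _ ⟨n, m, hm, rfl⟩
    exact ⟨n, g.lin m, g.map_deg hm, IsLocalizedModule.map_LocalizedModules _ _ _ _⟩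

lemma locMap_frac (hf : f ∈ 𝒜 e) {M N : GrMod 𝒜} (g : M ⟶ N) (x : M) (n : ℕ) :
    (locMap hf g).lin (frac x n) = frac (g.lin x) n :=
  IsLocalizedModule.map_LocalizedModules _ _ _ _

lemma loc_hom_ext (hf : f ∈ 𝒜 e) {M N : GrMod 𝒜} {g h : locObj hf M ⟶ N}
    (H : ∀ (x : M) (n : ℕ), g.lin (frac x n) = h.lin (frac x n)) : g = h := by
  ext y
  obtain ⟨x, n, rfl⟩ := exists_frac (f := f) y
  exact H x n

/-- Localization at a homogeneous element, as a functor. -/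
def loc (hf : f ∈ 𝒜 e) : GrMod 𝒜 ⥤ GrMod 𝒜 where
  obj := locObj hf
  map g := locMap hf g
  map_id M := loc_hom_ext hf fun x n => locMap_frac hf _ x n
  map_comp g h := loc_hom_ext hf fun x n => by
    refine (locMap_frac hf (g ≫ h) x n).trans ?_
    refine ((locMap_frac hf h _ n).symm.trans ?_)
    exact congrArg (locMap hf h).lin (locMap_frac hf g x n).symm

lemma loc_map_frac (hf : f ∈ 𝒜 e) {M N : GrMod 𝒜} (g : M ⟶ N) (x : M) (n : ℕ) :
    ((loc hf).map g).lin (frac x n) = frac (g.lin x) n :=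
  locMap_frac hf g x n

instance (hf : f ∈ 𝒜 e) : (loc hf).Additive where
  map_add {_ _ g h} := loc_hom_ext hf fun x n =>
    (locMap_frac hf (g + h) x n).trans ((frac_add_same _ _ n).trans
      (congrArg₂ (· + ·) (locMap_frac hf g x n) (locMap_frac hf h x n)).symm)

variable {f' : A} {e' : ℤ}

lemma isUnit_of_dvd (h : f ∣ f') (X : Type*) [AddCommGroup X] [Module A X]
    (s : Submonoid.powers f) :
    IsUnit (algebraMap A (Module.End A (LocalizedModule (Submonoid.powers f') X)) s) := by
  obtain ⟨_, n, rfl⟩ := s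
  obtain ⟨g, rfl⟩ := h
  have := IsLocalizedModule.map_units (LocalizedModule.mkLinearMap (Submonoid.powers (f * g)) X)
    (⟨(f * g) ^ n, n, rfl⟩ : Submonoid.powers (f * g))
  change IsUnit (algebraMap A (Module.End A _) ((f * g) ^ n)) at this
  rw [mul_pow, map_mul] at this
  exact (((Commute.all (f ^ n) (g ^ n)).map (algebraMap A _)).isUnit_mul_iff.1 this).1

lemma lift_frac (g : A) (h : f * g = f') (X : Type*) [AddCommGroup X] [Module A X] (x : X) (n : ℕ) :
    LocalizedModule.lift (Submonoid.powers f)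
      (LocalizedModule.mkLinearMap (Submonoid.powers f') X) (isUnit_of_dvd ⟨g, h.symm⟩ X)
      (frac x n) = frac (g ^ n • x) n := by
  subst h
  rw [LocalizedModule.lift_mk, Module.End.algebraMap_isUnit_inv_apply_eq_iff,
    LocalizedModule.mkLinearMap_apply, smul'_mk, mk_eq]
  refine ⟨1, ?_⟩
  simp only [one_smul, Submonoid.smul_def, smul_smul, mul_pow]

/-- For `f' = f g`, the canonical map `M_f ⟶ M_{f'}`, `x / f ^ n ↦ g ^ n x / f' ^ n`. -/
def locTransApp (hf : f ∈ 𝒜 e) (hf' : f' ∈ 𝒜 e') {g : A} {eg : ℤ} (hg : g ∈ 𝒜 eg)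
    (h : f * g = f') (he : e + eg = e') (M : GrMod 𝒜) : locObj hf M ⟶ locObj hf' M where
  lin := LocalizedModule.lift (Submonoid.powers f)
    (LocalizedModule.mkLinearMap (Submonoid.powers f') M) (isUnit_of_dvd ⟨g, h.symm⟩ M)
  map_deg := by
    rintro i _ ⟨n, m, hm, rfl⟩
    refine ⟨n, g ^ n • m, ?_, lift_frac g h _ _ _⟩
    have := M.smul_mem (pow_mem_deg hg n) hm
    rwa [show (n : ℤ) * eg + (n * e + i) = n * e' + i by rw [← he]; ring] at this

lemma locTransApp_frac (hf : f ∈ 𝒜 e) (hf' : f' ∈ 𝒜 e') {g : A} {eg : ℤ} (hg : g ∈ 𝒜 eg)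
    (h : f * g = f') (he : e + eg = e') (M : GrMod 𝒜) (x : M) (n : ℕ) :
    (locTransApp hf hf' hg h he M).lin (frac x n) = frac (g ^ n • x) n :=
  lift_frac g h _ _ _

/-- The maps `M_f ⟶ M_{f'}` as a natural transformation. -/
def locTrans (hf : f ∈ 𝒜 e) (hf' : f' ∈ 𝒜 e') {g : A} {eg : ℤ} (hg : g ∈ 𝒜 eg)
    (h : f * g = f') (he : e + eg = e') : loc hf ⟶ loc hf' where
  app M := locTransApp hf hf' hg h he M
  naturality M N k := loc_hom_ext hf fun x n => by
    change (locTransApp hf hf' hg h he N).lin ((locMap hf k).lin (frac x n)) =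
      (locMap hf' k).lin ((locTransApp hf hf' hg h he M).lin (frac x n))
    refine (congrArg _ (locMap_frac hf k x n)).trans ?_
    refine (locTransApp_frac hf hf' hg h he N _ n).trans ?_
    refine Eq.trans ?_ (congrArg _ (locTransApp_frac hf hf' hg h he M x n).symm)
    refine Eq.trans ?_ (locMap_frac hf' k _ n).symm
    rw [map_smul]

lemma locTrans_frac (hf : f ∈ 𝒜 e) (hf' : f' ∈ 𝒜 e') {g : A} {eg : ℤ} (hg : g ∈ 𝒜 eg)
    (h : f * g = f') (he : e + eg = e') (M : GrMod 𝒜) (x : M) (n : ℕ) :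
    ((locTrans hf hf' hg h he).app M).lin (frac x n) = frac (g ^ n • x) n :=
  lift_frac g h _ _ _

/-- Localization preserves exactness. -/
lemma loc_exact (hf : f ∈ 𝒜 e) (S : ShortComplex (GrMod 𝒜)) (hS : S.Exact) :
    (S.map (loc hf)).Exact := by
  rw [exact_iff] at hS ⊢
  have : Function.Exact S.f.lin S.g.lin := fun x =>
    ⟨hS x, by rintro ⟨y, rfl⟩; exact comp_apply_zero S.zero y⟩
  exact fun x hx => (LocalizedModule.map_exact (Submonoid.powers f) _ _ this x).1 hx

end GrMod

/-! ### Čech complexes -/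

/-- The functor to cochain complexes given by a cochain complex of functors. -/
def complexOfFunctors {C D : Type*} [Category C] [Category D] [Preadditive D]
    (T : ℕ → C ⥤ D) (δ : ∀ m, T m ⟶ T (m + 1)) (h : ∀ m, δ m ≫ δ (m + 1) = 0) :
    C ⥤ CochainComplex D ℕ where
  obj X := CochainComplex.of (fun m => (T m).obj X) (fun m => (δ m).app X)
    (fun m => congrArg (fun k => NatTrans.app k X) (h m))
  map g := CochainComplex.ofHom (fun m => (T m).map g) (fun m => by simp)

section Cech

variable {A : Type u} [CommRing A] {𝒜 : ℤ → AddSubgroup A} [SetLike.GradedMonoid 𝒜]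
  {r : ℕ} {f : Fin r → A} {d : Fin r → ℤ} (hf : ∀ i, f i ∈ 𝒜 (d i))

namespace Cech

open GrMod

/-- The product `f_{i₀} ⋯ f_{i_{m-1}}` for a strictly increasing sequence `i₀ < ⋯ < i_{m-1}`. -/
def prodF (f : Fin r → A) {m : ℕ} (s : Fin m ↪o Fin r) : A := ∏ j, f (s j)

lemma prodF_mem (hf : ∀ i, f i ∈ 𝒜 (d i)) {m : ℕ} (s : Fin m ↪o Fin r) : prodF f s ∈ 𝒜 (∑ j, d (s j)) :=
  SetLike.prod_mem_graded _ _ _ fun j _ => hf (s j)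

/-- The term `M ↦ ∏_{i₀ < ⋯ < i_{m-1}} M_{f_{i₀} ⋯ f_{i_{m-1}}}` of the extended Čech complex. For `m = 0`
it is the localization `M_1` of `M` at the empty product, which is `M` itself up to the canonical
isomorphism. -/
def term (m : ℕ) : GrMod 𝒜 ⥤ GrMod 𝒜 where
  obj M := GrMod.pi fun s : Fin m ↪o Fin r => (loc (prodF_mem hf s)).obj M
  map g := 
    { lin := LinearMap.pi fun s => ((loc (prodF_mem hf s)).map g).lin ∘ₗ LinearMap.proj s
      map_deg := fun hx s _ => ((loc (prodF_mem hf s)).map g).map_deg (hx s trivial) }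
  map_id M := by
    ext x
    funext s
    exact congrArg (fun k => Hom.lin k (x s)) ((loc (prodF_mem hf s)).map_id M)
  map_comp g h := by
    ext x
    funext s
    exact congrArg (fun k => Hom.lin k (x s)) ((loc (prodF_mem hf s)).map_comp g h)

instance (m : ℕ) : (term hf m).Additive where
  map_add {M N g h} := by
    ext x
    funext s
    exact congrArg (fun k => Hom.lin k (x s)) ((loc (prodF_mem hf s)).map_add)

lemma term_exact (m : ℕ) (S : ShortComplex (GrMod 𝒜)) (hS : S.Exact) :
    (S.map (term hf m)).Exact := by
  rw [exact_iff]
  intro x hx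
  have := fun s => (exact_iff _).1 (loc_exact (prodF_mem hf s) S hS) (x s) (congrFun hx s)
  choose y hy using this
  exact ⟨y, funext hy⟩

/-- The strictly increasing sequence `i₀ < ⋯ < î_j < ⋯ < i_m`. -/
def face {m : ℕ} (s : Fin (m + 1) ↪o Fin r) (j : Fin (m + 1)) : Fin m ↪o Fin r :=
  (Fin.succAboveOrderEmb j).trans s

lemma prodF_face {m : ℕ} (s : Fin (m + 1) ↪o Fin r) (j : Fin (m + 1)) :
    prodF f (face s j) * f (s j) = prodF f s := by
  rw [prodF, prodF, Fin.prod_univ_succAbove _ j, mul_comm]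
  rfl

lemma sum_face (d : Fin r → ℤ) {m : ℕ} (s : Fin (m + 1) ↪o Fin r) (j : Fin (m + 1)) :
    (∑ k, d (face s j k)) + d (s j) = ∑ k, d (s k) := by
  rw [Fin.sum_univ_succAbove _ j, add_comm]
  rfl

/-- The localization map `M_{f_{i₀} ⋯ f̂_{i_j} ⋯ f_{i_m}} ⟶ M_{f_{i₀} ⋯ f_{i_m}}`. -/
def faceMap {m : ℕ} (s : Fin (m + 1) ↪o Fin r) (j : Fin (m + 1)) :
    loc (prodF_mem hf (face s j)) ⟶ loc (prodF_mem hf s) :=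
  locTrans _ _ (hf (s j)) (prodF_face s j) (sum_face d s j)

/-- The components of the differential of the extended Čech complex. -/
def diffApp (m : ℕ) (M : GrMod 𝒜) : (term hf m).obj M ⟶ (term hf (m + 1)).obj M where
  lin := LinearMap.pi fun s : Fin (m + 1) ↪o Fin r => ∑ j : Fin (m + 1),
    (-1 : ℤ) ^ (j : ℕ) • (((faceMap hf s j).app M).lin ∘ₗ LinearMap.proj (face s j))
  map_deg := by
    intro i x hx s _
    change (∑ j : Fin (m + 1), _ : _ →ₗ[A] _) x ∈ _
    rw [LinearMap.sum_apply]
    exact sum_mem fun j _ => zsmul_mem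
      (((faceMap hf s j).app M).map_deg (hx (face s j) trivial)) _

lemma diffApp_apply {m : ℕ} (M : GrMod 𝒜) (x : (term hf m).obj M) (s : Fin (m + 1) ↪o Fin r) :
    (diffApp hf m M).lin x s =
      ∑ j : Fin (m + 1), (-1 : ℤ) ^ (j : ℕ) • ((faceMap hf s j).app M).lin (x (face s j)) := by
  refine (LinearMap.sum_apply _ _ _).trans ?_
  rfl

/-- The differential `d^m = ∑_j (-1)^j d_j^m` of the extended Čech complex, where `d_j^m` is made up
of the localization maps that adjoin `f_{i_j}`. -/
def diff (m : ℕ) : term hf m ⟶ term hf (m + 1) where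
  app M := diffApp hf m M
  naturality M N g := by
    ext x
    funext s
    refine (diffApp_apply hf N _ s).trans ?_
    refine Eq.trans ?_ (congrArg (locMap (prodF_mem hf s) g).lin (diffApp_apply hf M x s)).symm
    refine Eq.trans ?_ (map_sum (locMap (prodF_mem hf s) g).lin _ _).symm
    refine Finset.sum_congr rfl fun j _ => ?_
    refine Eq.trans ?_ (map_zsmul (locMap (prodF_mem hf s) g).lin _ _).symm
    exact congrArg (fun k => (-1 : ℤ) ^ (j : ℕ) • Hom.lin k (x (face s j)))
      ((faceMap hf s j).naturality g)

lemma diff_app {m : ℕ} (M : GrMod 𝒜) (x : (term hf m).obj M) (s : Fin (m + 1) ↪o Fin r) :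
    ((diff hf m).app M).lin x s =
      ∑ j : Fin (m + 1), (-1 : ℤ) ^ (j : ℕ) • ((faceMap hf s j).app M).lin (x (face s j)) :=
  diffApp_apply hf M x s

/-- The localization map from the factor of index `t` to the factor of index `s`. -/
def transLin {m n : ℕ} (s : Fin n ↪o Fin r) (t : Fin m ↪o Fin r) (h : prodF f t ∣ prodF f s)
    (M : GrMod 𝒜) : (loc (prodF_mem hf t)).obj M →ₗ[A] (loc (prodF_mem hf s)).obj M :=
  LocalizedModule.lift (Submonoid.powers (prodF f t))
    (LocalizedModule.mkLinearMap (Submonoid.powers (prodF f s)) M) (isUnit_of_dvd h M)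

lemma transLin_congr {m n : ℕ} {s : Fin n ↪o Fin r} {t t' : Fin m ↪o Fin r} (e : t = t')
    (h : prodF f t ∣ prodF f s) (h' : prodF f t' ∣ prodF f s) (M : GrMod 𝒜)
    (x : (term hf m).obj M) :
    transLin hf s t h M (x t) = transLin hf s t' h' M (x t') := by
  subst e
  rfl

lemma faceMap_faceMap {m : ℕ} (s : Fin (m + 2) ↪o Fin r) (j : Fin (m + 2)) (k : Fin (m + 1))
    (h : prodF f (face (face s j) k) ∣ prodF f s)
    (M : GrMod 𝒜) (x : (loc (prodF_mem hf (face (face s j) k))).obj M) :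
    ((faceMap hf s j).app M).lin (((faceMap hf (face s j) k).app M).lin x) =
      transLin hf s (face (face s j) k) h M x := by
  obtain ⟨x, n, rfl⟩ := exists_frac (f := prodF f (face (face s j) k)) x
  refine (congrArg _ (locTrans_frac _ _ _ _ _ M x n)).trans ?_
  refine (locTrans_frac _ _ _ _ _ M _ n).trans ?_
  refine Eq.trans ?_ (lift_frac (f (face s j k) * f (s j)) ?_ M x n).symm
  · rw [mul_comm, mul_pow, mul_smul]
  · rw [← mul_assoc, prodF_face, prodF_face]

lemma diff_comp (m : ℕ) : diff hf m ≫ diff hf (m + 1) = 0 := by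
  ext M x
  funext s
  have hdvd : ∀ j k, prodF f (face (face s j) k) ∣ prodF f s := fun j k =>
    ⟨f (face s j k) * f (s j), by rw [← mul_assoc, prodF_face, prodF_face]⟩
  let V : Fin (m + 2) × Fin (m + 1) → (loc (prodF_mem hf s)).obj M := fun p =>
    (-1 : ℤ) ^ ((p.1 : ℕ) + (p.2 : ℕ)) •
      transLin hf s (face (face s p.1) p.2) (hdvd p.1 p.2) M (x (face (face s p.1) p.2))
  have h₁ : ((diff hf (m + 1)).app M).lin (((diff hf m).app M).lin x) s = ∑ p, V p := by
    rw [diff_app, Fintype.sum_prod_type]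
    refine Finset.sum_congr rfl fun j _ => ?_
    rw [diff_app, map_sum, Finset.smul_sum]
    refine Finset.sum_congr rfl fun k _ => ?_
    rw [map_zsmul, faceMap_faceMap hf s j k (hdvd j k), smul_smul, ← pow_add]
  refine h₁.trans ?_
  refine Finset.sum_involution (fun p _ => (p.1.succAbove p.2, p.2.predAbove p.1)) ?_ ?_ ?_ ?_
  · rintro ⟨j, k⟩ -
    have e : face (face s (j.succAbove k)) (k.predAbove j) = face (face s j) k := by
      ext l
      exact congrArg (fun i => (s i : ℕ)) (Fin.succAbove_succAbove_succAbove_predAbove j k l)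
    change (-1 : ℤ) ^ _ • _ + (-1 : ℤ) ^ _ • _ = 0
    rw [transLin_congr hf e _ (hdvd j k), ← add_smul, Fin.neg_one_pow_succAbove_add_predAbove]
    simp
  · rintro ⟨j, k⟩ - -
    exact fun h => Fin.succAbove_ne j k (congrArg Prod.fst h)
  · intros; exact Finset.mem_univ _
  · rintro ⟨j, k⟩ -
    exact Prod.ext (Fin.succAbove_succAbove_predAbove j k) (Fin.predAbove_predAbove_succAbove j k)

/-- The functor `M ↦ RΓ_{(f)}(M) = [M ⟶ ∏ M_{f_{i₀}} ⟶ ∏_{i₀ < i₁} M_{f_{i₀} f_{i₁}} ⟶ ⋯]`, the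
extended Čech complex, with `M` in degree `0`. -/
def ext : GrMod 𝒜 ⥤ CochainComplex (GrMod 𝒜) ℕ :=
  complexOfFunctors (term hf) (diff hf) (diff_comp hf)

/-- The functor `M ↦ Č_{(f)}(M) = [∏ M_{f_{i₀}} ⟶ ∏_{i₀ < i₁} M_{f_{i₀} f_{i₁}} ⟶ ⋯]`, the Čech
complex, with `∏ M_{f_{i₀}}` in degree `0`. It is the part of positive degree of the extended Čech
complex, shifted by one; in particular its differential is the negative of that one. -/
def cech : GrMod 𝒜 ⥤ CochainComplex (GrMod 𝒜) ℕ :=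
  complexOfFunctors (fun q => term hf (q + 1)) (fun q => -diff hf (q + 1)) (fun q => by
    rw [Preadditive.neg_comp, Preadditive.comp_neg, neg_neg, diff_comp])

instance : (ext hf).Additive where
  map_add := by
    intros
    ext m : 1
    exact (term hf m).map_add

instance : (cech hf).Additive where
  map_add := by
    intros
    ext m : 1
    exact (term hf (m + 1)).map_add

lemma ext_exact (q : ℕ) (S : ShortComplex (GrMod 𝒜)) (hS : S.Exact) :
    (S.map (ext hf ⋙ HomologicalComplex.eval _ _ q)).Exact :=
  term_exact hf q S hS

lemma cech_exact (q : ℕ) (S : ShortComplex (GrMod 𝒜)) (hS : S.Exact) :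
    (S.map (cech hf ⋙ HomologicalComplex.eval _ _ q)).Exact :=
  term_exact hf (q + 1) S hS

end Cech

end Cech

/-! ### Total complexes -/

namespace Tot

attribute [local instance] Abelian.hasFiniteBiproducts

variable {C D : Type*} [Category C] [Category D] [Abelian C] [Abelian D]
  (N : ℕ) (F : C ⥤ CochainComplex D ℕ)

/-- The pairs `(p, q)` with `p + q = n` and `0 ≤ q ≤ N`. -/
abbrev Idx (N : ℕ) (n : ℤ) : Type := {i : ℤ × Fin (N + 1) // i.1 + ((i.2 : ℕ) : ℤ) = n}

instance (n : ℤ) : Finite (Idx N n) :=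
  Finite.of_injective (fun i : Idx N n => i.1.2) (by
    rintro ⟨⟨p, q⟩, h⟩ ⟨⟨p', q'⟩, h'⟩ (e : q = q')
    subst e
    dsimp only at h h'
    obtain rfl : p = p' := by omega
    rfl)

/-- The term `⨁_{p + q = n} F(K^p)^q`. -/
abbrev X (K : CochainComplex C ℤ) (n : ℤ) : D := ⨁ fun i : Idx N n => (F.obj (K.X i.1.1)).X i.1.2

/-- The projection to the summand `F(K^p)^q`; it is zero if there is no such summand. -/
def proj (K : CochainComplex C ℤ) (n p : ℤ) (q : ℕ) : X N F K n ⟶ (F.obj (K.X p)).X q :=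
  if h : q < N + 1 ∧ p + q = n then
    biproduct.π (fun i : Idx N n => (F.obj (K.X i.1.1)).X i.1.2) ⟨(p, ⟨q, h.1⟩), h.2⟩
  else 0

/-- The morphism with given components. -/
def lift (K : CochainComplex C ℤ) (n : ℤ) {T : D} (g : ∀ p q, T ⟶ (F.obj (K.X p)).X q) :
    T ⟶ X N F K n :=
  biproduct.lift fun i => g i.1.1 i.1.2

/-- The inclusion of the summand `F(K^p)^q`; it is zero if there is no such summand. -/
def incl (K : CochainComplex C ℤ) (n p : ℤ) (q : ℕ) : (F.obj (K.X p)).X q ⟶ X N F K n :=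
  if h : q < N + 1 ∧ p + q = n then
    biproduct.ι (fun i : Idx N n => (F.obj (K.X i.1.1)).X i.1.2) ⟨(p, ⟨q, h.1⟩), h.2⟩
  else 0

variable {N F} {K : CochainComplex C ℤ} {n p : ℤ} {q : ℕ}

lemma proj_eq_π (hq : q < N + 1) (h : p + q = n) : proj N F K n p q =
    biproduct.π (fun i : Idx N n => (F.obj (K.X i.1.1)).X i.1.2) ⟨(p, ⟨q, hq⟩), h⟩ :=
  dif_pos ⟨hq, h⟩

lemma incl_eq_ι (hq : q < N + 1) (h : p + q = n) : incl N F K n p q =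
    biproduct.ι (fun i : Idx N n => (F.obj (K.X i.1.1)).X i.1.2) ⟨(p, ⟨q, hq⟩), h⟩ :=
  dif_pos ⟨hq, h⟩

lemma proj_eq_zero (h : ¬(q < N + 1 ∧ p + q = n)) : proj N F K n p q = 0 := dif_neg h

lemma incl_eq_zero (h : ¬(q < N + 1 ∧ p + q = n)) : incl N F K n p q = 0 := dif_neg h

lemma lift_proj {T : D} (g : ∀ p q, T ⟶ (F.obj (K.X p)).X q) (hq : q < N + 1) (h : p + q = n) :
    lift N F K n g ≫ proj N F K n p q = g p q :=
  (congrArg (lift N F K n g ≫ ·) (proj_eq_π hq h)).trans (biproduct.lift_π _ _)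

lemma hom_ext {T : D} {g g' : T ⟶ X N F K n}
    (h : ∀ p q, q < N + 1 → p + q = n → g ≫ proj N F K n p q = g' ≫ proj N F K n p q) :
    g = g' := by
  refine biproduct.hom_ext _ _ ?_
  rintro ⟨⟨p, q⟩, hi⟩
  have e := proj_eq_π (N := N) (F := F) (K := K) q.2 hi
  exact (congrArg (g ≫ ·) e).symm.trans ((h p q q.2 hi).trans (congrArg (g' ≫ ·) e))

lemma incl_proj_self (hq : q < N + 1) (h : p + q = n) :
    incl N F K n p q ≫ proj N F K n p q = 𝟙 _ :=
  (congrArg₂ (· ≫ ·) (incl_eq_ι hq h) (proj_eq_π hq h)).trans (biproduct.ι_π_self _ _)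

lemma incl_proj_ne {p' : ℤ} {q' : ℕ} (h : q ≠ q') :
    incl N F K n p q ≫ proj N F K n p' q' = 0 := by
  by_cases h₁ : q < N + 1 ∧ p + q = n
  · by_cases h₂ : q' < N + 1 ∧ p' + q' = n
    · exact (congrArg₂ (· ≫ ·) (incl_eq_ι h₁.1 h₁.2) (proj_eq_π h₂.1 h₂.2)).trans
        (biproduct.ι_π_ne _ fun e => h (congrArg (fun i : Idx N n => (i.1.2 : ℕ)) e))
    · rw [proj_eq_zero h₂, comp_zero]
  · rw [incl_eq_zero h₁, zero_comp]

variable (N F)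

/-- The differential of the total complex: `d_h + (-1)^p d_v` on `F(K^p)^q`. -/
def d (K : CochainComplex C ℤ) (n n' : ℤ) : X N F K n ⟶ X N F K n' :=
  lift N F K n' fun p q =>
    proj N F K n (p - 1) q ≫ (F.map (K.d (p - 1) p)).f q +
      (p.negOnePow : ℤ) • proj N F K n p (q - 1) ≫ (F.obj (K.X p)).d (q - 1) q

variable {N F}

lemma d_proj {n' : ℤ} (hq : q < N + 1) (h : p + q = n') :
    d N F K n n' ≫ proj N F K n' p q =
      proj N F K n (p - 1) q ≫ (F.map (K.d (p - 1) p)).f q +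
        (p.negOnePow : ℤ) • proj N F K n p (q - 1) ≫ (F.obj (K.X p)).d (q - 1) q :=
  lift_proj _ hq h

variable (N F)

variable {N F} in
lemma d_proj_assoc {K : CochainComplex C ℤ} {n n' p : ℤ} {q : ℕ} (hq : q < N + 1)
    (h : p + q = n') {T : D} (g : (F.obj (K.X p)).X q ⟶ T) :
    d N F K n n' ≫ proj N F K n' p q ≫ g =
      (proj N F K n (p - 1) q ≫ (F.map (K.d (p - 1) p)).f q +
        (p.negOnePow : ℤ) • proj N F K n p (q - 1) ≫ (F.obj (K.X p)).d (q - 1) q) ≫ g := by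
  rw [← d_proj hq h, Category.assoc]

/-- The components of the map of total complexes induced by a map of complexes. -/
def mapX {K L : CochainComplex C ℤ} (φ : K ⟶ L) (n : ℤ) : X N F K n ⟶ X N F L n :=
  lift N F L n fun p q => proj N F K n p q ≫ (F.map (φ.f p)).f q

variable {N F} in
lemma mapX_proj {K L : CochainComplex C ℤ} (φ : K ⟶ L) (n p : ℤ) (q : ℕ) :
    mapX N F φ n ≫ proj N F L n p q = proj N F K n p q ≫ (F.map (φ.f p)).f q := by
  by_cases h : q < N + 1 ∧ p + q = n
  · exact lift_proj _ h.1 h.2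
  · rw [proj_eq_zero h, proj_eq_zero h, comp_zero, zero_comp]

variable {N F} in
lemma mapX_proj_assoc {K L : CochainComplex C ℤ} (φ : K ⟶ L) (n p : ℤ) (q : ℕ) {T : D}
    (g : (F.obj (L.X p)).X q ⟶ T) :
    mapX N F φ n ≫ proj N F L n p q ≫ g =
      proj N F K n p q ≫ (F.map (φ.f p)).f q ≫ g := by
  rw [← Category.assoc, mapX_proj, Category.assoc]

variable {N F} in
lemma comp_d_proj_of_forall_lt {K : CochainComplex C ℤ} {T : D} {n n' p p' : ℤ} {j : ℕ}
    (g : T ⟶ X N F K n) (hg : ∀ q < j, ∀ p, g ≫ proj N F K n p q = 0) (hj : j < N + 1)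
    (hp : p + j = n') (hp' : p' + 1 = p) :
    g ≫ d N F K n n' ≫ proj N F K n' p j =
      g ≫ proj N F K n p' j ≫ (F.map (K.d p' p)).f j := by
  obtain rfl : p' = p - 1 := by omega
  rw [d_proj hj hp, Preadditive.comp_add, Preadditive.comp_zsmul]
  suffices g ≫ proj N F K n p (j - 1) ≫ (F.obj (K.X p)).d (j - 1) j = 0 by
    rw [this, smul_zero, add_zero]
  cases j with
  | zero => simp
  | succ j => rw [reassoc_of% (hg (j + 1 - 1) (by omega) p), zero_comp]

/-- The columns of the map of double complexes induced by `φ` have acyclic mapping cones. -/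
def ColAcyclic {K L : CochainComplex C ℤ} (φ : K ⟶ L) : Prop :=
  ∀ (q : ℕ) ⦃T : D⦄ (l m n o : ℤ), l + 1 = m → m + 1 = n → n + 1 = o →
    ∀ (x : T ⟶ (F.obj (K.X n)).X q) (y : T ⟶ (F.obj (L.X m)).X q),
      x ≫ (F.map (K.d n o)).f q = 0 → x ≫ (F.map (φ.f n)).f q = y ≫ (F.map (L.d m n)).f q →
      ∃ (T' : D) (π : T' ⟶ T) (_ : Epi π) (x' : T' ⟶ (F.obj (K.X m)).X q)
        (y' : T' ⟶ (F.obj (L.X l)).X q),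
        π ≫ x = x' ≫ (F.map (K.d m n)).f q ∧
        π ≫ y = x' ≫ (F.map (φ.f m)).f q + y' ≫ (F.map (L.d l m)).f q

variable {N F} in
lemma exists_incl {K : CochainComplex C ℤ} {T : D} (n p : ℤ) (j : ℕ) (hj : j < N + 1)
    (hp : p + j = n) (x : T ⟶ (F.obj (K.X p)).X j) :
    ∃ x' : T ⟶ X N F K n, (∀ q < j, ∀ p', x' ≫ proj N F K n p' q = 0) ∧
      x' ≫ proj N F K n p j = x :=
  ⟨x ≫ incl N F K n p j, fun q hq p => by rw [Category.assoc, incl_proj_ne hq.ne', comp_zero],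
    by rw [Category.assoc, incl_proj_self hj hp, Category.comp_id]⟩

variable {N F} in
lemma exists_refinement_step {K L : CochainComplex C ℤ} (φ : K ⟶ L) (hcol : ColAcyclic F φ)
    {l m n o : ℤ} (hlm : l + 1 = m) (hmn : m + 1 = n) (hno : n + 1 = o)
    {T : D} (x : T ⟶ X N F K n) (y : T ⟶ X N F L m)
    (hx : x ≫ d N F K n o = 0) (hxy : x ≫ mapX N F φ n = y ≫ d N F L m n) {j : ℕ}
    (hj : j < N + 1) (hx₀ : ∀ q < j, ∀ p, x ≫ proj N F K n p q = 0)
    (hy₀ : ∀ q < j, ∀ p, y ≫ proj N F L m p q = 0) :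
    ∃ (T' : D) (π : T' ⟶ T) (_ : Epi π) (x' : T' ⟶ X N F K m) (y' : T' ⟶ X N F L l),
      ∀ q < j + 1, ∀ p, (π ≫ x - x' ≫ d N F K m n) ≫ proj N F K n p q = 0 ∧
        (π ≫ y - x' ≫ mapX N F φ m - y' ≫ d N F L l m) ≫ proj N F L m p q = 0 := by
  obtain ⟨T', π, hπ, x', y', e, e'⟩ := hcol j (l - j) (m - j) (n - j) (o - j) (by omega) (by omega)
    (by omega) (x ≫ proj N F K n (n - j) j) (y ≫ proj N F L m (m - j) j)
    (by
      rw [Category.assoc, ← comp_d_proj_of_forall_lt x hx₀ hj (n' := o) (by omega) (by omega),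
        reassoc_of% hx, zero_comp])
    (by
      rw [Category.assoc, ← mapX_proj, reassoc_of% hxy,
        comp_d_proj_of_forall_lt y hy₀ hj (p' := m - j) (by omega) (by omega), Category.assoc])
  obtain ⟨x', hx', rfl⟩ := exists_incl m (m - j) j hj (by omega) x'
  obtain ⟨y', hy', rfl⟩ := exists_incl l (l - j) j hj (by omega) y'
  refine ⟨T', π, hπ, x', y', fun q hq p => ⟨?_, ?_⟩⟩
  · by_cases hp : q < N + 1 ∧ p + q = n
    · rw [Preadditive.sub_comp, Category.assoc, Category.assoc]
      rcases (show q < j ∨ q = j by omega) with h | h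
      · rw [comp_d_proj_of_forall_lt x' (fun q' h' => hx' q' (by omega)) hp.1 hp.2 (p' := p - 1)
          (by omega), hx₀ q h, comp_zero, reassoc_of% (hx' q h (p - 1)), zero_comp, sub_zero]
      · subst h
        obtain rfl : p = n - q := by omega
        rw [comp_d_proj_of_forall_lt x' hx' hj (p' := m - q) (by omega) (by omega), e,
          Category.assoc, sub_self]
    · rw [proj_eq_zero hp, comp_zero]
  · by_cases hp : q < N + 1 ∧ p + q = m
    · rw [Preadditive.sub_comp, Preadditive.sub_comp, Category.assoc, Category.assoc,
        Category.assoc, mapX_proj]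
      rcases (show q < j ∨ q = j by omega) with h | h
      · rw [comp_d_proj_of_forall_lt y' (fun q' h' => hy' q' (by omega)) hp.1 hp.2 (p' := p - 1)
          (by omega), hy₀ q h, comp_zero, reassoc_of% (hy' q h (p - 1)),
          reassoc_of% (hx' q h p), zero_comp, zero_comp, sub_zero, sub_zero]
      · subst h
        obtain rfl : p = m - q := by omega
        rw [comp_d_proj_of_forall_lt y' hy' hj (p' := l - q) (by omega) (by omega), e',
          Category.assoc, Category.assoc, add_sub_cancel_left, sub_self]
    · rw [proj_eq_zero hp, comp_zero]

variable [F.Additive]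

/-- The total complex of the double complex with terms `F(K^p)^q` for `0 ≤ q ≤ N`. -/
def obj (K : CochainComplex C ℤ) : CochainComplex D ℤ where
  X n := X N F K n
  d n n' := d N F K n n'
  shape n n' h := by
    refine hom_ext fun p q hq hn => ?_
    have h' : n + 1 ≠ n' := h
    rw [d_proj hq hn, proj_eq_zero (by omega), zero_comp, zero_comp, zero_add]
    cases q with
    | zero => rw [(F.obj (K.X p)).shape _ _ (by simp), comp_zero, smul_zero]
    | succ q =>
      rw [proj_eq_zero (by push_cast at hn; simp only [Nat.add_sub_cancel]; omega), zero_comp,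
        smul_zero]
  d_comp_d' n n' n'' h' h'' := by
    have h' : n + 1 = n' := h'
    have h'' : n' + 1 = n'' := h''
    refine hom_ext fun p q hq hn => ?_
    rw [zero_comp, Category.assoc, d_proj hq hn, Preadditive.comp_add, Preadditive.comp_zsmul,
      d_proj_assoc hq (by omega), Preadditive.add_comp, Category.assoc, ← HomologicalComplex.comp_f,
      ← F.map_comp, K.d_comp_d, F.map_zero, HomologicalComplex.zero_f, comp_zero, zero_add]
    cases q with
    | zero => simp
    | succ q =>
      rw [Nat.add_sub_cancel, d_proj_assoc (by omega) (by push_cast at hn; omega)]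
      simp only [Preadditive.add_comp, Preadditive.zsmul_comp, Category.assoc,
        HomologicalComplex.d_comp_d, comp_zero, smul_zero, add_zero,
        HomologicalComplex.Hom.comm, Int.negOnePow_sub, Int.negOnePow_one]
      simp

/-- The map of total complexes induced by a map of complexes. -/
def map {K L : CochainComplex C ℤ} (φ : K ⟶ L) : obj N F K ⟶ obj N F L where
  f n := mapX N F φ n
  comm' n n' _ := by
    refine hom_ext fun p q hq hn => ?_
    change (mapX N F φ n ≫ d N F L n n') ≫ _ = (d N F K n n' ≫ mapX N F φ n') ≫ _
    rw [Category.assoc, Category.assoc, d_proj hq hn, mapX_proj, d_proj_assoc hq hn]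
    simp only [Preadditive.comp_add, Preadditive.add_comp, Preadditive.comp_zsmul,
      Preadditive.zsmul_comp, mapX_proj_assoc, Category.assoc, ← HomologicalComplex.comp_f,
      ← F.map_comp, HomologicalComplex.Hom.comm]

/-- The functor sending a complex `K` in `C` to the total complex of the double complex
`F(K^p)^q`, `0 ≤ q ≤ N`. -/
def functor : CochainComplex C ℤ ⥤ CochainComplex D ℤ where
  obj K := obj N F K
  map φ := map N F φ
  map_id K := by
    ext n : 1
    refine hom_ext fun p q hq hn => ?_
    change mapX N F (𝟙 K) n ≫ _ = 𝟙 _ ≫ _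
    rw [mapX_proj]
    simp
  map_comp {K L M} φ ψ := by
    ext n : 1
    refine hom_ext fun p q hq hn => ?_
    change mapX N F (φ ≫ ψ) n ≫ _ = (mapX N F φ n ≫ mapX N F ψ n) ≫ _
    rw [Category.assoc, mapX_proj, mapX_proj, mapX_proj_assoc]
    simp

/-! The total complex preserves quasi-isomorphisms if `F` is exact in every degree. -/

/-- A form of the acyclicity of the mapping cone of `ψ`. -/
def ConeAcyclic {K L : CochainComplex D ℤ} (ψ : K ⟶ L) : Prop :=
  ∀ ⦃T : D⦄ (l m n o : ℤ), l + 1 = m → m + 1 = n → n + 1 = o →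
    ∀ (x : T ⟶ K.X n) (y : T ⟶ L.X m), x ≫ K.d n o = 0 → x ≫ ψ.f n = y ≫ L.d m n →
      ∃ (T' : D) (π : T' ⟶ T) (_ : Epi π) (x' : T' ⟶ K.X m) (y' : T' ⟶ L.X l),
        π ≫ x = x' ≫ K.d m n ∧ π ≫ y = x' ≫ ψ.f m + y' ≫ L.d l m

lemma quasiIso_iff_coneAcyclic {K L : CochainComplex D ℤ} (ψ : K ⟶ L) :
    QuasiIso ψ ↔ ConeAcyclic ψ := by
  have hp : ∀ i j : ℤ, i + 1 = j → (ComplexShape.up ℤ).prev j = i := fun i j h =>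
    (ComplexShape.up ℤ).prev_eq' h
  have hn : ∀ i j : ℤ, i + 1 = j → (ComplexShape.up ℤ).next i = j := fun i j h =>
    (ComplexShape.up ℤ).next_eq' h
  constructor
  · intro h T l m n o hlm hmn hno x y hx hxy
    have h₁ : Mono (HomologicalComplex.homologyMap ψ n) := inferInstance
    have h₂ : Epi (HomologicalComplex.homologyMap ψ m) := inferInstance
    rw [HomologicalComplex.mono_homologyMap_iff_up_to_refinements ψ m n o (hp _ _ hmn)
      (hn _ _ hno)] at h₁
    rw [HomologicalComplex.epi_homologyMap_iff_up_to_refinements ψ l m n (hp _ _ hlm)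
      (hn _ _ hmn)] at h₂
    obtain ⟨T₁, π₁, _, x₁, e₁⟩ := h₁ x hx y hxy
    obtain ⟨T₂, π₂, _, x₂, hx₂, y₂, e₂⟩ := h₂ (π₁ ≫ y - x₁ ≫ ψ.f m) (by
      rw [Preadditive.sub_comp, Category.assoc, ← hxy, reassoc_of% e₁, Category.assoc,
        HomologicalComplex.Hom.comm, sub_self])
    refine ⟨T₂, π₂ ≫ π₁, inferInstance, π₂ ≫ x₁ + x₂, y₂, ?_, ?_⟩
    · rw [Preadditive.add_comp, hx₂, add_zero, Category.assoc, e₁, Category.assoc]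
    · rw [Preadditive.add_comp, add_assoc, ← e₂, Preadditive.comp_sub]
      simp
  · intro h
    rw [quasiIso_iff]
    intro n
    rw [quasiIsoAt_iff_isIso_homologyMap]
    have h₁ : Mono (HomologicalComplex.homologyMap ψ n) := by
      rw [HomologicalComplex.mono_homologyMap_iff_up_to_refinements ψ (n - 1) n (n + 1)
        (hp _ _ (by omega)) (hn _ _ rfl)]
      intro T x hx y hxy
      obtain ⟨T', π, hπ, x', y', e, -⟩ := h (n - 1 - 1) (n - 1) n (n + 1) (by omega) (by omega) rfl
        x y hx hxy
      exact ⟨T', π, hπ, x', e⟩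
    have h₂ : Epi (HomologicalComplex.homologyMap ψ n) := by
      rw [HomologicalComplex.epi_homologyMap_iff_up_to_refinements ψ (n - 1) n (n + 1)
        (hp _ _ (by omega)) (hn _ _ rfl)]
      intro T y hy
      obtain ⟨T', π, hπ, x', y', e, e'⟩ := h (n - 1) n (n + 1) (n + 1 + 1) (by omega) rfl rfl
        (0 : T ⟶ K.X (n + 1)) y zero_comp (by rw [hy, zero_comp])
      exact ⟨T', π, hπ, x', by rw [← e, comp_zero], y', e'⟩
    exact isIso_of_mono_of_epi _

variable {N F} in
lemma exists_refinement {K L : CochainComplex C ℤ} (φ : K ⟶ L) (hcol : ColAcyclic F φ)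
    {l m n o : ℤ} (hlm : l + 1 = m) (hmn : m + 1 = n) (hno : n + 1 = o)
    {T : D} (x : T ⟶ X N F K n) (y : T ⟶ X N F L m)
    (hx : x ≫ d N F K n o = 0) (hxy : x ≫ mapX N F φ n = y ≫ d N F L m n) (j : ℕ)
    (hj : j ≤ N + 1) :
    ∃ (T' : D) (π : T' ⟶ T) (_ : Epi π) (x' : T' ⟶ X N F K m) (y' : T' ⟶ X N F L l),
      ∀ q < j, ∀ p, (π ≫ x - x' ≫ d N F K m n) ≫ proj N F K n p q = 0 ∧
        (π ≫ y - x' ≫ mapX N F φ m - y' ≫ d N F L l m) ≫ proj N F L m p q = 0 := by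
  have dd : ∀ (M : CochainComplex C ℤ) (a b c : ℤ), d N F M a b ≫ d N F M b c = 0 :=
    fun M a b c => (obj N F M).d_comp_d a b c
  have dm : ∀ (a b : ℤ), mapX N F φ a ≫ d N F L a b = d N F K a b ≫ mapX N F φ b :=
    fun a b => (map N F φ).comm a b
  induction j with
  | zero => exact ⟨T, 𝟙 T, inferInstance, 0, 0, fun q hq => by omega⟩
  | succ j ih =>
    obtain ⟨T₁, π₁, _, x₁, y₁, h₁⟩ := ih (by omega)
    obtain ⟨T₂, π₂, _, x₂, y₂, h₂⟩ := exists_refinement_step φ hcol hlm hmn hno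
      (π₁ ≫ x - x₁ ≫ d N F K m n) (π₁ ≫ y - x₁ ≫ mapX N F φ m - y₁ ≫ d N F L l m)
      (by simp only [Preadditive.sub_comp, Category.assoc, hx, dd, comp_zero, sub_zero])
      (by simp only [Preadditive.sub_comp, Category.assoc, hxy, dd, dm, comp_zero, sub_zero])
      (by omega : j < N + 1) (fun q hq p => (h₁ q hq p).1) (fun q hq p => (h₁ q hq p).2)
    refine ⟨T₂, π₂ ≫ π₁, inferInstance, π₂ ≫ x₁ + x₂, π₂ ≫ y₁ + y₂, fun q hq p => ⟨?_, ?_⟩⟩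
    · convert (h₂ q hq p).1 using 2
      simp only [Preadditive.comp_sub, Preadditive.add_comp, Category.assoc]
      abel
    · convert (h₂ q hq p).2 using 2
      simp only [Preadditive.comp_sub, Preadditive.add_comp, Category.assoc]
      abel

lemma map_quasiIso (hF : ∀ q (S : ShortComplex C), S.Exact →
      (S.map (F ⋙ HomologicalComplex.eval D (ComplexShape.up ℕ) q)).Exact)
    {K L : CochainComplex C ℤ} (φ : K ⟶ L) (hφ : QuasiIso φ) : QuasiIso (map N F φ) := by
  have hcol : ∀ q, ConeAcyclic
      (((F ⋙ HomologicalComplex.eval D (ComplexShape.up ℕ) q).mapHomologicalComplex _).map φ) := by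
    intro q
    rw [← quasiIso_iff_coneAcyclic]
    have : (F ⋙ HomologicalComplex.eval D (ComplexShape.up ℕ) q).PreservesHomology :=
      ((F ⋙ HomologicalComplex.eval D (ComplexShape.up ℕ) q).exact_tfae.out 1 2).1 (hF q)
    exact HomologicalComplex.quasiIso_map_of_preservesHomology _ _
  rw [quasiIso_iff_coneAcyclic]
  intro T l m n o hlm hmn hno x y hx hxy
  obtain ⟨T', π, hπ, x', y', h⟩ := exists_refinement φ hcol hlm hmn hno x y hx hxy (N + 1) le_rfl
  refine ⟨T', π, hπ, x', y', ?_, ?_⟩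
  · exact sub_eq_zero.1 (hom_ext fun p q hq _ => (h q hq p).1.trans zero_comp.symm)
  · rw [← sub_eq_iff_eq_add', ← sub_eq_zero]
    exact hom_ext fun p q hq _ => (h q hq p).2.trans zero_comp.symm

end Tot

/-! ### Serre quotients -/

section SerreQuotient

variable {C : Type*} [Category C] [Abelian C] (P : ObjectProperty C) [P.IsSerreClass]

/-- The Serre quotient `C/S`, as the localization of `C` at the morphisms with kernel and cokernel
in `S`. -/
def SerreQuotient : Type _ := P.isoModSerre.Localization

instance : Category (SerreQuotient P) := inferInstanceAs (Category P.isoModSerre.Localization)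

/-- The quotient functor `φ^* : C ⥤ C/S`. -/
def SerreQuotient.functor : C ⥤ SerreQuotient P := P.isoModSerre.Q

instance : (SerreQuotient.functor P).IsLocalization P.isoModSerre :=
  inferInstanceAs (P.isoModSerre.Q.IsLocalization P.isoModSerre)

instance : Preadditive (SerreQuotient P) :=
  inferInstanceAs (Preadditive P.isoModSerre.Localization)

instance : (SerreQuotient.functor P).Additive :=
  inferInstanceAs P.isoModSerre.Q.Additive

instance : Abelian (SerreQuotient P) :=
  ObjectProperty.SerreClassLocalization.abelian (SerreQuotient.functor P) P

instance : PreservesFiniteLimits (SerreQuotient.functor P) :=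
  ObjectProperty.SerreClassLocalization.preservesFiniteLimits _ P

instance : PreservesFiniteColimits (SerreQuotient.functor P) :=
  ObjectProperty.SerreClassLocalization.preservesFiniteColimits _ P

end SerreQuotient

/-! ### The derived categories `D^♠` for `♠ ∈ {∅, +, -, b}` -/

/-- The four symbols `∅`, `+`, `-`, `b`. -/
inductive Spade
  | none
  | plus
  | minus
  | bounded

section DerivedCategories

variable (C : Type*) [Category C] [Abelian C] [HasDerivedCategory.{w} C]

/-- The objects of `D^♠(C)`: all complexes, respectively those with cohomology bounded below,
bounded above, bounded on both sides. -/
def dProp : Spade → ObjectProperty (DerivedCategory C)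
  | .none => ⊤
  | .plus => DerivedCategory.TStructure.t.plus
  | .minus => DerivedCategory.TStructure.t.minus
  | .bounded => DerivedCategory.TStructure.t.bounded

instance (b : Spade) : (dProp C b).IsTriangulated := by
  cases b with
  | none =>
    exact
      { exists_zero := ⟨_, isZero_zero (DerivedCategory C), trivial⟩
        isStableUnderShiftBy := fun _ => ⟨fun _ _ => trivial⟩
        ext₂' := fun _ _ _ _ => ⟨_, trivial, ⟨Iso.refl _⟩⟩ }
  | plus => exact inferInstanceAs (DerivedCategory.TStructure.t.plus.IsTriangulated)
  | minus => exact inferInstanceAs (DerivedCategory.TStructure.t.minus.IsTriangulated)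
  | bounded => exact inferInstanceAs (DerivedCategory.TStructure.t.bounded.IsTriangulated)

/-- The triangulated category `D^♠(C)`. -/
abbrev DCat (b : Spade) : Type _ := (dProp C b).FullSubcategory

variable {C}

/-- The full subcategory `D^♠_S(C) ⊆ D^♠(C)` of the complexes with cohomology in `S`. -/
def dCohomologyIn (S : ObjectProperty C) (b : Spade) : ObjectProperty (DCat C b) :=
  fun X => ∀ n : ℤ, S ((DerivedCategory.homologyFunctor C n).obj X.obj)

variable {C' : Type*} [Category C'] [Abelian C'] [HasDerivedCategory.{w'} C'] (F : C ⥤ C')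
  [F.Additive] [PreservesFiniteLimits F] [PreservesFiniteColimits F]

lemma isGE_mapDerivedCategory (X : DerivedCategory C) (n : ℤ) (h : X.IsGE n) :
    (F.mapDerivedCategory.obj X).IsGE n := by
  obtain ⟨K, _, ⟨e⟩⟩ := X.exists_iso_Q_obj_of_isGE n
  have h₁ : CochainComplex.IsStrictlyGE ((F.mapHomologicalComplex (ComplexShape.up ℤ)).obj K) n :=
    K.map_isStrictlySupported F _
  have : ((F.mapHomologicalComplex (ComplexShape.up ℤ) ⋙ DerivedCategory.Q).obj K).IsGE n :=
    (DerivedCategory.isGE_Q_obj_iff _ n).2 inferInstance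
  exact DerivedCategory.TStructure.t.isGE_of_iso ((F.mapDerivedCategoryFactors.app K).symm ≪≫
    F.mapDerivedCategory.mapIso e.symm) n

lemma isLE_mapDerivedCategory (X : DerivedCategory C) (n : ℤ) (h : X.IsLE n) :
    (F.mapDerivedCategory.obj X).IsLE n := by
  obtain ⟨K, _, ⟨e⟩⟩ := X.exists_iso_Q_obj_of_isLE n
  have h₁ : CochainComplex.IsStrictlyLE ((F.mapHomologicalComplex (ComplexShape.up ℤ)).obj K) n :=
    K.map_isStrictlySupported F _
  have : ((F.mapHomologicalComplex (ComplexShape.up ℤ) ⋙ DerivedCategory.Q).obj K).IsLE n :=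
    (DerivedCategory.isLE_Q_obj_iff _ n).2 inferInstance
  exact DerivedCategory.TStructure.t.isLE_of_iso ((F.mapDerivedCategoryFactors.app K).symm ≪≫
    F.mapDerivedCategory.mapIso e.symm) n

lemma dProp_mapDerivedCategory (b : Spade) (X : DerivedCategory C) (h : dProp C b X) :
    dProp C' b (F.mapDerivedCategory.obj X) := by
  cases b with
  | none => trivial
  | plus =>
    obtain ⟨n, h⟩ := h
    exact ⟨n, isGE_mapDerivedCategory F X n h⟩
  | minus =>
    obtain ⟨n, h⟩ := h
    exact ⟨n, isLE_mapDerivedCategory F X n h⟩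
  | bounded =>
    obtain ⟨⟨n, h⟩, ⟨m, h'⟩⟩ := h
    exact ⟨⟨n, isGE_mapDerivedCategory F X n h⟩, ⟨m, isLE_mapDerivedCategory F X m h'⟩⟩

/-- The functor `D^♠(C) ⥤ D^♠(C')` induced by an exact functor `C ⥤ C'`. -/
abbrev mapD (b : Spade) : DCat C b ⥤ DCat C' b :=
  (dProp C' b).lift ((dProp C b).ι ⋙ F.mapDerivedCategory)
    (fun X => dProp_mapDerivedCategory F b X.obj X.property)

end DerivedCategories

section Localizing

variable {C : Type*} [Category C] [Abelian C] (S : ObjectProperty C) [S.IsSerreClass]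
  [HasDerivedCategory.{w} C] [HasDerivedCategory.{w'} (SerreQuotient S)]

/-- The functor `φ^* : D(C) ⥤ D(C/S)`. -/
abbrev phiStar : DerivedCategory C ⥤ DerivedCategory (SerreQuotient S) :=
  (SerreQuotient.functor S).mapDerivedCategory

/-- The functor `φ^* : D^♠(C) ⥤ D^♠(C/S)`. -/
abbrev phiStarD (b : Spade) : DCat C b ⥤ DCat (SerreQuotient S) b :=
  mapD (SerreQuotient.functor S) b

/-- The Serre subcategory `S` is `D^♠`-localizing: `φ^* : D^♠(C) ⥤ D^♠(C/S)` has a right adjoint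
`Rφ_*` such that the counit `φ^* Rφ_* ⟶ 𝟙` is an isomorphism. -/
def IsDLocalizing (b : Spade) : Prop :=
  ∃ (R : DCat (SerreQuotient S) b ⥤ DCat C b) (adj : phiStarD S b ⊣ R), IsIso adj.counit

end Localizing

/-- The sequence `(E₁, E₂)` of full subcategories of the triangulated category `T` is a
semi-orthogonal decomposition `T = ⟨E₁, E₂⟩`: both are triangulated, `Hom(E₂, E₁) = 0`, and each
object `X` sits in an exact triangle `X₂ ⟶ X ⟶ X₁ ⟶ X₂[1]` with `X₁ ∈ E₁` and `X₂ ∈ E₂`. -/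
structure IsSemiorthogonalDecomposition {T : Type*} [Category T] [Preadditive T]
    [HasZeroObject T] [HasShift T ℤ] [∀ n : ℤ, (shiftFunctor T n).Additive] [Pretriangulated T]
    (E₁ E₂ : ObjectProperty T) : Prop where
  isTriangulated₁ : E₁.IsTriangulated
  isTriangulated₂ : E₂.IsTriangulated
  hom_eq_zero : ∀ ⦃X Y : T⦄ (f : X ⟶ Y), E₂ X → E₁ Y → f = 0
  exists_triangle : ∀ X : T, ∃ (X₁ X₂ : T) (f : X₂ ⟶ X) (g : X ⟶ X₁)
    (h : X₁ ⟶ (shiftFunctor T (1 : ℤ)).obj X₂), E₁ X₁ ∧ E₂ X₂ ∧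
      Pretriangulated.Triangle.mk f g h ∈ Pretriangulated.distinguishedTriangles

/-! ### Local cohomology and Čech complexes on the derived category -/

section LocalCohomology

variable {A : Type u} [CommRing A] {𝒜 : ℤ → AddSubgroup A} [SetLike.GradedMonoid 𝒜]
  {r : ℕ} {f : Fin r → A} {d : Fin r → ℤ}

/-- The functor `K ↦ RΓ_{(f)}(K)` on cochain complexes: the total complex of the double complex
`RΓ_{(f)}(K^p)^q`, which vanishes for `q > r`. -/
def rGammaComplex (hf : ∀ i, f i ∈ 𝒜 (d i)) :
    CochainComplex (GrMod 𝒜) ℤ ⥤ CochainComplex (GrMod 𝒜) ℤ :=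
  Tot.functor r (Cech.ext hf)

/-- The functor `K ↦ Č_{(f)}(K)` on cochain complexes: the total complex of the double complex
`Č_{(f)}(K^p)^q`, which vanishes for `q ≥ r`. -/
def cechComplex (hf : ∀ i, f i ∈ 𝒜 (d i)) :
    CochainComplex (GrMod 𝒜) ℤ ⥤ CochainComplex (GrMod 𝒜) ℤ :=
  Tot.functor r (Cech.cech hf)

variable [HasDerivedCategory.{w} (GrMod 𝒜)]

/-- The functor `RΓ_I : D(Gr(A)) ⥤ D(Gr(A))`, where `I` is generated by the `f i`. -/
def rGamma (hf : ∀ i, f i ∈ 𝒜 (d i)) : DerivedCategory (GrMod 𝒜) ⥤ DerivedCategory (GrMod 𝒜) :=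
  Localization.lift (rGammaComplex hf ⋙ DerivedCategory.Q)
    (W := HomologicalComplex.quasiIso (GrMod 𝒜) (ComplexShape.up ℤ))
    (fun _ _ φ hφ => by
      have := Tot.map_quasiIso r (Cech.ext hf) (Cech.ext_exact hf) φ hφ
      exact inferInstanceAs (IsIso (DerivedCategory.Q.map (Tot.map r (Cech.ext hf) φ))))
    DerivedCategory.Q

/-- The functor `Č_I : D(Gr(A)) ⥤ D(Gr(A))`, where `I` is generated by the `f i`. -/
def cechD (hf : ∀ i, f i ∈ 𝒜 (d i)) : DerivedCategory (GrMod 𝒜) ⥤ DerivedCategory (GrMod 𝒜) :=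
  Localization.lift (cechComplex hf ⋙ DerivedCategory.Q)
    (W := HomologicalComplex.quasiIso (GrMod 𝒜) (ComplexShape.up ℤ))
    (fun _ _ φ hφ => by
      have := Tot.map_quasiIso r (Cech.cech hf) (Cech.cech_exact hf) φ hφ
      exact inferInstanceAs (IsIso (DerivedCategory.Q.map (Tot.map r (Cech.cech hf) φ))))
    DerivedCategory.Q

/-- The full subcategory `D^♠_{I-triv}(Gr(A)) ⊆ D^♠(Gr(A))` of the `I`-trivial complexes:
`RΓ_I(M) ≃ 0`. -/
def trivD (hf : ∀ i, f i ∈ 𝒜 (d i)) (b : Spade) : ObjectProperty (DCat (GrMod 𝒜) b) :=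
  fun X => IsZero ((rGamma hf).obj X.obj)

end LocalCohomology

/-- The category `Q⁺Gr(A) = Gr(A)/Tor⁺`. -/
abbrev QGr {A : Type u} [CommRing A] (𝒜 : ℤ → AddSubgroup A) : Type _ := SerreQuotient (torPos 𝒜)

end

/-! The right adjoint is written down by Čech complexes, without injective resolutions. Every term
of the Čech complex is a finite product of localizations at nonempty products of the `f i`. As a
functor of the module it is exact and it kills `Tor⁺`, so the Čech functor factors through the Serre
quotient as `E ∘ φ^*`, with `E` (`Cech.quotCech`) exact in every degree. Total complexes of `E` then
define `R : D(Q⁺Gr(A)) ⥤ D(Gr(A))` with `R ∘ φ^*` the Čech functor, and the augmentation `M ⟶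
Č(M)^0` gives `η : 𝟭 ⟶ R ∘ φ^*`.

Two properties of the extended Čech complex make this an adjunction. Division by `f i` is a
contracting homotopy up to a power of `f i` (`Cech.exists_pow_smul_eq_diff`). (a) Hence its
cohomology is killed elementwise by powers of every generator, so it lies in `Tor⁺` and `φ^*` makes
the complex acyclic. This yields an invertible `θ : 𝟭 ⟶ φ^* ∘ R`. (b) If some `f i` acts bijectively
on `M`, the power can be divided out and the extended complex of `M` is acyclic. This applies to the
factors of every Čech term, so `η` is invertible on the image of `R`. Since moreover `φ^*(η) = θ
φ^*`, the formal criterion `adjunctionOfIsIso` gives `φ^* ⊣ R` with unit `η` and invertible counit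
`θ⁻¹`. The structure `Tot.Resolution` isolates exactly what is used here.

The total extended Čech complex of `K` is, up to a shift, the cone of `K ⟶ Tot(Č(K))`
(`Tot.quasiIso_unit_iff`). So `RΓ_I(K) ≃ 0` if and only if the unit at `K` is invertible, if and
only if `K` lies in the essential image of `R`; this is the equivalence with the `I`-trivial
complexes.

The rest is formal. The double complexes occupy finitely many Čech degrees, so all functors and the
adjunction restrict to `D^♠`. As `φ^*` is exact, its kernel consists of the complexes with
cohomology in `Tor⁺`. The triangle on the unit gives the semi-orthogonal decomposition, and the
image of `R` is triangulated because it is the right orthogonal of that kernel. -/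

noncomputable section

/-! ### Total complexes of double complexes with exact rows. -/

namespace Tot

attribute [local instance] Abelian.hasFiniteBiproducts

section Acyclic

variable {D : Type*} [Category D] [Abelian D]

lemma acyclic_iff_refinements (K : CochainComplex D ℤ) :
    K.Acyclic ↔ ∀ ⦃T : D⦄ (m n o : ℤ), m + 1 = n → n + 1 = o → ∀ x : T ⟶ K.X n, x ≫ K.d n o = 0 →
      ∃ (T' : D) (π : T' ⟶ T) (_ : Epi π) (x' : T' ⟶ K.X m), π ≫ x = x' ≫ K.d m n := by
  constructor
  · intro h T m n o hmn hno x hx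
    have := h n
    rw [K.exactAt_iff' m n o ((ComplexShape.up ℤ).prev_eq' hmn) ((ComplexShape.up ℤ).next_eq' hno),
      ShortComplex.exact_iff_exact_up_to_refinements] at this
    exact this x hx
  · intro h n
    rw [K.exactAt_iff' (n - 1) n (n + 1) ((ComplexShape.up ℤ).prev_eq' (by simp))
      ((ComplexShape.up ℤ).next_eq' rfl), ShortComplex.exact_iff_exact_up_to_refinements]
    intro T x hx
    exact h (n - 1) n (n + 1) (by simp) rfl x hx

lemma exists_refinement_succ {K : CochainComplex D ℕ} (hK : K.Acyclic) {T : D} (q : ℕ)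
    (x : T ⟶ K.X (q + 1)) (hx : x ≫ K.d (q + 1) (q + 2) = 0) :
    ∃ (T' : D) (π : T' ⟶ T) (_ : Epi π) (y : T' ⟶ K.X q), π ≫ x = y ≫ K.d q (q + 1) := by
  have := hK (q + 1)
  rw [K.exactAt_iff' q (q + 1) (q + 2) (by simp) (by simp),
    ShortComplex.exact_iff_exact_up_to_refinements] at this
  exact this x hx

lemma eq_zero_of_comp_d {K : CochainComplex D ℕ} (hK : K.Acyclic) {T : D}
    (x : T ⟶ K.X 0) (hx : x ≫ K.d 0 1 = 0) : x = 0 := by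
  have := hK 0
  -- The predecessor of `0` is `0` by convention, so the incoming map is `d 0 0`, which vanishes.
  rw [K.exactAt_iff' 0 0 1 (by simp) (by simp),
    ShortComplex.exact_iff_exact_up_to_refinements] at this
  obtain ⟨T', π, _, y, e⟩ := this x hx
  rw [← cancel_epi π, comp_zero]
  refine e.trans ?_
  exact (congrArg (y ≫ ·) (K.shape 0 0 (by simp))).trans comp_zero

end Acyclic

section

variable {C D : Type*} [Category C] [Category D] [Abelian C] [Abelian D]
  {N : ℕ} {F : C ⥤ CochainComplex D ℕ}

/-- Place `y` at position `(p, j)`: its total differential has only a horizontal part in second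
index `j`, which is left uncontrolled, and the vertical part in second index `j + 1`. -/
lemma exists_incl_rows {K : CochainComplex C ℤ} {T : D} {m n p : ℤ} {j : ℕ} (hmn : m + 1 = n)
    (hj : j + 1 < N + 1) (hp : p + j = m) (y : T ⟶ (F.obj (K.X p)).X j) :
    ∃ x : T ⟶ X N F K m, (∀ q, j + 1 < q → q < N + 1 → ∀ p', p' + q = n →
        (x ≫ d N F K m n) ≫ proj N F K n p' q = 0) ∧
      (x ≫ d N F K m n) ≫ proj N F K n p (j + 1) = y ≫ (F.obj (K.X p)).d j (j + 1) := by
  have hs : ∀ z : T ⟶ (F.obj (K.X p)).X (j + 1),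
      (p.negOnePow : ℤ) • (p.negOnePow : ℤ) • z = z := fun z => by
    rw [smul_smul, ← Units.val_mul, Int.units_mul_self, Units.val_one, one_smul]
  -- The sign cancels the factor `(-1)^p` of the vertical differential.
  refine ⟨((p.negOnePow : ℤ) • y) ≫ incl N F K m p j, fun q hq hq' p' hp' => ?_, ?_⟩
  · obtain ⟨q, rfl⟩ : ∃ q', q = q' + 1 := ⟨q - 1, by omega⟩
    rw [Category.assoc, Category.assoc, d_proj hq' hp', Preadditive.comp_add,
      Preadditive.comp_zsmul, ← Category.assoc (incl N F K m p j),
      ← Category.assoc (incl N F K m p j), incl_proj_ne (by omega),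
      incl_proj_ne (by simp only [Nat.add_sub_cancel]; omega)]
    simp
  · rw [Category.assoc, Category.assoc, d_proj hj (by push_cast; omega), Preadditive.comp_add,
      Preadditive.comp_zsmul, ← Category.assoc (incl N F K m p j),
      ← Category.assoc (incl N F K m p j), incl_proj_ne (by omega)]
    rw [Nat.add_sub_cancel, incl_proj_self (by omega) hp]
    simp only [zero_comp, zero_add, Category.id_comp, Preadditive.comp_zsmul,
      Preadditive.zsmul_comp, hs]

variable [F.Additive]

/-- Descending induction on the second index: after `j` steps a cocycle has been changed by a
boundary, up to an epimorphism, so that its components with `q > N - j` vanish. Correcting at index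
`q` disturbs only the index below it. -/
lemma exists_refinement_rows {K : CochainComplex C ℤ} (hrow : ∀ p, (F.obj (K.X p)).Acyclic)
    (hN : ∀ p, IsZero ((F.obj (K.X p)).X (N + 1))) {m n o : ℤ} (hmn : m + 1 = n) (hno : n + 1 = o)
    {T : D} (x : T ⟶ X N F K n) (hx : x ≫ d N F K n o = 0) (j : ℕ) :
    ∃ (T' : D) (π : T' ⟶ T) (_ : Epi π) (x' : T' ⟶ X N F K m),
      ∀ q, N + 1 < q + j + 1 → q < N + 1 → ∀ p, p + q = n →
        (π ≫ x - x' ≫ d N F K m n) ≫ proj N F K n p q = 0 := by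
  have dd : d N F K m n ≫ d N F K n o = 0 := (obj N F K).d_comp_d m n o
  induction j with
  | zero => exact ⟨T, 𝟙 T, inferInstance, 0, fun q hq => by omega⟩
  | succ j ih =>
    obtain ⟨T₁, π₁, _, x₁, h₁⟩ := ih
    -- For `j ≥ N + 1` no index `q` is left to treat.
    by_cases hj : j < N + 1
    swap
    · exact ⟨T₁, π₁, inferInstance, x₁, fun q hq hq' => h₁ q (by omega) hq'⟩
    obtain ⟨k, hk⟩ : ∃ k, k + j = N := ⟨N - j, by omega⟩
    set z := π₁ ≫ x - x₁ ≫ d N F K m n with hz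
    have hzd : z ≫ d N F K n o = 0 := by
      rw [hz, Preadditive.sub_comp, Category.assoc, Category.assoc, hx, dd, comp_zero, comp_zero,
        sub_zero]
    -- The top remaining component is a vertical cocycle: in `dz = 0` at second index `k + 1` the
    -- horizontal contribution comes from a component already killed. For `k = N` the target is zero
    -- by `hN`.
    have hcl : (z ≫ proj N F K n (n - k) k) ≫ (F.obj (K.X (n - k))).d k (k + 1) = 0 := by
      by_cases hkN : k = N
      · subst hkN
        exact (hN (n - k)).eq_of_tgt _ _
      · have e := congrArg (· ≫ proj N F K o (n - k) (k + 1)) hzd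
        simp only [Category.assoc, zero_comp] at e
        rw [d_proj (by omega) (by push_cast; omega), Preadditive.comp_add,
          Preadditive.comp_zsmul, ← Category.assoc z, h₁ (k + 1) (by omega) (by omega) _
          (by push_cast; omega), zero_comp, zero_add] at e
        have e' := congrArg (fun g => ((n - k : ℤ).negOnePow : ℤ) • g) e
        simp only [smul_smul, ← Units.val_mul, Int.units_mul_self, Units.val_one, one_smul,
          smul_zero] at e'
        simpa using e'
    cases k with
    -- At the bottom exactness means injectivity of `d 0 1`, so the last component is already zero
    -- and needs no correction.
    | zero =>
      refine ⟨T₁, π₁, inferInstance, x₁, fun q hq hq' p hp => ?_⟩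
      rcases Nat.eq_zero_or_pos q with rfl | hq0
      · obtain rfl : p = n - (0 : ℕ) := by omega
        exact eq_zero_of_comp_d (hrow _) _ hcl
      · exact h₁ q (by omega) hq' p hp
    | succ k =>
      obtain ⟨T₂, π₂, _, y, e⟩ := exists_refinement_succ (hrow _) k _ hcl
      obtain ⟨x₂, h₂, h₂'⟩ := exists_incl_rows (N := N) (m := m) hmn (by omega)
        (by push_cast; omega) y
      refine ⟨T₂, π₂ ≫ π₁, inferInstance, π₂ ≫ x₁ + x₂, fun q hq hq' p hp => ?_⟩
      have key : (π₂ ≫ π₁) ≫ x - (π₂ ≫ x₁ + x₂) ≫ d N F K m n =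
          π₂ ≫ z - x₂ ≫ d N F K m n := by
        rw [hz]
        simp only [Preadditive.comp_sub, Preadditive.add_comp, Category.assoc]
        abel
      rw [key, Preadditive.sub_comp, Category.assoc]
      rcases (show q = k + 1 ∨ k + 1 < q by omega) with rfl | h
      · obtain rfl : p = n - (k + 1 : ℕ) := by omega
        rw [h₂', e, sub_self]
      · rw [h₁ q (by omega) hq' p hp, h₂ q h hq' p hp, comp_zero, sub_zero]

/-- The total complex of a double complex with exact rows `F(K^p)` is acyclic. -/
lemma acyclic_obj {K : CochainComplex C ℤ} (hrow : ∀ p, (F.obj (K.X p)).Acyclic)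
    (hN : ∀ p, IsZero ((F.obj (K.X p)).X (N + 1))) : (obj N F K).Acyclic := by
  rw [acyclic_iff_refinements]
  intro T m n o hmn hno x hx
  obtain ⟨T', π, hπ, x', h⟩ := exists_refinement_rows hrow hN hmn hno x hx (N + 1)
  refine ⟨T', π, hπ, x', sub_eq_zero.1 (hom_ext fun p q hq hp => ?_)⟩
  exact (h q (by omega) hq p hp).trans zero_comp.symm

end

/-! ### Functoriality of the total complex. -/

section Iso

variable {C D : Type*} [Category C] [Category D] [Abelian C] [Abelian D] (N : ℕ)

/-- The components of the map of total complexes induced by a natural transformation. -/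
def natX {F G : C ⥤ CochainComplex D ℕ} (τ : F ⟶ G) (K : CochainComplex C ℤ) (n : ℤ) :
    X N F K n ⟶ X N G K n :=
  lift N G K n fun p q => proj N F K n p q ≫ (τ.app (K.X p)).f q

variable {N} in
lemma natX_proj {F G : C ⥤ CochainComplex D ℕ} (τ : F ⟶ G) (K : CochainComplex C ℤ) (n p : ℤ)
    (q : ℕ) : natX N τ K n ≫ proj N G K n p q = proj N F K n p q ≫ (τ.app (K.X p)).f q := by
  by_cases h : q < N + 1 ∧ p + q = n
  · exact lift_proj _ h.1 h.2
  · rw [proj_eq_zero h, proj_eq_zero h, comp_zero, zero_comp]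

variable {N} in
lemma natX_proj_assoc {F G : C ⥤ CochainComplex D ℕ} (τ : F ⟶ G) (K : CochainComplex C ℤ)
    (n p : ℤ) (q : ℕ) {T : D} (g : (G.obj (K.X p)).X q ⟶ T) :
    natX N τ K n ≫ proj N G K n p q ≫ g = proj N F K n p q ≫ (τ.app (K.X p)).f q ≫ g := by
  rw [← Category.assoc, natX_proj, Category.assoc]

/-- The map of total complexes induced by a natural transformation. -/
def natTrans {F G : C ⥤ CochainComplex D ℕ} [F.Additive] [G.Additive] (τ : F ⟶ G) :
    functor N F ⟶ functor N G where
  app K :=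
    { f := fun n => natX N τ K n
      comm' := fun n n' _ => by
        refine hom_ext fun p q hq hn => ?_
        change (natX N τ K n ≫ d N G K n n') ≫ _ = (d N F K n n' ≫ natX N τ K n') ≫ _
        rw [Category.assoc, Category.assoc, d_proj hq hn, natX_proj, d_proj_assoc hq hn,
          Preadditive.comp_add, Preadditive.comp_zsmul, natX_proj_assoc, natX_proj_assoc]
        simp only [Preadditive.add_comp, Preadditive.zsmul_comp, Category.assoc,
          ← HomologicalComplex.comp_f, NatTrans.naturality, HomologicalComplex.Hom.comm] }
  naturality K L φ := by
    ext n : 1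
    refine hom_ext fun p q hq hn => ?_
    change (mapX N F φ n ≫ natX N τ L n) ≫ _ = (natX N τ K n ≫ mapX N G φ n) ≫ _
    rw [Category.assoc, Category.assoc, mapX_proj, natX_proj, mapX_proj_assoc, natX_proj_assoc]
    simp only [← HomologicalComplex.comp_f, NatTrans.naturality]

lemma natTrans_comp {F G H : C ⥤ CochainComplex D ℕ} [F.Additive] [G.Additive] [H.Additive]
    (τ : F ⟶ G) (σ : G ⟶ H) : natTrans N (τ ≫ σ) = natTrans N τ ≫ natTrans N σ := by
  ext K n : 4
  refine hom_ext fun p q hq hn => ?_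
  change natX N (τ ≫ σ) K n ≫ _ = (natX N τ K n ≫ natX N σ K n) ≫ _
  rw [Category.assoc, natX_proj, natX_proj, natX_proj_assoc]
  rfl

lemma natTrans_id (F : C ⥤ CochainComplex D ℕ) [F.Additive] : natTrans N (𝟙 F) = 𝟙 _ := by
  ext K n : 4
  refine hom_ext fun p q hq hn => ?_
  change natX N (𝟙 F) K n ≫ _ = 𝟙 (X N F K n) ≫ _
  rw [natX_proj, Category.id_comp]
  exact Category.comp_id _

/-- Isomorphic functors have isomorphic total complexes. -/
def natIso {F G : C ⥤ CochainComplex D ℕ} [F.Additive] [G.Additive] (e : F ≅ G) :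
    functor N F ≅ functor N G where
  hom := natTrans N e.hom
  inv := natTrans N e.inv
  hom_inv_id := by rw [← natTrans_comp, e.hom_inv_id, natTrans_id]
  inv_hom_id := by rw [← natTrans_comp, e.inv_hom_id, natTrans_id]

variable {B : Type*} [Category B] [Abelian B]

/-- Total complexes of `F ∘ G`. -/
def precompIso (G : B ⥤ C) [G.Additive] (F : C ⥤ CochainComplex D ℕ) [F.Additive] :
    G.mapHomologicalComplex (ComplexShape.up ℤ) ⋙ functor N F ≅ functor N (G ⋙ F) :=
  NatIso.ofComponents (fun _ => Iso.refl _) (fun _ =>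
    (Category.comp_id _).trans (Category.id_comp _).symm)

variable {N}

/-- The comparison map from the image of a total complex. -/
def postcompX (F : B ⥤ CochainComplex C ℕ) (G : C ⥤ D) [G.Additive] (K : CochainComplex B ℤ)
    (n : ℤ) : G.obj (X N F K n) ⟶ X N (F ⋙ G.mapHomologicalComplex _) K n :=
  lift N (F ⋙ G.mapHomologicalComplex _) K n fun p q => G.map (proj N F K n p q)

lemma postcompX_proj (F : B ⥤ CochainComplex C ℕ) (G : C ⥤ D) [G.Additive]
    (K : CochainComplex B ℤ) (n p : ℤ) (q : ℕ) :
    postcompX F G K n ≫ proj N (F ⋙ G.mapHomologicalComplex _) K n p q =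
      G.map (proj N F K n p q) := by
  by_cases h : q < N + 1 ∧ p + q = n
  · exact lift_proj _ h.1 h.2
  · rw [proj_eq_zero h, proj_eq_zero h, comp_zero, G.map_zero]
    rfl

/-- This is the canonical comparison of an additive functor with a finite biproduct. -/
lemma isIso_postcompX (F : B ⥤ CochainComplex C ℕ) (G : C ⥤ D) [G.Additive]
    (K : CochainComplex B ℤ) (n : ℤ) : IsIso (postcompX (N := N) F G K n) := by
  let Y : Idx N n → C := fun i => (F.obj (K.X i.1.1)).X i.1.2
  have : (postcompX F G K n : G.obj (⨁ Y) ⟶ ⨁ G.obj ∘ Y) = (G.mapBiproduct Y).hom := by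
    rw [Functor.mapBiproduct_hom]
    exact congrArg biproduct.lift (funext fun i => congrArg G.map (proj_eq_π i.1.2.2 i.2))
  have h : IsIso (postcompX F G K n : G.obj (⨁ Y) ⟶ ⨁ G.obj ∘ Y) := this ▸ (G.mapBiproduct Y).isIso_hom
  exact h

/-- The comparison isomorphism from the image of a total complex. -/
def postcompXIso (F : B ⥤ CochainComplex C ℕ) (G : C ⥤ D) [G.Additive] (K : CochainComplex B ℤ)
    (n : ℤ) : G.obj (X N F K n) ≅ X N (F ⋙ G.mapHomologicalComplex _) K n :=
  have := isIso_postcompX (N := N) F G K n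
  asIso (postcompX F G K n)

variable (N)

/-- The total complex commutes with additive functors. -/
def postcompIso (F : B ⥤ CochainComplex C ℕ) [F.Additive] (G : C ⥤ D) [G.Additive] :
    functor N F ⋙ G.mapHomologicalComplex (ComplexShape.up ℤ) ≅
      functor N (F ⋙ G.mapHomologicalComplex (ComplexShape.up ℕ)) :=
  NatIso.ofComponents
    (fun K => HomologicalComplex.Hom.isoOfComponents (fun n => postcompXIso F G K n)
      (fun n n' _ => by
        refine hom_ext fun p q hq hn => ?_
        change (postcompX F G K n ≫ d N _ K n n') ≫ _ =
          (G.map (d N F K n n') ≫ postcompX F G K n') ≫ _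
        refine (Category.assoc _ _ _).trans (Eq.trans ?_ (Category.assoc _ _ _).symm)
        refine Eq.trans ?_ (congrArg (G.map (d N F K n n') ≫ ·) (postcompX_proj F G K n' p q)).symm
        refine Eq.trans ?_ ((congrArg G.map (d_proj hq hn)).symm.trans (G.map_comp _ _))
        rw [d_proj hq hn, Preadditive.comp_add, Preadditive.comp_zsmul, ← Category.assoc,
          ← Category.assoc, postcompX_proj, postcompX_proj, G.map_add, G.map_zsmul, G.map_comp,
          G.map_comp]
        rfl))
    (fun {K L} φ => by
      ext n : 1
      refine hom_ext fun p q hq hn => ?_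
      change (G.map (mapX N F φ n) ≫ postcompX F G L n) ≫ _ =
        (postcompX F G K n ≫ mapX N _ φ n) ≫ _
      refine (Category.assoc _ _ _).trans (Eq.trans ?_ (Category.assoc _ _ _).symm)
      refine (congrArg (G.map (mapX N F φ n) ≫ ·) (postcompX_proj F G L n p q)).trans ?_
      refine ((G.map_comp _ _).symm.trans (congrArg G.map (mapX_proj φ n p q))).trans ?_
      rw [mapX_proj, ← Category.assoc, postcompX_proj, G.map_comp]
      rfl)

end Iso

end Tot

/-! ### Augmented complexes and the cone of the augmentation. -/

namespace Tot

attribute [local instance] Abelian.hasFiniteBiproducts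

/-- The data identifying `G(X)` with an augmented complex `X ⟶ F(X)^0 ⟶ F(X)^1 ⟶ ⋯`. -/
structure Augmentation {C : Type*} [Category C] [Abelian C] (F G : C ⥤ CochainComplex C ℕ) where
  zeroIso (X : C) : X ≅ (G.obj X).X 0
  succIso (X : C) (q : ℕ) : (F.obj X).X q ≅ (G.obj X).X (q + 1)
  zero_naturality {X Y : C} (f : X ⟶ Y) :
    f ≫ (zeroIso Y).hom = (zeroIso X).hom ≫ (G.map f).f 0
  succ_naturality {X Y : C} (f : X ⟶ Y) (q : ℕ) :
    (F.map f).f q ≫ (succIso Y q).hom = (succIso X q).hom ≫ (G.map f).f (q + 1)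
  comm (X : C) (q : ℕ) : (succIso X q).hom ≫ (G.obj X).d (q + 1) (q + 2) =
    (F.obj X).d q (q + 1) ≫ (succIso X (q + 1)).hom

namespace Augmentation

variable {C : Type*} [Category C] [Abelian C] {F G : C ⥤ CochainComplex C ℕ}
  (a : Augmentation F G)

/-- The augmentation map `X ⟶ F(X)^0`. -/
def map (X : C) : X ⟶ (F.obj X).X 0 :=
  (a.zeroIso X).hom ≫ (G.obj X).d 0 1 ≫ (a.succIso X 0).inv

lemma zeroIso_d (X : C) :
    (a.zeroIso X).hom ≫ (G.obj X).d 0 1 = a.map X ≫ (a.succIso X 0).hom := by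
  simp [map]

lemma succ_naturality_inv {X Y : C} (f : X ⟶ Y) (q : ℕ) :
    (G.map f).f (q + 1) ≫ (a.succIso Y q).inv = (a.succIso X q).inv ≫ (F.map f).f q := by
  rw [Iso.comp_inv_eq, Category.assoc, a.succ_naturality, Iso.inv_hom_id_assoc]

lemma map_naturality {X Y : C} (f : X ⟶ Y) : f ≫ a.map Y = a.map X ≫ (F.map f).f 0 := by
  rw [map, map, ← Category.assoc, a.zero_naturality, Category.assoc, Category.assoc,
    Category.assoc, ← a.succ_naturality_inv, HomologicalComplex.Hom.comm_assoc]

lemma map_d (X : C) : a.map X ≫ (F.obj X).d 0 1 = 0 := by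
  rw [← cancel_mono (a.succIso X 1).hom, Category.assoc, ← a.comm, ← Category.assoc,
    ← a.zeroIso_d, Category.assoc, HomologicalComplex.d_comp_d, comp_zero, zero_comp]

variable (N : ℕ)

/-- The components of the augmentation of the total complex. -/
def unitX (K : CochainComplex C ℤ) (n : ℤ) : K.X n ⟶ X N F K n :=
  a.map (K.X n) ≫ incl N F K n n 0

variable {N}

lemma unitX_proj_zero (K : CochainComplex C ℤ) (n : ℤ) :
    a.unitX N K n ≫ proj N F K n n 0 = a.map (K.X n) := by
  rw [unitX, Category.assoc, incl_proj_self (by omega) (by simp), Category.comp_id]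

lemma unitX_proj_succ (K : CochainComplex C ℤ) (n p : ℤ) (q : ℕ) :
    a.unitX N K n ≫ proj N F K n p (q + 1) = 0 := by
  rw [unitX, Category.assoc, incl_proj_ne (by omega), comp_zero]

lemma unitX_naturality {K L : CochainComplex C ℤ} (φ : K ⟶ L) (n : ℤ) :
    φ.f n ≫ a.unitX N L n = a.unitX N K n ≫ mapX N F φ n := by
  refine hom_ext fun p q hq hn => ?_
  rw [Category.assoc, Category.assoc, mapX_proj]
  match q with
  | 0 =>
    obtain rfl : p = n := by simpa using hn
    rw [unitX_proj_zero, ← Category.assoc, unitX_proj_zero, a.map_naturality]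
  | q + 1 => rw [unitX_proj_succ, ← Category.assoc, unitX_proj_succ, comp_zero, zero_comp]

/-- In second index `0` this is naturality of the augmentation, in index `1` it is the relation
`map_d`, and above that both sides vanish. -/
lemma unitX_d (K : CochainComplex C ℤ) (n n' : ℤ) (h : n + 1 = n') :
    a.unitX N K n ≫ d N F K n n' = K.d n n' ≫ a.unitX N K n' := by
  refine hom_ext fun p q hq hn => ?_
  rw [Category.assoc, Category.assoc, d_proj hq hn, Preadditive.comp_add,
    Preadditive.comp_zsmul]
  match q with
  | 0 =>
    obtain rfl : p = n' := by simpa using hn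
    obtain rfl : n = p - 1 := by omega
    rw [unitX_proj_zero, ← Category.assoc, unitX_proj_zero,
      (F.obj (K.X p)).shape _ _ (by simp), comp_zero, comp_zero, smul_zero, add_zero,
      a.map_naturality]
  | 1 =>
    obtain rfl : p = n := by push_cast at hn; omega
    rw [unitX_proj_succ, comp_zero, ← Category.assoc, unitX_proj_succ, zero_comp, zero_add,
      Nat.sub_self, ← Category.assoc, unitX_proj_zero, a.map_d, smul_zero]
  | q + 2 =>
    rw [unitX_proj_succ, comp_zero, ← Category.assoc, unitX_proj_succ, zero_comp, zero_add,
      show q + 2 - 1 = q + 1 from rfl, ← Category.assoc, unitX_proj_succ, zero_comp, smul_zero]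

variable [F.Additive]

variable (N) in
/-- The augmentation `K ⟶ Tot (F(K))`. -/
def unitHom (K : CochainComplex C ℤ) : K ⟶ obj N F K where
  f := a.unitX N K
  comm' n n' h := a.unitX_d K n n' h

variable (N) in
/-- The augmentation `K ⟶ Tot (F(K))` as a natural transformation. -/
def unit : 𝟭 (CochainComplex C ℤ) ⟶ functor N F where
  app K := a.unitHom N K
  naturality K L φ := by
    ext n : 1
    exact a.unitX_naturality φ n

end Augmentation

section

variable {C : Type*} [Category C] [Abelian C] {F G : C ⥤ CochainComplex C ℕ}
  (a : Augmentation F G) (N : ℕ)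

/-- The components of the map from the total complex of `F(K)` to that of `G(K)`. -/
def shiftFam (K : CochainComplex C ℤ) (m p : ℤ) : ∀ q : ℕ, X N F K m ⟶ (G.obj (K.X p)).X q
  | 0 => 0
  -- The sign `(-1)^m` makes this map anticommute with the total differentials and absorbs the sign
  -- of the vertical map out of `(m, 0)`, as the differential of a cone requires.
  | q + 1 => (m.negOnePow : ℤ) • proj N F K m p q ≫ (a.succIso (K.X p) q).hom

/-- The map from the total complex of `F(K)` to that of `G(K)`. -/
def shiftIn (K : CochainComplex C ℤ) (m n : ℤ) : X N F K m ⟶ X N G K n :=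
  lift N G K n (shiftFam a N K m)

/-- The map from the total complex of `G(K)` to that of `F(K)`. -/
def shiftOut (K : CochainComplex C ℤ) (n m : ℤ) : X N G K n ⟶ X N F K m :=
  lift N F K m fun p q =>
    (m.negOnePow : ℤ) • proj N G K n p (q + 1) ≫ (a.succIso (K.X p) q).inv

/-- The inclusion of `K^n` in the total complex of `G(K)`. -/
def baseIn (K : CochainComplex C ℤ) (n : ℤ) : K.X n ⟶ X N G K n :=
  (a.zeroIso (K.X n)).hom ≫ incl N G K n n 0

/-- The projection of the total complex of `G(K)` to `K^n`. -/
def baseOut (K : CochainComplex C ℤ) (n : ℤ) : X N G K n ⟶ K.X n :=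
  proj N G K n n 0 ≫ (a.zeroIso (K.X n)).inv

variable {N} {K : CochainComplex C ℤ}

lemma shiftIn_proj_zero {m n p : ℤ} : shiftIn a N K m n ≫ proj N G K n p 0 = 0 := by
  by_cases h : 0 < N + 1 ∧ p + (0 : ℕ) = n
  · exact lift_proj _ h.1 h.2
  · rw [proj_eq_zero h, comp_zero]

lemma shiftIn_proj_succ {m n p : ℤ} {q : ℕ} (hq : q + 1 < N + 1) (h : p + (q + 1 : ℕ) = n) :
    shiftIn a N K m n ≫ proj N G K n p (q + 1) =
      (m.negOnePow : ℤ) • proj N F K m p q ≫ (a.succIso (K.X p) q).hom :=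
  lift_proj _ hq h

lemma shiftOut_proj {n m p : ℤ} {q : ℕ} (hq : q < N + 1) (h : p + q = m) :
    shiftOut a N K n m ≫ proj N F K m p q =
      (m.negOnePow : ℤ) • proj N G K n p (q + 1) ≫ (a.succIso (K.X p) q).inv :=
  lift_proj _ hq h

lemma baseIn_proj_zero (n : ℤ) : baseIn a N K n ≫ proj N G K n n 0 = (a.zeroIso (K.X n)).hom := by
  rw [baseIn, Category.assoc, incl_proj_self (by omega) (by simp), Category.comp_id]

lemma baseIn_baseOut (n : ℤ) : baseIn a N K n ≫ baseOut a N K n = 𝟙 _ := by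
  rw [baseOut, ← Category.assoc, baseIn_proj_zero, Iso.hom_inv_id]

lemma baseIn_proj_succ (n p : ℤ) (q : ℕ) : baseIn a N K n ≫ proj N G K n p (q + 1) = 0 := by
  rw [baseIn, Category.assoc, incl_proj_ne (by omega), comp_zero]

lemma negOnePow_smul_smul {X Y : C} (p : ℤ) (f : X ⟶ Y) :
    (p.negOnePow : ℤ) • (p.negOnePow : ℤ) • f = f := by
  rw [smul_smul, ← Units.val_mul, Int.units_mul_self, Units.val_one, one_smul]

lemma baseIn_shiftOut (n m : ℤ) : baseIn a N K n ≫ shiftOut a N K n m = 0 := by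
  refine hom_ext fun p q hq hn => ?_
  rw [Category.assoc, shiftOut_proj a hq hn, Preadditive.comp_zsmul, ← Category.assoc,
    baseIn_proj_succ, zero_comp, zero_comp, smul_zero]

lemma shiftIn_baseOut (m n : ℤ) : shiftIn a N K m n ≫ baseOut a N K n = 0 := by
  rw [baseOut, ← Category.assoc, shiftIn_proj_zero, zero_comp]

/-- Both total complexes are cut off at `q ≤ N`, and the shift raises `q` by one. The terms of `F`
with `q = N` would be lost, hence the assumption that they vanish. -/
lemma shiftIn_shiftOut (hN : ∀ p, IsZero ((F.obj (K.X p)).X N)) {m n : ℤ} (hmn : m + 1 = n) :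
    shiftIn a N K m n ≫ shiftOut a N K n m = 𝟙 _ := by
  refine hom_ext fun p q hq hn => ?_
  by_cases h : q = N
  · subst h
    exact (hN p).eq_of_tgt _ _
  · rw [Category.assoc, shiftOut_proj a hq hn, Preadditive.comp_zsmul, Category.id_comp,
      ← Category.assoc, shiftIn_proj_succ a (by omega) (by push_cast; omega),
      Preadditive.zsmul_comp, Category.assoc, Iso.hom_inv_id, Category.comp_id,
      negOnePow_smul_smul]

/-- Together with the orthogonality relations above, this splits the degree `n` term for `G` as
`K^n` plus the degree `n - 1` term for `F`. -/
lemma baseOut_baseIn_add {m n : ℤ} (hmn : m + 1 = n) :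
    baseOut a N K n ≫ baseIn a N K n + shiftOut a N K n m ≫ shiftIn a N K m n = 𝟙 _ := by
  refine hom_ext fun p q hq hn => ?_
  rw [Preadditive.add_comp, Category.assoc, Category.assoc, Category.id_comp]
  match q with
  | 0 =>
    obtain rfl : p = n := by simpa using hn
    rw [shiftIn_proj_zero, comp_zero, add_zero, baseIn_proj_zero, baseOut, Category.assoc,
      Iso.inv_hom_id, Category.comp_id]
  | q + 1 =>
    rw [baseIn_proj_succ, comp_zero, zero_add, shiftIn_proj_succ a hq hn, Preadditive.comp_zsmul,
      ← Category.assoc, shiftOut_proj a (by omega) (by push_cast at hn; omega),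
      Preadditive.zsmul_comp, Category.assoc, Iso.inv_hom_id, Category.comp_id,
      negOnePow_smul_smul]

/-- With `shiftIn_d`, the differential of the total complex of `G` reads `(x, y) ↦ (dx, u(x) - dy)`
in the splitting, where `u` is the augmentation: it is a shifted mapping cone of `u`. -/
lemma baseIn_d {n o : ℤ} (hno : n + 1 = o) :
    baseIn a N K n ≫ d N G K n o =
      K.d n o ≫ baseIn a N K o + a.unitX N K n ≫ shiftIn a N K n o := by
  refine hom_ext fun p q hq hn => ?_
  rw [Category.assoc, d_proj hq hn, Preadditive.comp_add, Preadditive.add_comp, Category.assoc,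
    Category.assoc, Preadditive.comp_zsmul]
  match q with
  | 0 =>
    obtain rfl : p = o := by simpa using hn
    obtain rfl : n = p - 1 := by omega
    rw [shiftIn_proj_zero, comp_zero, add_zero, (G.obj (K.X p)).shape _ _ (by simp),
      comp_zero, comp_zero, smul_zero, add_zero, ← Category.assoc, baseIn_proj_zero,
      baseIn_proj_zero, a.zero_naturality]
  | 1 =>
    obtain rfl : p = n := by push_cast at hn; omega
    rw [shiftIn_proj_succ (q := 0) a hq hn, baseIn_proj_succ, comp_zero, zero_add,
      ← Category.assoc, baseIn_proj_succ, zero_comp, zero_add, Preadditive.comp_zsmul,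
      ← Category.assoc (a.unitX N K p), a.unitX_proj_zero, ← a.zeroIso_d, Nat.sub_self,
      ← Category.assoc, baseIn_proj_zero]
  | q + 2 =>
    rw [shiftIn_proj_succ (q := q + 1) a hq hn, baseIn_proj_succ, comp_zero, zero_add,
      ← Category.assoc, baseIn_proj_succ, zero_comp, zero_add, Preadditive.comp_zsmul,
      ← Category.assoc (a.unitX N K n), a.unitX_proj_succ, show q + 2 - 1 = q + 1 from rfl,
      ← Category.assoc, baseIn_proj_succ, zero_comp, smul_zero, zero_comp, smul_zero]

/-- The underlying shift of double complexes commutes with both partial differentials; passing from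
`m` to `m + 1` changes the sign `(-1)^m` in its definition. -/
lemma shiftIn_d {m n o : ℤ} (hmn : m + 1 = n) (hno : n + 1 = o) :
    shiftIn a N K m n ≫ d N G K n o = -(d N F K m n ≫ shiftIn a N K n o) := by
  refine hom_ext fun p q hq hn => ?_
  rw [Category.assoc, d_proj hq hn, Preadditive.comp_add, Preadditive.neg_comp, Category.assoc,
    Preadditive.comp_zsmul]
  match q with
  | 0 =>
    rw [shiftIn_proj_zero, comp_zero, neg_zero, (G.obj (K.X p)).shape _ _ (by simp),
      comp_zero, comp_zero, smul_zero, add_zero, ← Category.assoc, shiftIn_proj_zero, zero_comp]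
  | q + 1 =>
    have e : (n.negOnePow : ℤ) = -(m.negOnePow : ℤ) := by
      rw [← hmn, Int.negOnePow_add, Int.negOnePow_one]; simp
    rw [shiftIn_proj_succ a hq hn, Preadditive.comp_zsmul, ← Category.assoc (d N F K m n),
      d_proj (by omega) (by push_cast at hn; omega), ← Category.assoc,
      shiftIn_proj_succ a hq (by push_cast at hn ⊢; omega), e, neg_smul, neg_neg,
      Preadditive.add_comp, smul_add, Preadditive.zsmul_comp, Preadditive.zsmul_comp,
      Category.assoc, Category.assoc, a.succ_naturality]
    refine congrArg₂ (· + ·) rfl ?_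
    rw [smul_comm]
    refine congrArg _ ?_
    match q with
    | 0 =>
      rw [Nat.sub_self, ← Category.assoc, shiftIn_proj_zero, zero_comp,
        (F.obj (K.X p)).shape _ _ (by simp), comp_zero, zero_comp, smul_zero]
    | q + 1 =>
      rw [Nat.add_sub_cancel, Nat.add_sub_cancel, ← Category.assoc,
        shiftIn_proj_succ a (by omega) (by push_cast at hn ⊢; omega), Preadditive.zsmul_comp,
        Category.assoc, Category.assoc, a.comm]

variable [F.Additive] [G.Additive]

/-- By the cone description, a cocycle for `G` is a pair with `dx = 0` and `u(x) = dy`, and being a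
boundary up to refinement is the condition in `ConeAcyclic`, up to the sign of one witness. -/
lemma quasiIso_unit_iff (hN : ∀ p, IsZero ((F.obj (K.X p)).X N)) :
    QuasiIso (a.unitHom N K) ↔ (obj N G K).Acyclic := by
  have bd : ∀ {n o : ℤ}, n + 1 = o → d N G K n o ≫ baseOut a N K o =
      baseOut a N K n ≫ K.d n o := fun {n o} h => by
    rw [← Category.id_comp (d N G K n o),
      ← baseOut_baseIn_add a (m := n - 1) (n := n) (by omega), Preadditive.add_comp,
      Preadditive.add_comp, Category.assoc, Category.assoc, Category.assoc, Category.assoc,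
      ← Category.assoc (baseIn a N K n), baseIn_d a h,
      ← Category.assoc (shiftIn a N K _ _), shiftIn_d a (by omega) h]
    simp only [Preadditive.add_comp, Preadditive.neg_comp, Category.assoc, baseIn_baseOut,
      shiftIn_baseOut, comp_zero, neg_zero, add_zero, Category.comp_id]
  rw [quasiIso_iff_coneAcyclic, acyclic_iff_refinements]
  constructor
  · intro h T m n o hmn hno z hz
    change T ⟶ X N G K n at z
    change z ≫ d N G K n o = 0 at hz
    obtain ⟨x, y, rfl⟩ : ∃ (x : T ⟶ K.X n) (y : T ⟶ X N F K m),
        x ≫ baseIn a N K n + y ≫ shiftIn a N K m n = z :=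
      ⟨z ≫ baseOut a N K n, z ≫ shiftOut a N K n m, by
        rw [Category.assoc, Category.assoc, ← Preadditive.comp_add, baseOut_baseIn_add a hmn,
          Category.comp_id]⟩
    rw [Preadditive.add_comp, Category.assoc, Category.assoc, baseIn_d a hno,
      shiftIn_d a hmn hno] at hz
    have hxd := congrArg (· ≫ baseOut a N K o) hz
    have hxy := congrArg (· ≫ shiftOut a N K o n) hz
    simp only [Preadditive.add_comp, Preadditive.comp_add, Preadditive.comp_neg,
      Preadditive.neg_comp, Category.assoc, baseIn_baseOut, shiftIn_baseOut, comp_zero, add_zero,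
      neg_zero, Category.comp_id, zero_comp] at hxd
    simp only [Preadditive.add_comp, Preadditive.comp_add, Preadditive.comp_neg,
      Preadditive.neg_comp, Category.assoc, baseIn_shiftOut, shiftIn_shiftOut a hN hno, comp_zero,
      zero_add, Category.comp_id, zero_comp] at hxy
    rw [← sub_eq_add_neg, sub_eq_zero] at hxy
    obtain ⟨T', π, hπ, x', y', e, e'⟩ := h (m - 1) m n o (by omega) hmn hno x y hxd hxy
    change T' ⟶ X N F K (m - 1) at y'
    change π ≫ y = x' ≫ a.unitX N K m + y' ≫ d N F K (m - 1) m at e'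
    -- The minus sign compensates `shiftIn_d`: the differential of `(x', -y')` is `(dx', u(x') +
    -- dy')`.
    refine ⟨T', π, hπ, x' ≫ baseIn a N K m - y' ≫ shiftIn a N K (m - 1) m, ?_⟩
    change π ≫ (_ + _) = (_ - _) ≫ d N G K m n
    rw [Preadditive.sub_comp, Category.assoc, Category.assoc, baseIn_d a hmn,
      shiftIn_d a (by omega) hmn, Preadditive.comp_add, ← Category.assoc, ← Category.assoc, e, e']
    simp only [Preadditive.add_comp, Preadditive.comp_add, Preadditive.comp_neg, Category.assoc]
    abel
  · intro h T l m n o hlm hmn hno x y hx hxy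
    change T ⟶ X N F K m at y
    change x ≫ a.unitX N K n = y ≫ d N F K m n at hxy
    obtain ⟨T', π, hπ, z', e⟩ := h m n o hmn hno
      (x ≫ baseIn a N K n + y ≫ shiftIn a N K m n : T ⟶ X N G K n) (by
        change (_ + _) ≫ d N G K n o = 0
        rw [Preadditive.add_comp, Category.assoc, Category.assoc, baseIn_d a hno, shiftIn_d a hmn hno,
          Preadditive.comp_add, ← Category.assoc, hx, zero_comp, zero_add, ← Category.assoc, hxy,
          Preadditive.comp_neg, Category.assoc, add_neg_cancel])
    change T' ⟶ X N G K m at z'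
    change π ≫ (x ≫ baseIn a N K n + y ≫ shiftIn a N K m n) = z' ≫ d N G K m n at e
    obtain ⟨x', y', rfl⟩ : ∃ (x' : T' ⟶ K.X m) (y' : T' ⟶ X N F K l),
        x' ≫ baseIn a N K m + y' ≫ shiftIn a N K l m = z' :=
      ⟨z' ≫ baseOut a N K m, z' ≫ shiftOut a N K m l, by
        rw [Category.assoc, Category.assoc, ← Preadditive.comp_add, baseOut_baseIn_add a hlm,
          Category.comp_id]⟩
    rw [Preadditive.add_comp, Category.assoc, Category.assoc, baseIn_d a hmn,
      shiftIn_d a hlm hmn] at e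
    have e₁ := congrArg (· ≫ baseOut a N K n) e
    have e₂ := congrArg (· ≫ shiftOut a N K n m) e
    simp only [Preadditive.add_comp, Preadditive.comp_add, Preadditive.comp_neg,
      Preadditive.neg_comp, Category.assoc, baseIn_baseOut, shiftIn_baseOut, comp_zero, add_zero,
      neg_zero, Category.comp_id] at e₁
    simp only [Preadditive.add_comp, Preadditive.comp_add, Preadditive.comp_neg,
      Preadditive.neg_comp, Category.assoc, baseIn_shiftOut, shiftIn_shiftOut a hN hmn, comp_zero,
      zero_add, Category.comp_id] at e₂
    -- Conversely, the second coordinate of the differential of `(x', y')` is `u(x') - dy'`, so the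
    -- witness is `-y'`.
    refine ⟨T', π, hπ, x', -y', e₁, e₂.trans ?_⟩
    change _ = x' ≫ a.unitX N K m + (-y') ≫ d N F K l m
    rw [Preadditive.neg_comp]

/-- The augmentation `K ⟶ Tot (F(K))` is a quasi-isomorphism if the augmented complexes of the terms
of `K` are acyclic. -/
lemma quasiIso_unit (hN : ∀ p, IsZero ((F.obj (K.X p)).X N))
    (hrow : ∀ p, (G.obj (K.X p)).Acyclic) : QuasiIso (a.unitHom N K) :=
  (quasiIso_unit_iff a hN).2 (acyclic_obj hrow fun p => (hN p).of_iso (a.succIso _ _).symm)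

end

section Aug

variable {C : Type*} [Category C] [Abelian C] (F : C ⥤ CochainComplex C ℕ)
  (a : ∀ X, X ⟶ (F.obj X).X 0) (ha : ∀ X, a X ≫ (F.obj X).d 0 1 = 0)
  (hn : ∀ {X Y : C} (f : X ⟶ Y), f ≫ a Y = a X ≫ (F.map f).f 0)

/-- The components of the map of augmented complexes induced by a morphism. -/
def augMap {X Y : C} (f : X ⟶ Y) : ∀ q : ℕ,
    ((F.obj X).augment (a X) (ha X)).X q ⟶ ((F.obj Y).augment (a Y) (ha Y)).X q
  | 0 => f
  | q + 1 => (F.map f).f q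

/-- The functor sending `X` to the augmented complex `X ⟶ F(X)^0 ⟶ F(X)^1 ⟶ ⋯`. -/
def aug : C ⥤ CochainComplex C ℕ where
  obj X := (F.obj X).augment (a X) (ha X)
  map {X Y} f :=
    { f := augMap F a ha f
      comm' := by
        rintro i _ rfl
        match i with
        | 0 => exact hn f
        | i + 1 => exact (F.map f).comm i (i + 1) }
  map_id X := by
    ext q
    match q with
    | 0 => rfl
    | q + 1 => exact congrArg (fun k => HomologicalComplex.Hom.f k q) (F.map_id X)
  map_comp f g := by
    ext q
    match q with
    | 0 => rfl
    | q + 1 => exact congrArg (fun k => HomologicalComplex.Hom.f k q) (F.map_comp f g)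

instance aug_additive [F.Additive] : (aug F a ha hn).Additive where
  map_add {X Y f g} := by
    ext q
    match q with
    | 0 => rfl
    | q + 1 => exact congrArg (fun k => HomologicalComplex.Hom.f k q) (F.map_add (f := f) (g := g))

/-- The augmented complex as an augmentation. -/
def augmentation : Augmentation F (aug F a ha hn) where
  zeroIso X := Iso.refl X
  succIso X q := Iso.refl ((F.obj X).X q)
  zero_naturality f := (Category.comp_id f).trans (Category.id_comp f).symm
  succ_naturality f q := (Category.comp_id ((F.map f).f q)).trans
    (Category.id_comp ((F.map f).f q)).symm
  comm X q := (Category.id_comp ((F.obj X).d q (q + 1))).trans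
    (Category.comp_id ((F.obj X).d q (q + 1))).symm

lemma augmentation_map (X : C) : (augmentation F a ha hn).map X = a X :=
  (Category.id_comp _).trans (Category.comp_id (a X))

end Aug

end Tot

/-! ### Functorial resolutions along an exact functor, on the level of complexes. -/

namespace Tot

attribute [local instance] Abelian.hasFiniteBiproducts

/-- The identity of the biproduct is a sum of maps factoring through the `f j`. -/
lemma isZero_obj_biproduct {C D : Type*} [Category C] [Category D] [Preadditive C] [Preadditive D]
    (H : C ⥤ D) [H.Additive] {J : Type} [Finite J] (f : J → C) [HasBiproduct f]
    (h : ∀ j, IsZero (H.obj (f j))) : IsZero (H.obj (⨁ f)) := by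
  classical
  have := Fintype.ofFinite J
  rw [IsZero.iff_id_eq_zero, ← H.map_id, ← biproduct.total (f := f), H.map_sum]
  refine Finset.sum_eq_zero fun j _ => ?_
  rw [H.map_comp, (h j).eq_of_tgt (H.map (biproduct.π f j)) 0, zero_comp]

lemma quasiIso_isoHom {D : Type*} [Category D] [Preadditive D] [CategoryWithHomology D]
    {K L : CochainComplex D ℤ} (e : K ≅ L) : QuasiIso e.hom := inferInstance

/-- An exact functor `φ : C ⥤ Q` together with a functorial finite resolution of the objects
of `Q` which comes from `C`. -/
structure Resolution {C Q : Type*} [Category C] [Category Q] [Abelian C] [Abelian Q] (φ : C ⥤ Q)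
    [φ.Additive] (N : ℕ) where
  E : Q ⥤ CochainComplex C ℕ
  G : C ⥤ CochainComplex C ℕ
  [additive_E : E.Additive]
  [additive_G : G.Additive]
  exact_E : ∀ q (S : ShortComplex Q), S.Exact →
      (S.map (E ⋙ HomologicalComplex.eval C (ComplexShape.up ℕ) q)).Exact
  a : Augmentation (φ ⋙ E) G
  -- The augmentation lives in `C` only for objects `φ(X)`; for a general object of `Q` it exists
  -- only after applying `φ`.
  θ : ∀ Y : Q, Y ⟶ φ.obj ((E.obj Y).X 0)
  θ_naturality : ∀ {Y Z : Q} (f : Y ⟶ Z), f ≫ θ Z = θ Y ≫ φ.map ((E.map f).f 0)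
  θ_obj : ∀ X : C, θ (φ.obj X) = φ.map (a.map X)
  isZero : ∀ Y, IsZero ((E.obj Y).X N)
  -- This condition makes the counit invertible.
  acyclic_map : ∀ X, ((φ.mapHomologicalComplex (ComplexShape.up ℕ)).obj (G.obj X)).Acyclic
  -- This condition makes the unit invertible on the image of the right adjoint.
  acyclic : ∀ Y q, (G.obj ((E.obj Y).X q)).Acyclic

namespace Resolution

variable {C Q : Type*} [Category C] [Category Q] [Abelian C] [Abelian Q] {φ : C ⥤ Q}
  [φ.Additive] {N : ℕ} (ρ : Resolution φ N)

instance : ρ.E.Additive := ρ.additive_E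
instance : ρ.G.Additive := ρ.additive_G

/-- Essential surjectivity and naturality reduce to `Y = φ(X)`, where `θ` is the image of the
augmentation in `C`. -/
lemma θ_d [φ.EssSurj] (Y : Q) : ρ.θ Y ≫ φ.map ((ρ.E.obj Y).d 0 1) = 0 := by
  let e := φ.objObjPreimageIso Y
  rw [← cancel_epi e.hom, ← Category.assoc, ρ.θ_naturality, comp_zero, Category.assoc,
    ← φ.map_comp, HomologicalComplex.Hom.comm, φ.map_comp, ← Category.assoc, ρ.θ_obj,
    ← φ.map_comp]
  have : ρ.a.map (φ.objPreimage Y) ≫ (ρ.E.obj (φ.obj (φ.objPreimage Y))).d 0 1 = 0 :=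
    ρ.a.map_d _
  rw [this, φ.map_zero, zero_comp]

/-- The functor `Y ↦ φ(E(Y))`. -/
abbrev F : Q ⥤ CochainComplex Q ℕ := ρ.E ⋙ φ.mapHomologicalComplex (ComplexShape.up ℕ)

variable [φ.EssSurj]

instance (ρ : Resolution φ N) : (aug ρ.F ρ.θ ρ.θ_d ρ.θ_naturality).Additive :=
  aug_additive ρ.F ρ.θ ρ.θ_d ρ.θ_naturality

/-- The functor sending `Y` to the augmented complex `Y ⟶ φ(E(Y))`. -/
abbrev augF : Q ⥤ CochainComplex Q ℕ := aug ρ.F ρ.θ ρ.θ_d ρ.θ_naturality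

/-- The augmentation `Y ⟶ φ(E(Y))`. -/
abbrev b : Augmentation ρ.F ρ.augF := augmentation ρ.F ρ.θ ρ.θ_d ρ.θ_naturality

/-- The components of the comparison of `φ(G(X))` with the augmented complex of `φ(X)`. -/
def augIsoX (X : C) : ∀ q : ℕ, (ρ.augF.obj (φ.obj X)).X q ≅ φ.obj ((ρ.G.obj X).X q)
  | 0 => φ.mapIso (ρ.a.zeroIso X)
  | q + 1 => φ.mapIso (ρ.a.succIso X q)

/-- The comparison of `φ(G(X))` with the augmented complex of `φ(X)`. -/
def augIso (X : C) : ρ.augF.obj (φ.obj X) ≅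
    (φ.mapHomologicalComplex (ComplexShape.up ℕ)).obj (ρ.G.obj X) :=
  HomologicalComplex.Hom.isoOfComponents (ρ.augIsoX X) (by
    rintro i _ rfl
    match i with
    | 0 =>
      change φ.map (ρ.a.zeroIso X).hom ≫ φ.map ((ρ.G.obj X).d 0 1) =
        ρ.θ (φ.obj X) ≫ φ.map (ρ.a.succIso X 0).hom
      rw [ρ.θ_obj, ← φ.map_comp, ρ.a.zeroIso_d, φ.map_comp]
    | i + 1 =>
      change φ.map (ρ.a.succIso X i).hom ≫ φ.map ((ρ.G.obj X).d (i + 1) (i + 2)) =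
        φ.map ((ρ.E.obj (φ.obj X)).d i (i + 1)) ≫ φ.map (ρ.a.succIso X (i + 1)).hom
      rw [← φ.map_comp, ρ.a.comm, φ.map_comp]
      rfl)

/-- Up to isomorphism `Y = φ(X)`, and then the augmented complex is `φ(G(X))`. -/
lemma acyclic_augF (Y : Q) : (ρ.augF.obj Y).Acyclic := fun q =>
  (ρ.acyclic_map (φ.objPreimage Y) q).of_iso
    ((ρ.augIso _).symm ≪≫ ρ.augF.mapIso (φ.objObjPreimageIso Y))

/-- The natural transformation `Z ⟶ φ(Tot(E(Z)))` on complexes in `Q`. -/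
def counitInv : 𝟭 (CochainComplex Q ℤ) ⟶
    functor N ρ.E ⋙ φ.mapHomologicalComplex (ComplexShape.up ℤ) :=
  ρ.b.unit N ≫ (postcompIso N ρ.E φ).inv

lemma quasiIso_counitInv (Z : CochainComplex Q ℤ) : QuasiIso (ρ.counitInv.app Z) := by
  have h₁ : QuasiIso (ρ.b.unitHom N Z) :=
    quasiIso_unit ρ.b (fun p => φ.map_isZero (ρ.isZero _)) (fun p => ρ.acyclic_augF _)
  let e : obj N ρ.F Z ≅ (φ.mapHomologicalComplex (ComplexShape.up ℤ)).obj (obj N ρ.E Z) :=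
    ((postcompIso N ρ.E φ).app Z).symm
  have h₂ : QuasiIso e.hom := quasiIso_isoHom e
  exact (quasiIso_comp (ρ.b.unitHom N Z) e.hom :)

omit [φ.EssSurj] in
/-- The natural transformation `K ⟶ Tot(E(φ(K)))` on complexes in `C`. -/
def unit : 𝟭 (CochainComplex C ℤ) ⟶
    φ.mapHomologicalComplex (ComplexShape.up ℤ) ⋙ functor N ρ.E :=
  ρ.a.unit N ≫ (precompIso N φ ρ.E).inv

omit [φ.EssSurj] in
lemma quasiIso_unit_iff (K : CochainComplex C ℤ) :
    QuasiIso (ρ.unit.app K) ↔ (obj N ρ.G K).Acyclic := by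
  rw [← Tot.quasiIso_unit_iff ρ.a (fun p => ρ.isZero _)]
  let e : obj N (φ ⋙ ρ.E) K ≅
      obj N ρ.E ((φ.mapHomologicalComplex (ComplexShape.up ℤ)).obj K) :=
    ((precompIso N φ ρ.E).app K).symm
  have h₂ : QuasiIso e.hom := quasiIso_isoHom e
  exact (quasiIso_iff_comp_right (ρ.a.unitHom N K) e.hom :)

omit [φ.EssSurj] in
-- Each term of the total complex is a finite biproduct of objects on which `G` is acyclic, and
-- homology of `G` is additive.
lemma acyclic_biproduct (Z : CochainComplex Q ℤ) (n : ℤ) :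
    (ρ.G.obj ((obj N ρ.E Z).X n)).Acyclic := by
  intro q
  rw [HomologicalComplex.exactAt_iff_isZero_homology]
  refine isZero_obj_biproduct (ρ.G ⋙ HomologicalComplex.homologyFunctor C _ q)
    (fun i : Idx N n => (ρ.E.obj (Z.X i.1.1)).X i.1.2) fun i => ?_
  exact (HomologicalComplex.exactAt_iff_isZero_homology _ _).1 (ρ.acyclic (Z.X i.1.1) i.1.2 q)

omit [φ.EssSurj] in
-- The double complex `G(Tot(E(Z))^p)^q` has exact rows, so its total complex, a shifted cone of the
-- unit, is acyclic.
lemma quasiIso_unit_obj (Z : CochainComplex Q ℤ) :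
    QuasiIso (ρ.unit.app (obj N ρ.E Z)) := by
  rw [quasiIso_unit_iff]
  exact acyclic_obj (fun p => ρ.acyclic_biproduct Z p)
    (fun p => (ρ.isZero _).of_iso (ρ.a.succIso _ N).symm)

/-- Once `φ` is moved inside the total complex, both maps have a single nonzero component, at `q =
0`, and there they agree by `θ_obj`. This becomes the compatibility `φ(η) = θ φ`. -/
lemma map_unit (K : CochainComplex C ℤ) :
    (φ.mapHomologicalComplex (ComplexShape.up ℤ)).map (ρ.unit.app K) =
      ρ.counitInv.app ((φ.mapHomologicalComplex (ComplexShape.up ℤ)).obj K) := by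
  have h : (φ.mapHomologicalComplex (ComplexShape.up ℤ)).map (ρ.unit.app K) ≫
      (postcompIso N ρ.E φ).hom.app ((φ.mapHomologicalComplex (ComplexShape.up ℤ)).obj K) =
      ρ.b.unitHom N ((φ.mapHomologicalComplex (ComplexShape.up ℤ)).obj K) := by
    ext n : 1
    let L := (φ.mapHomologicalComplex (ComplexShape.up ℤ)).obj K
    refine hom_ext fun p q hq hn => ?_
    have h₁ : φ.map (ρ.a.unitX N K n) ≫ φ.map (proj N (φ ⋙ ρ.E) K n p q) =
        ρ.b.unitX N L n ≫ proj N ρ.F L n p q := by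
      rw [← φ.map_comp]
      match q with
      | 0 =>
        obtain rfl : p = n := by simpa using hn
        rw [Augmentation.unitX_proj_zero, Augmentation.unitX_proj_zero]
        exact (ρ.θ_obj (K.X p)).symm.trans (augmentation_map ρ.F ρ.θ ρ.θ_d ρ.θ_naturality _).symm
      | q + 1 =>
        rw [Augmentation.unitX_proj_succ, Augmentation.unitX_proj_succ, φ.map_zero]
        rfl
    have h₂ : ((φ.mapHomologicalComplex (ComplexShape.up ℤ)).map (ρ.unit.app K)).f n =
        φ.map (ρ.a.unitX N K n) := congrArg φ.map (Category.comp_id _)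
    refine Eq.trans ?_ h₁
    refine (Category.assoc _ _ _).trans ?_
    refine (congrArg (((φ.mapHomologicalComplex (ComplexShape.up ℤ)).map (ρ.unit.app K)).f n ≫ ·)
      (postcompX_proj ρ.E φ L n p q)).trans ?_
    exact congrArg (· ≫ φ.map (proj N (φ ⋙ ρ.E) K n p q)) h₂
  rw [counitInv, NatTrans.comp_app, ← cancel_mono ((postcompIso N ρ.E φ).hom.app _)]
  refine h.trans ?_
  rw [Category.assoc, Iso.inv_hom_id_app, Category.comp_id]
  rfl

end Resolution

end Tot

/-! ### A criterion for an adjunction with invertible counit. -/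

section Adjunction

variable {C D : Type*} [Category C] [Category D] {L : C ⥤ D} {R : D ⥤ C} (η : 𝟭 C ⟶ L ⋙ R)
  (θ : 𝟭 D ⟶ R ⋙ L) [IsIso θ]

/-- Let `u` be the composite. By `h₁` and naturality of `θ`, `L(u)` is the identity, so naturality
of `η` gives `u ≫ η = η ≫ R(L(u)) = η`; cancel the isomorphism `η` at `R(Y)`. -/
lemma app_comp_map_inv_app (h₁ : ∀ X, L.map (η.app X) = θ.app (L.obj X))
    (h₂ : ∀ Y, IsIso (η.app (R.obj Y))) (Y : D) :
    η.app (R.obj Y) ≫ R.map ((inv θ).app Y) = 𝟙 (R.obj Y) := by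
  have := h₂ Y
  have h : L.map (η.app (R.obj Y) ≫ R.map ((inv θ).app Y)) = 𝟙 (L.obj (R.obj Y)) := by
    rw [L.map_comp, h₁]
    exact (θ.naturality ((inv θ).app Y)).symm.trans ((asIso θ).inv_hom_id_app Y)
  refine (cancel_mono (η.app (R.obj Y))).1 (Eq.trans ?_ (Category.id_comp _).symm)
  refine (η.naturality (η.app (R.obj Y) ≫ R.map ((inv θ).app Y))).trans ?_
  refine (congrArg (fun k => η.app (R.obj Y) ≫ R.map k) h).trans ?_
  exact (congrArg (η.app (R.obj Y) ≫ ·) (R.map_id _)).trans (Category.comp_id _)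

/-- The adjunction given by a unit `η` and an inverse counit `θ` such that `L(η) = θL` and `ηR` is an
isomorphism. -/
def adjunctionOfIsIso (h₁ : ∀ X, L.map (η.app X) = θ.app (L.obj X))
    (h₂ : ∀ Y, IsIso (η.app (R.obj Y))) : L ⊣ R :=
  Adjunction.mkOfUnitCounit
    { unit := η
      counit := inv θ
      left_triangle := by
        ext X
        change L.map (η.app X) ≫ 𝟙 _ ≫ (inv θ).app (L.obj X) = 𝟙 _
        rw [Category.id_comp, h₁]
        exact (asIso θ).hom_inv_id_app _
      right_triangle := by
        ext Y
        change η.app (R.obj Y) ≫ 𝟙 _ ≫ R.map ((inv θ).app Y) = 𝟙 _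
        rw [Category.id_comp]
        exact app_comp_map_inv_app η θ h₁ h₂ Y }

lemma isIso_adjunctionOfIsIso_counit (h₁ : ∀ X, L.map (η.app X) = θ.app (L.obj X))
    (h₂ : ∀ Y, IsIso (η.app (R.obj Y))) : IsIso (adjunctionOfIsIso η θ h₁ h₂).counit :=
  inferInstanceAs (IsIso (inv θ))

end Adjunction

/-! ### Zero objects of the derived category. -/

namespace DerivedCategory

variable {C : Type*} [Category C] [Abelian C] [HasDerivedCategory.{w} C]

lemma exists_iso_Q_obj (X : DerivedCategory C) :
    ∃ K : CochainComplex C ℤ, Nonempty (Q.obj K ≅ X) :=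
  ⟨_, ⟨Q.objObjPreimageIso X⟩⟩

/-- An object without cohomology is both `≤ 0` and `≥ 1` for the canonical t-structure, hence zero.
-/
lemma isZero_iff_isZero_homology (X : DerivedCategory C) :
    IsZero X ↔ ∀ n, IsZero ((homologyFunctor C n).obj X) := by
  refine ⟨fun h n => (homologyFunctor C n).map_isZero h, fun h => ?_⟩
  have h₁ : X.IsLE 0 := (isLE_iff X 0).2 fun i _ => h i
  have h₂ : X.IsGE 1 := (isGE_iff X 1).2 fun i _ => h i
  exact TStructure.t.isZero X 0 1 (by omega)

lemma isZero_Q_obj_iff (K : CochainComplex C ℤ) : IsZero (Q.obj K) ↔ K.Acyclic := by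
  rw [isZero_iff_isZero_homology]
  refine forall_congr' fun n => ?_
  rw [HomologicalComplex.exactAt_iff_isZero_homology]
  exact ((homologyFunctorFactors C n).app K).isZero_iff

end DerivedCategory

/-! ### The right adjoint on derived categories. -/

namespace Tot.Resolution

variable {C Q : Type*} [Category C] [Category Q] [Abelian C] [Abelian Q] {φ : C ⥤ Q}
  [φ.Additive] [PreservesFiniteLimits φ] [PreservesFiniteColimits φ] {N : ℕ}
  (ρ : Resolution φ N) [HasDerivedCategory.{w} C] [HasDerivedCategory.{w'} Q]

/-- The functor `Z ↦ Tot(E(Z))` on derived categories. -/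
def R : DerivedCategory Q ⥤ DerivedCategory C :=
  Localization.lift (functor N ρ.E ⋙ DerivedCategory.Q)
    (W := HomologicalComplex.quasiIso Q (ComplexShape.up ℤ))
    (fun _ _ f hf => by
      have := map_quasiIso N ρ.E ρ.exact_E f hf
      exact inferInstanceAs (IsIso (DerivedCategory.Q.map (Tot.map N ρ.E f))))
    DerivedCategory.Q

/-- `R` is induced by `Z ↦ Tot(E(Z))`. -/
def facR : DerivedCategory.Q ⋙ ρ.R ≅ functor N ρ.E ⋙ DerivedCategory.Q :=
  Localization.fac _ _ _

/-- `R ∘ φ` is induced by `K ↦ Tot(E(φ(K)))`. -/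
def facφR : DerivedCategory.Q ⋙ φ.mapDerivedCategory ⋙ ρ.R ≅
    (φ.mapHomologicalComplex (ComplexShape.up ℤ) ⋙ functor N ρ.E) ⋙ DerivedCategory.Q :=
  Functor.isoWhiskerRight φ.mapDerivedCategoryFactors ρ.R ≪≫
    Functor.isoWhiskerLeft (φ.mapHomologicalComplex (ComplexShape.up ℤ)) ρ.facR

/-- `φ ∘ R` is induced by `Z ↦ φ(Tot(E(Z)))`. -/
def facRφ : DerivedCategory.Q ⋙ ρ.R ⋙ φ.mapDerivedCategory ≅
    (functor N ρ.E ⋙ φ.mapHomologicalComplex (ComplexShape.up ℤ)) ⋙ DerivedCategory.Q :=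
  Functor.isoWhiskerRight ρ.facR φ.mapDerivedCategory ≪≫
    Functor.isoWhiskerLeft (functor N ρ.E) φ.mapDerivedCategoryFactors

/-- The natural transformation `X ⟶ R(φ(X))`. -/
def η : 𝟭 (DerivedCategory C) ⟶ φ.mapDerivedCategory ⋙ ρ.R :=
  letI : Localization.Lifting DerivedCategory.Q
      (HomologicalComplex.quasiIso C (ComplexShape.up ℤ))
      ((φ.mapHomologicalComplex (ComplexShape.up ℤ) ⋙ functor N ρ.E) ⋙ DerivedCategory.Q)
      (φ.mapDerivedCategory ⋙ ρ.R) := ⟨ρ.facφR⟩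
  Localization.liftNatTrans DerivedCategory.Q (HomologicalComplex.quasiIso C (ComplexShape.up ℤ))
    DerivedCategory.Q _ _ _ (Functor.whiskerRight ρ.unit DerivedCategory.Q)

/-- On a complex the transformation is the augmentation up to a factorization isomorphism, so
questions about it become questions about complexes. -/
lemma η_app (K : CochainComplex C ℤ) :
    ρ.η.app (DerivedCategory.Q.obj K) =
      DerivedCategory.Q.map (ρ.unit.app K) ≫ ρ.facφR.inv.app K := by
  let : Localization.Lifting DerivedCategory.Q
      (HomologicalComplex.quasiIso C (ComplexShape.up ℤ))
      ((φ.mapHomologicalComplex (ComplexShape.up ℤ) ⋙ functor N ρ.E) ⋙ DerivedCategory.Q)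
      (φ.mapDerivedCategory ⋙ ρ.R) := ⟨ρ.facφR⟩
  refine (Localization.liftNatTrans_app DerivedCategory.Q
    (HomologicalComplex.quasiIso C (ComplexShape.up ℤ)) _ _ _ _ _ K).trans ?_
  exact Category.id_comp _

variable [φ.EssSurj]

/-- The natural transformation `Y ⟶ φ(R(Y))`. -/
def θD : 𝟭 (DerivedCategory Q) ⟶ ρ.R ⋙ φ.mapDerivedCategory :=
  letI : Localization.Lifting DerivedCategory.Q
      (HomologicalComplex.quasiIso Q (ComplexShape.up ℤ))
      ((functor N ρ.E ⋙ φ.mapHomologicalComplex (ComplexShape.up ℤ)) ⋙ DerivedCategory.Q)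
      (ρ.R ⋙ φ.mapDerivedCategory) := ⟨ρ.facRφ⟩
  Localization.liftNatTrans DerivedCategory.Q (HomologicalComplex.quasiIso Q (ComplexShape.up ℤ))
    DerivedCategory.Q _ _ _ (Functor.whiskerRight ρ.counitInv DerivedCategory.Q)

lemma θD_app (Z : CochainComplex Q ℤ) :
    ρ.θD.app (DerivedCategory.Q.obj Z) =
      DerivedCategory.Q.map (ρ.counitInv.app Z) ≫ ρ.facRφ.inv.app Z := by
  let : Localization.Lifting DerivedCategory.Q
      (HomologicalComplex.quasiIso Q (ComplexShape.up ℤ))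
      ((functor N ρ.E ⋙ φ.mapHomologicalComplex (ComplexShape.up ℤ)) ⋙ DerivedCategory.Q)
      (ρ.R ⋙ φ.mapDerivedCategory) := ⟨ρ.facRφ⟩
  refine (Localization.liftNatTrans_app DerivedCategory.Q
    (HomologicalComplex.quasiIso Q (ComplexShape.up ℤ)) _ _ _ _ _ Z).trans ?_
  exact Category.id_comp _

instance : IsIso ρ.θD := by
  rw [NatTrans.isIso_iff_isIso_app]
  intro Y
  obtain ⟨Z, ⟨e⟩⟩ := DerivedCategory.exists_iso_Q_obj Y
  refine (NatTrans.isIso_app_iff_of_iso _ e).1 ?_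
  rw [θD_app]
  have := ρ.quasiIso_counitInv Z
  have : IsIso (DerivedCategory.Q.map (ρ.counitInv.app Z)) := inferInstance
  exact IsIso.comp_isIso' this inferInstance

omit [φ.EssSurj] in
-- A map of complexes becomes invertible in the derived category exactly when it is a
-- quasi-isomorphism, and the total complex of `G(K)` is a shifted cone of the augmentation.
lemma isIso_η_app_iff (K : CochainComplex C ℤ) :
    IsIso (ρ.η.app (DerivedCategory.Q.obj K)) ↔ (obj N ρ.G K).Acyclic := by
  rw [← ρ.quasiIso_unit_iff, ← DerivedCategory.isIso_Q_map_iff_quasiIso, η_app]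
  exact isIso_comp_right_iff (DerivedCategory.Q.map (ρ.unit.app K)) (ρ.facφR.inv.app K)

omit [φ.EssSurj] in
lemma isIso_η_app_R_obj (Y : DerivedCategory Q) : IsIso (ρ.η.app (ρ.R.obj Y)) := by
  obtain ⟨Z, ⟨e⟩⟩ := DerivedCategory.exists_iso_Q_obj Y
  refine (NatTrans.isIso_app_iff_of_iso ρ.η (X := DerivedCategory.Q.obj (obj N ρ.E Z))
    ((ρ.facR.app Z).symm ≪≫ ρ.R.mapIso e)).1 ?_
  rw [isIso_η_app_iff, ← ρ.quasiIso_unit_iff]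
  exact ρ.quasiIso_unit_obj Z

/-- Transformations between functors on the derived category may be compared on complexes, where the
claim is `map_unit`; the remaining work is to match the factorization isomorphisms. -/
lemma map_η (X : DerivedCategory C) :
    φ.mapDerivedCategory.map (ρ.η.app X) = ρ.θD.app (φ.mapDerivedCategory.obj X) := by
  suffices h : Functor.whiskerRight ρ.η φ.mapDerivedCategory =
      Functor.whiskerLeft φ.mapDerivedCategory ρ.θD from congrArg (fun k => NatTrans.app k X) h
  refine Localization.natTrans_ext DerivedCategory.Q
    (HomologicalComplex.quasiIso C (ComplexShape.up ℤ)) fun K => ?_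
  let M := φ.mapHomologicalComplex (ComplexShape.up ℤ)
  let e := φ.mapDerivedCategoryFactors
  change φ.mapDerivedCategory.map (ρ.η.app (DerivedCategory.Q.obj K)) =
    ρ.θD.app (φ.mapDerivedCategory.obj (DerivedCategory.Q.obj K))
  have h₁ : e.hom.app K ≫ ρ.θD.app (DerivedCategory.Q.obj (M.obj K)) =
      ρ.θD.app (φ.mapDerivedCategory.obj (DerivedCategory.Q.obj K)) ≫
        φ.mapDerivedCategory.map (ρ.R.map (e.hom.app K)) := ρ.θD.naturality (e.hom.app K)
  have h₂ : φ.mapDerivedCategory.map (ρ.facφR.inv.app K) ≫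
      φ.mapDerivedCategory.map (ρ.R.map (e.hom.app K)) =
      φ.mapDerivedCategory.map (ρ.facR.inv.app (M.obj K)) := by
    rw [← φ.mapDerivedCategory.map_comp]
    congr 1
    refine (Category.assoc (ρ.facR.inv.app (M.obj K)) (ρ.R.map (e.inv.app K))
      (ρ.R.map (e.hom.app K))).trans ?_
    rw [← ρ.R.map_comp, e.inv_hom_id_app]
    exact (congrArg (ρ.facR.inv.app (M.obj K) ≫ ·) (ρ.R.map_id _)).trans (Category.comp_id _)
  -- Composing with this isomorphism moves `θD` from `φ(Q(K))` to `Q(φ(K))`, the image of an actual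
  -- complex, where `θD_app` applies.
  rw [← cancel_mono (φ.mapDerivedCategory.map (ρ.R.map (e.hom.app K))), ← h₁, θD_app, η_app,
    φ.mapDerivedCategory.map_comp, Category.assoc, h₂, ← ρ.map_unit]
  change φ.mapDerivedCategory.map (DerivedCategory.Q.map (ρ.unit.app K)) ≫
      φ.mapDerivedCategory.map (ρ.facR.inv.app (M.obj K)) =
    e.hom.app K ≫ DerivedCategory.Q.map (M.map (ρ.unit.app K)) ≫
      e.inv.app (obj N ρ.E (M.obj K)) ≫ φ.mapDerivedCategory.map (ρ.facR.inv.app (M.obj K))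
  have h₃ : φ.mapDerivedCategory.map (DerivedCategory.Q.map (ρ.unit.app K)) ≫
      e.hom.app (obj N ρ.E (M.obj K)) =
      e.hom.app K ≫ DerivedCategory.Q.map (M.map (ρ.unit.app K)) :=
    e.hom.naturality (ρ.unit.app K)
  refine Eq.trans ?_ (Category.assoc _ _ _)
  refine Eq.trans ?_ (congrArg (· ≫ e.inv.app (obj N ρ.E (M.obj K)) ≫
    φ.mapDerivedCategory.map (ρ.facR.inv.app (M.obj K))) h₃)
  refine Eq.trans ?_ (Category.assoc _ _ _).symm
  exact congrArg (φ.mapDerivedCategory.map (DerivedCategory.Q.map (ρ.unit.app K)) ≫ ·)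
    (e.hom_inv_id_app_assoc (obj N ρ.E (M.obj K)) _).symm

/-- `R` is right adjoint to `φ`. -/
def adj : φ.mapDerivedCategory ⊣ ρ.R :=
  adjunctionOfIsIso ρ.η ρ.θD ρ.map_η ρ.isIso_η_app_R_obj

instance : IsIso ρ.adj.counit :=
  isIso_adjunctionOfIsIso_counit ρ.η ρ.θD ρ.map_η ρ.isIso_η_app_R_obj

lemma isIso_adj_unit_app_iff (K : CochainComplex C ℤ) :
    IsIso (ρ.adj.unit.app (DerivedCategory.Q.obj K)) ↔ (obj N ρ.G K).Acyclic :=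
  ρ.isIso_η_app_iff K

omit [φ.EssSurj] in
/-- A functor induced by the total complexes of `K ↦ F(K)`, for `F` isomorphic to `E ∘ φ`, is
isomorphic to `R ∘ φ`. -/
def compRIso {F : C ⥤ CochainComplex C ℕ} [F.Additive] (e : φ ⋙ ρ.E ≅ F)
    {H : DerivedCategory C ⥤ DerivedCategory C}
    (fac : DerivedCategory.Q ⋙ H ≅ functor N F ⋙ DerivedCategory.Q) :
    φ.mapDerivedCategory ⋙ ρ.R ≅ H :=
  letI : Localization.Lifting DerivedCategory.Q
      (HomologicalComplex.quasiIso C (ComplexShape.up ℤ))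
      ((φ.mapHomologicalComplex (ComplexShape.up ℤ) ⋙ functor N ρ.E) ⋙ DerivedCategory.Q)
      (φ.mapDerivedCategory ⋙ ρ.R) := ⟨ρ.facφR⟩
  letI : Localization.Lifting DerivedCategory.Q
      (HomologicalComplex.quasiIso C (ComplexShape.up ℤ)) (functor N F ⋙ DerivedCategory.Q) H :=
    ⟨fac⟩
  Localization.liftNatIso DerivedCategory.Q (HomologicalComplex.quasiIso C (ComplexShape.up ℤ))
    _ _ _ _ (Functor.isoWhiskerRight (precompIso N φ ρ.E ≪≫ natIso N e) DerivedCategory.Q)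

end Tot.Resolution

/-! ### Cohomological bounds for total complexes. -/

namespace Tot

variable {C D : Type*} [Category C] [Category D] [Abelian C] [Abelian D]
  (N : ℕ) (F : C ⥤ CochainComplex D ℕ) [F.Additive]

lemma isStrictlyGE_obj (K : CochainComplex C ℤ) (n : ℤ) [K.IsStrictlyGE n] :
    (obj N F K).IsStrictlyGE n := by
  rw [CochainComplex.isStrictlyGE_iff]
  intro i hi
  refine (IsZero.iff_id_eq_zero (X N F K i)).2 (hom_ext fun p q hq hp => ?_)
  have h : IsZero ((F.obj (K.X p)).X q) :=
    (F ⋙ HomologicalComplex.eval _ _ q).map_isZero (K.isZero_of_isStrictlyGE n p (by omega))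
  exact h.eq_of_tgt _ _

/-- A summand in degree `i` has `p = i - q ≥ i - N`, so `i > n + N` forces `p > n`. -/
lemma isStrictlyLE_obj (K : CochainComplex C ℤ) (n : ℤ) [K.IsStrictlyLE n] :
    (obj N F K).IsStrictlyLE (n + N) := by
  rw [CochainComplex.isStrictlyLE_iff]
  intro i hi
  refine (IsZero.iff_id_eq_zero (X N F K i)).2 (hom_ext fun p q hq hp => ?_)
  have h : IsZero ((F.obj (K.X p)).X q) :=
    (F ⋙ HomologicalComplex.eval _ _ q).map_isZero (K.isZero_of_isStrictlyLE n p (by omega))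
  exact h.eq_of_tgt _ _

variable {N F} [HasDerivedCategory.{w} C] [HasDerivedCategory.{w'} D]
  {H : DerivedCategory C ⥤ DerivedCategory D}
  (fac : DerivedCategory.Q ⋙ H ≅ functor N F ⋙ DerivedCategory.Q)

include fac

lemma isGE_of_fac (X : DerivedCategory C) (n : ℤ) (h : X.IsGE n) : (H.obj X).IsGE n := by
  obtain ⟨K, _, ⟨e⟩⟩ := X.exists_iso_Q_obj_of_isGE n
  have := isStrictlyGE_obj N F K n
  have : ((functor N F ⋙ DerivedCategory.Q).obj K).IsGE n :=
    (DerivedCategory.isGE_Q_obj_iff (obj N F K) n).2 inferInstance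
  exact DerivedCategory.TStructure.t.isGE_of_iso ((fac.app K).symm ≪≫ H.mapIso e.symm) n

lemma isLE_of_fac (X : DerivedCategory C) (n : ℤ) (h : X.IsLE n) :
    (H.obj X).IsLE (n + N) := by
  obtain ⟨K, _, ⟨e⟩⟩ := X.exists_iso_Q_obj_of_isLE n
  have := isStrictlyLE_obj N F K n
  have : ((functor N F ⋙ DerivedCategory.Q).obj K).IsLE (n + N) :=
    (DerivedCategory.isLE_Q_obj_iff (obj N F K) _).2 inferInstance
  exact DerivedCategory.TStructure.t.isLE_of_iso ((fac.app K).symm ≪≫ H.mapIso e.symm) _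

/-- The lower bound is kept and the upper bound grows by at most `N`. Finiteness of the range of `q`
is what makes the cases `-` and `b` work. -/
lemma dProp_of_fac (b : Spade) (X : DerivedCategory C) (h : dProp C b X) :
    dProp D b (H.obj X) := by
  cases b with
  | none => trivial
  | plus =>
    obtain ⟨n, h⟩ := h
    exact ⟨n, isGE_of_fac fac X n h⟩
  | minus =>
    obtain ⟨n, h⟩ := h
    exact ⟨_, isLE_of_fac fac X n h⟩
  | bounded =>
    obtain ⟨⟨n, h⟩, ⟨m, h'⟩⟩ := h
    exact ⟨⟨n, isGE_of_fac fac X n h⟩, ⟨_, isLE_of_fac fac X m h'⟩⟩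

end Tot

lemma hom_eq_zero_of_essImage {C D : Type*} [Category C] [Category D] [HasZeroMorphisms C]
    {L : C ⥤ D} {R : D ⥤ C} (adj : L ⊣ R) {P : ObjectProperty C} (hP : ∀ X, P X ↔ IsZero (L.obj X))
    {X Y : C} (f : X ⟶ Y) (hX : P X) (hY : R.essImage Y) : f = 0 := by
  obtain ⟨Z, ⟨e⟩⟩ := hY
  rw [← cancel_mono e.inv, zero_comp]
  exact (adj.homEquiv X Z).symm.injective (((hP X).1 hX).eq_of_src _ _)

/-! ### The semi-orthogonal decomposition attached to an adjunction with invertible counit. -/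

section Semiorthogonal

open Pretriangulated

variable {T T' : Type*} [Category T] [Category T'] [Preadditive T] [Preadditive T']
  [HasZeroObject T] [HasZeroObject T'] [HasShift T ℤ] [HasShift T' ℤ]
  [∀ n : ℤ, (shiftFunctor T n).Additive] [∀ n : ℤ, (shiftFunctor T' n).Additive]
  [Pretriangulated T] [Pretriangulated T'] {L : T ⥤ T'} [L.CommShift ℤ] [L.IsTriangulated]
  {R : T' ⥤ T} (adj : L ⊣ R) [IsIso adj.counit] {P : ObjectProperty T}
  (hP : ∀ X, P X ↔ IsZero (L.obj X))

include hP in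
lemma isTriangulated_of_iff_isZero : P.IsTriangulated where
  exists_zero := ⟨_, isZero_zero T, (hP _).2 (L.map_isZero (isZero_zero T))⟩
  isStableUnderShiftBy n := ⟨fun X hX => (hP _).2 (((shiftFunctor T' n).map_isZero
    ((hP X).1 hX)).of_iso ((L.commShiftIso n).app X))⟩
  toIsTriangulatedClosed₂ :=
    have : P.IsClosedUnderIsomorphisms :=
      ⟨fun e hX => (hP _).2 (((hP _).1 hX).of_iso (L.mapIso e.symm))⟩
    .mk' fun S hS h₁ h₃ => (hP _).2
    (Triangle.isZero₂_of_isZero₁₃ _ (L.map_distinguished S hS) ((hP _).1 h₁) ((hP _).1 h₃))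

include hP adj in
/-- The cone of the unit of an adjunction whose right adjoint is fully faithful. -/
lemma exists_triangle_unit (X : T) : ∃ (Y : T) (f : Y ⟶ X)
    (h : R.obj (L.obj X) ⟶ (shiftFunctor T (1 : ℤ)).obj Y), P Y ∧
      Triangle.mk f (adj.unit.app X) h ∈ distinguishedTriangles := by
  obtain ⟨Y, f, h, hT⟩ := distinguished_cocone_triangle₁ (adj.unit.app X)
  refine ⟨Y, f, h, (hP _).2 ?_, hT⟩
  -- By the triangle identity `L(unit)` has the invertible counit as a left inverse, so it is itself
  -- invertible and `L` kills the third vertex.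
  have hi : IsIso (L.map (adj.unit.app X)) := by
    have : IsIso (L.map (adj.unit.app X) ≫ adj.counit.app (L.obj X)) := by
      rw [adj.left_triangle_components X]
      exact IsIso.id (L.obj X)
    exact IsIso.of_isIso_comp_right _ (adj.counit.app (L.obj X))
  exact (Triangle.isZero₁_iff_isIso₂ _ (L.map_distinguished _ hT)).2 hi

include hP adj in
-- If `X` is right orthogonal to `P`, so is the vertex `Y` of the triangle on the unit at `X`. But
-- `Y` also lies in `P`, so its identity vanishes and the unit is invertible. An orthogonal of a
-- triangulated subcategory is triangulated, which is how the essential image is seen to be so.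
lemma essImage_eq_rightOrthogonal : R.essImage = P.rightOrthogonal := by
  have := isTriangulated_of_iff_isZero hP
  ext X
  refine ⟨fun hX Y f hY => hom_eq_zero_of_essImage adj hP f hY hX, fun hX => ?_⟩
  obtain ⟨Y, f, h, hY, hT⟩ := exists_triangle_unit adj hP X
  have hR : P.rightOrthogonal (R.obj (L.obj X)) := fun Z g hZ =>
    hom_eq_zero_of_essImage adj hP g hZ (R.obj_mem_essImage _)
  have h₁ : P.rightOrthogonal Y := P.rightOrthogonal.ext_of_isTriangulatedClosed₁ _ hT hX hR
  have h₂ : IsZero Y := (IsZero.iff_id_eq_zero Y).2 (h₁ _ hY)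
  have : IsIso (adj.unit.app X) := (Triangle.isZero₁_iff_isIso₂ _ hT).1 h₂
  exact ⟨_, ⟨(asIso (adj.unit.app X)).symm⟩⟩

include hP adj in
lemma isSemiorthogonalDecomposition_of_adjunction :
    IsSemiorthogonalDecomposition R.essImage P where
  isTriangulated₁ := by
    have := isTriangulated_of_iff_isZero hP
    rw [essImage_eq_rightOrthogonal adj hP]
    infer_instance
  isTriangulated₂ := isTriangulated_of_iff_isZero hP
  hom_eq_zero _ _ f hX hY := hom_eq_zero_of_essImage adj hP f hX hY
  exists_triangle X := by
    obtain ⟨Y, f, h, hY, hT⟩ := exists_triangle_unit adj hP X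
    exact ⟨_, _, f, _, h, R.obj_mem_essImage _, hY, hT⟩

end Semiorthogonal

/-! ### Objects with invertible unit. -/

section Equivalence

variable {C D : Type*} [Category C] [Category D] {L : C ⥤ D} {R : D ⥤ C} (adj : L ⊣ R)
  [IsIso adj.counit] {P : ObjectProperty C} (hP : ∀ X, P X ↔ IsIso (adj.unit.app X))

include adj in
-- A triangle identity exhibits it as a one-sided inverse of the invertible `R(counit)`.
lemma isIso_unit_app_obj (Y : D) : IsIso (adj.unit.app (R.obj Y)) := by
  have : IsIso (adj.unit.app (R.obj Y) ≫ R.map (adj.counit.app Y)) := by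
    rw [adj.right_triangle_components Y]
    exact IsIso.id (R.obj Y)
  exact IsIso.of_isIso_comp_right _ (R.map (adj.counit.app Y))

include hP in
lemma essImage_eq_of_isIso_unit : R.essImage = P := by
  ext X
  rw [hP]
  refine ⟨fun ⟨Y, ⟨e⟩⟩ => ?_, fun h => ⟨_, ⟨(asIso (adj.unit.app X)).symm⟩⟩⟩
  exact (NatTrans.isIso_app_iff_of_iso adj.unit e).1 (isIso_unit_app_obj adj Y)

/-- The equivalence of the full subcategory of the objects with invertible unit with the target of
a left adjoint whose right adjoint is fully faithful. -/
def equivalenceOfIsIsoUnit : P.FullSubcategory ≌ D :=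
  CategoryTheory.Equivalence.mk (P.ι ⋙ L)
    (P.lift R fun Y => (hP _).2 (isIso_unit_app_obj adj Y))
    (NatIso.ofComponents
      (fun X => P.fullyFaithfulι.preimageIso
        (have := (hP _).1 X.property; asIso (adj.unit.app X.obj)))
      (fun f => P.ι.map_injective (adj.unit.naturality f.hom)))
    (NatIso.ofComponents (fun Y => asIso (adj.counit.app Y))
      (fun f => adj.counit.naturality f))

end Equivalence

/-! ### Torsion tested on generators of the ideal. -/

section Torsion

variable {A : Type u} [CommRing A] {𝒜 : ℤ → AddSubgroup A}

/-- The elements with a power annihilating `x` form the radical of the annihilator of `x`. This is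
an ideal, so it contains `I⁺` as soon as it contains the generators. -/
lemma torPos_iff_of_span {r : ℕ} {f : Fin r → A} (hI : Ideal.span (Set.range f) = idealPos 𝒜)
    (M : GrMod 𝒜) : torPos 𝒜 M ↔ ∀ (i : Fin r) (x : M), ∃ n : ℕ, f i ^ n • x = 0 := by
  rw [torPos_iff]
  refine ⟨fun h i x => ?_, fun h x a ha => ?_⟩
  · obtain ⟨n, -, hn⟩ := h x (f i) (hI ▸ Ideal.subset_span ⟨i, rfl⟩)
    exact ⟨n, hn⟩
  · have hle : idealPos 𝒜 ≤ Ideal.radical (LinearMap.ker (LinearMap.toSpanSingleton A M x)) := by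
      rw [← hI, Ideal.span_le]
      rintro _ ⟨i, rfl⟩
      exact h i x
    obtain ⟨n, hn⟩ := hle ha
    -- The definition of torsion asks for a positive exponent, while the radical may give `n = 0`.
    refine ⟨n + 1, n.succ_pos, ?_⟩
    have hn : a ^ n • x = 0 := hn
    rw [pow_succ', mul_smul, hn, smul_zero]

end Torsion

/-! ### Cohomology of the extended Čech complex is power torsion. -/

namespace Cech

open GrMod LocalizedModule

variable {A : Type u} [CommRing A] {𝒜 : ℤ → AddSubgroup A} [SetLike.GradedMonoid 𝒜]
  {r : ℕ} {f : Fin r → A} {d : Fin r → ℤ} (hf : ∀ i, f i ∈ 𝒜 (d i))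

lemma smul_frac {g : A} {X : Type*} [AddCommGroup X] [Module A X] (a : A) (x : X) (n : ℕ) :
    a • (frac x n : LocalizedModule (Submonoid.powers g) X) = frac (a • x) n :=
  smul'_mk _ _ _

lemma frac_eq_zero_iff {g : A} {X : Type*} [AddCommGroup X] [Module A X] (x : X) (n : ℕ) :
    (frac x n : LocalizedModule (Submonoid.powers g) X) = 0 ↔ ∃ k : ℕ, g ^ k • x = 0 := by
  rw [frac, ← zero_mk 1, mk_eq]
  constructor
  · rintro ⟨⟨_, k, rfl⟩, h⟩
    exact ⟨k, by simpa [Submonoid.smul_def] using h⟩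
  · rintro ⟨k, h⟩
    exact ⟨⟨g ^ k, k, rfl⟩, by simpa [Submonoid.smul_def] using h⟩

lemma frac_eq_iff {g : A} {X : Type*} [AddCommGroup X] [Module A X] (x y : X) (n : ℕ) :
    (frac x n : LocalizedModule (Submonoid.powers g) X) = frac y n ↔
      ∃ k : ℕ, g ^ k • x = g ^ k • y := by
  have h : (frac x n : LocalizedModule (Submonoid.powers g) X) = frac (x - y) n + frac y n := by
    rw [← frac_add_same, sub_add_cancel]
  rw [h, add_eq_right, frac_eq_zero_iff]
  simp only [smul_sub, sub_eq_zero]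

lemma prodF_face_dvd {m : ℕ} (s : Fin (m + 1) ↪o Fin r) (j : Fin (m + 1)) :
    prodF f (face s j) ∣ prodF f s := ⟨f (s j), (prodF_face s j).symm⟩

lemma transLin_face_frac {m : ℕ} (s : Fin (m + 1) ↪o Fin r) (j : Fin (m + 1)) (M : GrMod 𝒜)
    (x : M) (n : ℕ) :
    transLin hf s (face s j) (prodF_face_dvd s j) M (frac x n) = frac (f (s j) ^ n • x) n :=
  lift_frac (f (s j)) (prodF_face s j) M x n

/-- With `f_s = f_t f_i` for the face `t`, multiplying `x / f_s^n` by `f_i^n` gives the image of `x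
/ f_t^n`: the localization map is surjective up to powers of `f_i`. -/
lemma exists_transLin_face_eq {m : ℕ} (s : Fin (m + 1) ↪o Fin r) (j : Fin (m + 1)) (M : GrMod 𝒜)
    (z : (loc (prodF_mem hf s)).obj M) : ∃ (k : ℕ) (w : (loc (prodF_mem hf (face s j))).obj M),
      transLin hf s (face s j) (prodF_face_dvd s j) M w = f (s j) ^ k • z := by
  obtain ⟨x, n, rfl⟩ := exists_frac (f := prodF f s) z
  exact ⟨n, frac x n, (transLin_face_frac hf s j M x n).trans (smul_frac _ _ _).symm⟩

/-- The localization map is also injective up to powers of the adjoined element. -/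
lemma exists_pow_smul_eq_zero {m : ℕ} (s : Fin (m + 1) ↪o Fin r) (j : Fin (m + 1)) (M : GrMod 𝒜)
    (z : (loc (prodF_mem hf (face s j))).obj M)
    (hz : transLin hf s (face s j) (prodF_face_dvd s j) M z = 0) :
    ∃ k : ℕ, f (s j) ^ k • z = 0 := by
  obtain ⟨x, n, rfl⟩ := exists_frac (f := prodF f (face s j)) z
  rw [transLin_face_frac] at hz
  obtain ⟨k, hk⟩ := (frac_eq_zero_iff _ _).1 hz
  -- The power `n` comes from the numerator of the localized fraction, and `k` from splitting
  -- `f_s^k` into the `k`-th powers of `f_t` and of the adjoined element.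
  refine ⟨k + n, (smul_frac _ _ _).trans ((frac_eq_zero_iff _ _).2 ⟨k, ?_⟩)⟩
  rw [← hk, ← prodF_face s j, smul_smul, smul_smul, mul_pow, pow_add, mul_assoc]

/-- Insert `i` into the set of indices and list it in increasing order; increasing sequences with
equal ranges coincide. -/
lemma exists_face {m : ℕ} (t : Fin m ↪o Fin r) (i : Fin r) (hi : i ∉ Set.range t) :
    ∃ (s : Fin (m + 1) ↪o Fin r) (j : Fin (m + 1)), face s j = t ∧ s j = i := by
  classical
  let T : Finset (Fin r) := Finset.univ.map t.toEmbedding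
  have hiT : i ∉ T := fun h => by
    obtain ⟨j, -, hj⟩ := Finset.mem_map.1 h
    exact hi ⟨j, hj⟩
  have hT : (insert i T).card = m + 1 := by
    rw [Finset.card_insert_of_notMem hiT, Finset.card_map, Finset.card_univ, Fintype.card_fin]
  let s := (insert i T).orderEmbOfFin hT
  have hs : Set.range s = insert i (Set.range t) := by
    rw [Finset.range_orderEmbOfFin]
    ext x
    simp [T]
  obtain ⟨j, hj⟩ : i ∈ Set.range s := hs ▸ Set.mem_insert _ _
  refine ⟨s, j, ?_, hj⟩
  have hr : Set.range (face s j) = Set.range t := by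
    have h₁ : Set.range (face s j) = Set.range s \ {s j} := by
      have : (face s j : Fin m → Fin r) = s ∘ j.succAbove := rfl
      rw [this, Set.range_comp, Fin.range_succAbove, Set.compl_eq_univ_sdiff,
        Set.image_sdiff s.injective, Set.image_univ, Set.image_singleton]
    rw [h₁, hs, hj]
    ext x
    simp only [Set.mem_sdiff, Set.mem_insert_iff, Set.mem_singleton_iff]
    constructor
    · rintro ⟨rfl | h, h'⟩
      · exact absurd rfl h'
      · exact h
    · intro h
      exact ⟨Or.inr h, fun e => hi (e ▸ h)⟩
  exact DFunLike.coe_injective (((face s j).strictMono.range_inj t.strictMono).1 hr)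

lemma eq_of_face_eq {m : ℕ} {s s' : Fin (m + 1) ↪o Fin r} {j j' : Fin (m + 1)}
    (h : face s j = face s' j') (h' : s j = s' j') : s = s' ∧ j = j' := by
  have hr : ∀ (s : Fin (m + 1) ↪o Fin r) (j : Fin (m + 1)),
      Set.range s = insert (s j) (Set.range (face s j)) := by
    intro s j
    have : (face s j : Fin m → Fin r) = s ∘ j.succAbove := rfl
    rw [this, Set.range_comp, Fin.range_succAbove, ← Set.image_insert_eq]
    rw [Set.insert_eq, Set.union_compl_self, Set.image_univ]
  have e : s = s' := DFunLike.coe_injective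
    ((s.strictMono.range_inj s'.strictMono).1 (by rw [hr s j, hr s' j', h, h']))
  subst e
  exact ⟨rfl, s.injective h'⟩

lemma notMem_range_face {m : ℕ} (s : Fin (m + 1) ↪o Fin r) (j : Fin (m + 1)) :
    s j ∉ Set.range (face s j) := by
  rintro ⟨l, hl⟩
  exact Fin.succAbove_ne j l (s.injective hl)

lemma diff_app_eq {m : ℕ} (M : GrMod 𝒜) (x : (term hf m).obj M) (s : Fin (m + 1) ↪o Fin r) :
    ((diff hf m).app M).lin x s = ∑ j : Fin (m + 1), (-1 : ℤ) ^ (j : ℕ) •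
      transLin hf s (face s j) (prodF_face_dvd s j) M (x (face s j)) :=
  diff_app hf M x s

lemma exists_pow_smul_eq_zero_of_diff {M : GrMod 𝒜} (x : (term hf 0).obj M)
    (hx : ((diff hf 0).app M).lin x = 0) (i : Fin r) : ∃ k : ℕ, f i ^ k • x = 0 := by
  obtain ⟨s, j, -, rfl⟩ := exists_face (m := 0) (Fin.castLEOrderEmb (Nat.zero_le r)) i
    (fun ⟨l, _⟩ => l.elim0)
  obtain rfl : j = 0 := Fin.fin_one_eq_zero j
  have h : ((diff hf 0).app M).lin x s = (0 : (loc (prodF_mem hf s)).obj M) := congrFun hx s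
  rw [diff_app_eq, Fin.sum_univ_one] at h
  obtain ⟨k, hk⟩ := exists_pow_smul_eq_zero hf s 0 M (x (face s 0))
    (by simpa using h)
  refine ⟨k, funext fun t => ?_⟩
  obtain rfl : t = face s 0 := DFunLike.ext _ _ fun l => l.elim0
  exact hk

/-- The homotopy operator given by the division by `f i`. -/
lemma exists_homotopy {m : ℕ} {M : GrMod 𝒜} (x : (term hf (m + 1)).obj M) (i : Fin r) :
    ∃ (k : ℕ) (y : (term hf m).obj M), 
      (∀ t : Fin m ↪o Fin r, i ∈ Set.range t → y t = 0) ∧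
      ∀ (s : Fin (m + 1) ↪o Fin r) (j : Fin (m + 1)), s j = i →
        transLin hf s (face s j) (prodF_face_dvd s j) M (y (face s j)) =
          (-1 : ℤ) ^ (j : ℕ) • f i ^ k • x s := by
  classical
  -- Asking for a solution for every `k ≥ k₀` allows one common exponent, the maximum over the
  -- finitely many `t`.
  have key : ∀ t : Fin m ↪o Fin r, ∃ k₀ : ℕ, ∀ k ≥ k₀, ∃ z : (loc (prodF_mem hf t)).obj M,
      (i ∈ Set.range t → z = 0) ∧ ∀ (s : Fin (m + 1) ↪o Fin r) (j : Fin (m + 1))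
        (h : face s j = t), s j = i → transLin hf s t (h ▸ prodF_face_dvd s j) M z =
          (-1 : ℤ) ^ (j : ℕ) • f i ^ k • x s := by
    intro t
    by_cases hi : i ∈ Set.range t
    · refine ⟨0, fun k _ => ⟨0, fun _ => rfl, ?_⟩⟩
      rintro s j rfl rfl
      exact absurd hi (notMem_range_face s j)
    · obtain ⟨s, j, rfl, rfl⟩ := exists_face t i hi
      obtain ⟨k₀, w, hw⟩ := exists_transLin_face_eq hf s j M (x s)
      -- The sequence `s` and the position `j` are determined by `t` and `i`, so one choice settles
      -- every condition on `z`.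
      refine ⟨k₀, fun k hk => ⟨(-1 : ℤ) ^ (j : ℕ) • f (s j) ^ (k - k₀) • w,
        fun h => absurd h hi, ?_⟩⟩
      intro s' j' h h'
      obtain ⟨rfl, rfl⟩ := eq_of_face_eq h h'
      rw [map_zsmul, map_smul, hw, smul_smul, ← pow_add, Nat.sub_add_cancel hk]
  choose k₀ hk₀ using key
  choose z hz hz' using fun t => hk₀ t (Finset.univ.sup k₀) (Finset.le_sup (Finset.mem_univ t))
  exact ⟨_, z, hz, fun s j h => hz' _ s j rfl h⟩

/-- By the simplicial identity, deleting two indices in either order gives the same face, so each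
term may be routed through the other intermediate face. -/
lemma transLin_diff {m : ℕ} {M : GrMod 𝒜} (y : (term hf m).obj M) (s : Fin (m + 2) ↪o Fin r)
    (j : Fin (m + 2)) :
    transLin hf s (face s j) (prodF_face_dvd s j) M (((diff hf m).app M).lin y (face s j)) =
      ∑ l : Fin (m + 1), (-1 : ℤ) ^ (l : ℕ) •
        transLin hf s (face s (j.succAbove l)) (prodF_face_dvd s _) M
          (transLin hf (face s (j.succAbove l)) (face (face s (j.succAbove l)) (l.predAbove j))
            (prodF_face_dvd _ _) M (y (face (face s (j.succAbove l)) (l.predAbove j)))) := by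
  have hdvd : ∀ j k, prodF f (face (face s j) k) ∣ prodF f s := fun j k =>
    (prodF_face_dvd _ _).trans (prodF_face_dvd _ _)
  rw [diff_app_eq, map_sum]
  refine Finset.sum_congr rfl fun l _ => ?_
  rw [map_zsmul]
  congr 1
  have e : face (face s (j.succAbove l)) (l.predAbove j) = face (face s j) l := by
    ext a
    exact congrArg (fun i => (s i : ℕ)) (Fin.succAbove_succAbove_succAbove_predAbove j l a)
  refine (faceMap_faceMap hf s j l (hdvd j l) M _).trans ?_
  refine Eq.trans ?_ (faceMap_faceMap hf s (j.succAbove l) (l.predAbove j) (hdvd _ _) M _).symm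
  exact (transLin_congr hf e (hdvd _ _) (hdvd _ _) M y).symm

/-- The homotopy `h` of `exists_homotopy`, division by `f i` with values `0` on sequences containing
`i`, makes `d(h(x))` and `f_i^k x` agree up to a power of `f i` when `x` is a cocycle. A further
power absorbs the error. -/
lemma exists_pow_smul_eq_diff {m : ℕ} {M : GrMod 𝒜} (x : (term hf (m + 1)).obj M)
    (hx : ((diff hf (m + 1)).app M).lin x = 0) (i : Fin r) :
    ∃ (k : ℕ) (y : (term hf m).obj M), f i ^ k • x = ((diff hf m).app M).lin y := by
  obtain ⟨k, y, hy, hy'⟩ := exists_homotopy hf x i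
  have key : ∀ s : Fin (m + 1) ↪o Fin r, ∃ k' : ℕ,
      f i ^ k' • (f i ^ k • x s - ((diff hf m).app M).lin y s) = 0 := by
    intro s
    by_cases hi : i ∈ Set.range s
    · obtain ⟨j, hj⟩ := hi
      refine ⟨0, ?_⟩
      -- Deleting any entry other than the `j`-th leaves `i` in the sequence, where `y` vanishes; in
      -- the surviving term the sign `(-1)^j` occurs twice.
      rw [diff_app_eq, Finset.sum_eq_single j, hy' s j hj, smul_smul, ← mul_pow, neg_one_mul,
        neg_neg, one_pow, one_smul, sub_self, smul_zero]
      · intro l _ hl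
        obtain ⟨a, ha⟩ := Fin.exists_succAbove_eq (Ne.symm hl)
        rw [hy _ ⟨a, (congrArg s ha).trans hj⟩, map_zero, smul_zero]
      · intro h
        exact absurd (Finset.mem_univ _) h
    · obtain ⟨s, j, rfl, rfl⟩ := exists_face s i hi
      -- Now `s` is the sequence with `i` inserted at `j`. The kernel of the localization map is
      -- power torsion for `f i`, so the comparison can be made on `s`, where the cocycle condition
      -- on `x` applies.
      refine exists_pow_smul_eq_zero hf s j M _ ?_
      have h : ((diff hf (m + 1)).app M).lin x s = (0 : (loc (prodF_mem hf s)).obj M) :=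
        congrFun hx s
      rw [diff_app_eq, Fin.sum_univ_succAbove _ j] at h
      rw [map_sub, map_smul, transLin_diff, sub_eq_zero]
      have h₂ : ∀ l : Fin (m + 1), face s (j.succAbove l) (l.predAbove j) = s j := fun l =>
        congrArg s (Fin.succAbove_succAbove_predAbove j l)
      have h₃ : ∀ l : Fin (m + 1), (-1 : ℤ) ^ (l : ℕ) •
          transLin hf s (face s (j.succAbove l)) (prodF_face_dvd s _) M
            (transLin hf (face s (j.succAbove l)) (face (face s (j.succAbove l)) (l.predAbove j))
              (prodF_face_dvd _ _) M (y (face (face s (j.succAbove l)) (l.predAbove j)))) =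
          (-(-1 : ℤ) ^ (j : ℕ)) • f (s j) ^ k • (-1 : ℤ) ^ (j.succAbove l : ℕ) •
            transLin hf s (face s (j.succAbove l)) (prodF_face_dvd s _) M
              (x (face s (j.succAbove l))) := by
        intro l
        have h₄ := Fin.neg_one_pow_succAbove_add_predAbove (R := ℤ) j l
        -- Exchanging the order of two deletions reverses the sign (`h₄`); multiplying by signs of
        -- square one brings this into the needed form.
        have h₅ : (-1 : ℤ) ^ (l : ℕ) * (-1) ^ (l.predAbove j : ℕ) =
            -(-1) ^ (j : ℕ) * (-1) ^ (j.succAbove l : ℕ) := by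
          have h₆ : ((-1 : ℤ) ^ (j.succAbove l : ℕ)) * (-1) ^ (j.succAbove l : ℕ) = 1 := by
            rw [← mul_pow]; simp
          have h₇ : ((-1 : ℤ) ^ (l : ℕ)) * (-1) ^ (l : ℕ) = 1 := by
            rw [← mul_pow]; simp
          rw [pow_add, pow_add] at h₄
          linear_combination (-1 : ℤ) ^ (l : ℕ) * (-1) ^ (j.succAbove l : ℕ) * h₄ -
            (-1 : ℤ) ^ (l : ℕ) * (-1) ^ (l.predAbove j : ℕ) * h₆ -
            (-1 : ℤ) ^ (j : ℕ) * (-1) ^ (j.succAbove l : ℕ) * h₇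
        rw [hy' _ _ (h₂ l), map_zsmul, map_smul, smul_comm (f (s j) ^ k), smul_smul, smul_smul, h₅]
      -- The cocycle condition replaces the sum over the faces other than the `j`-th by minus the
      -- `j`-th term.
      rw [Finset.sum_congr rfl fun l _ => h₃ l, ← Finset.smul_sum, ← Finset.smul_sum,
        ← neg_eq_of_add_eq_zero_right h, smul_neg, neg_smul, smul_neg, neg_neg,
        smul_comm (f (s j) ^ k), smul_smul, ← mul_pow, neg_one_mul, neg_neg, one_pow, one_smul]
  choose k' hk' using key
  -- There are finitely many `s`, so the largest `k' s` kills all the errors at once.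
  refine ⟨Finset.univ.sup k' + k, f i ^ Finset.univ.sup k' • y, ?_⟩
  rw [map_smul, pow_add, mul_smul, ← sub_eq_zero, ← smul_sub]
  refine funext fun s => ?_
  have hle : k' s ≤ Finset.univ.sup k' := Finset.le_sup (Finset.mem_univ s)
  change f i ^ Finset.univ.sup k' • (f i ^ k • x s - ((diff hf m).app M).lin y s) = 0
  rw [← Nat.sub_add_cancel hle, pow_add, mul_smul, hk', smul_zero]

end Cech

/-! ### Exactness modulo torsion. -/

namespace GrMod

variable {A : Type u} [CommRing A] {𝒜 : ℤ → AddSubgroup A}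

/-- By hypothesis each homology class is killed by a power of each generator, which is enough for
torsion. -/
lemma torPos_homology {r : ℕ} {f : Fin r → A} (hI : Ideal.span (Set.range f) = idealPos 𝒜)
    (S : ShortComplex (GrMod 𝒜))
    (h : ∀ x : S.X₂, S.g.lin x = 0 → ∀ i, ∃ (k : ℕ) (y : S.X₁), f i ^ k • x = S.f.lin y) :
    torPos 𝒜 S.homology := by
  rw [torPos_iff_of_span hI]
  intro i z
  obtain ⟨c, rfl⟩ := (epi_iff_surjective S.homologyπ).1 inferInstance z
  obtain ⟨k, y, hk⟩ := h (S.iCycles.lin c) (comp_apply_zero S.iCycles_g c) i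
  refine ⟨k, ?_⟩
  have e : f i ^ k • c = S.toCycles.lin y := by
    apply (mono_iff_injective S.iCycles).1 inferInstance
    rw [map_smul, hk]
    exact (congrArg (fun g => Hom.lin g y) S.toCycles_i).symm
  rw [← map_smul, e]
  exact comp_apply_zero S.toCycles_comp_homologyπ y

lemma exact_map_functor {r : ℕ} {f : Fin r → A} (hI : Ideal.span (Set.range f) = idealPos 𝒜)
    (S : ShortComplex (GrMod 𝒜))
    (h : ∀ x : S.X₂, S.g.lin x = 0 → ∀ i, ∃ (k : ℕ) (y : S.X₁), f i ^ k • x = S.f.lin y) :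
    (S.map (SerreQuotient.functor (torPos 𝒜))).Exact := by
  rw [ShortComplex.exact_iff_isZero_homology]
  refine IsZero.of_iso ?_ (S.mapHomologyIso (SerreQuotient.functor (torPos 𝒜)))
  exact (ObjectProperty.SerreClassLocalization.isZero_obj_iff _ (torPos 𝒜) _).2
    (torPos_homology hI S h)

/-- A finite product of graded modules is a biproduct. -/
def piIsoBiproduct {ι : Type} [Finite ι] (M : ι → GrMod 𝒜) [HasBiproduct M] : pi M ≅ ⨁ M :=
  (piIsLimit M).conePointUniqueUpToIso (biproduct.isLimit M)

end GrMod

/-! ### Acyclicity and vanishing for Čech complexes, and their augmentation. -/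

namespace Cech

open GrMod LocalizedModule

variable {A : Type u} [CommRing A] {𝒜 : ℤ → AddSubgroup A} [SetLike.GradedMonoid 𝒜]
  {r : ℕ} {f : Fin r → A} {d : Fin r → ℤ} (hf : ∀ i, f i ∈ 𝒜 (d i))

lemma ext_d (M : GrMod 𝒜) (m : ℕ) : ((ext hf).obj M).d m (m + 1) = (diff hf m).app M :=
  CochainComplex.of_d (fun m => (term hf m).obj M) (fun m => (diff hf m).app M) m

lemma cech_d (M : GrMod 𝒜) (m : ℕ) :
    ((cech hf).obj M).d m (m + 1) = (-diff hf (m + 1)).app M :=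
  CochainComplex.of_d (fun m => (term hf (m + 1)).obj M) (fun m => (-diff hf (m + 1)).app M) m

lemma exists_pow_smul_eq_ext_d (M : GrMod 𝒜) (m : ℕ) (x : ((ext hf).obj M).X m)
    (hx : (((ext hf).obj M).d m (m + 1)).lin x = 0) (i : Fin r) :
    ∃ (k : ℕ) (y : ((ext hf).obj M).X ((ComplexShape.up ℕ).prev m)),
      f i ^ k • x = (((ext hf).obj M).d ((ComplexShape.up ℕ).prev m) m).lin y := by
  rw [ext_d] at hx
  match m with
  | 0 =>
    obtain ⟨k, hk⟩ := exists_pow_smul_eq_zero_of_diff hf x hx i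
    -- In degree `0` the cocycle itself is killed; the predecessor of `0` is `0`, and `y = 0`
    -- serves.
    exact ⟨k, 0, hk.trans (map_zero _).symm⟩
  | m + 1 =>
    rw [CochainComplex.prev_nat_succ, ext_d]
    exact exists_pow_smul_eq_diff hf x hx i

lemma acyclic_map_ext (hI : Ideal.span (Set.range f) = idealPos 𝒜) (M : GrMod 𝒜) :
    (((SerreQuotient.functor (torPos 𝒜)).mapHomologicalComplex (ComplexShape.up ℕ)).obj
      ((ext hf).obj M)).Acyclic := by
  intro m
  refine (HomologicalComplex.exactAt_iff' _ ((ComplexShape.up ℕ).prev m) m (m + 1) rfl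
    (by simp)).2 ?_
  exact exact_map_functor hI (((ext hf).obj M).sc' ((ComplexShape.up ℕ).prev m) m (m + 1))
    (exists_pow_smul_eq_ext_d hf M m)

lemma bijective_smul_localizedModule {X : Type*} [AddCommGroup X] [Module A X] {a : A}
    (h : Function.Bijective fun x : X => a • x) (g : A) :
    Function.Bijective fun x : LocalizedModule (Submonoid.powers g) X => a • x := by
  constructor
  · intro x y hxy
    have hxy : a • x = a • y := hxy
    rw [← sub_eq_zero, ← smul_sub] at hxy
    rw [← sub_eq_zero]
    obtain ⟨z, n, e⟩ := exists_frac (x - y)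
    rw [e, smul_frac, frac_eq_zero_iff] at hxy
    obtain ⟨k, hk⟩ := hxy
    rw [e, frac_eq_zero_iff]
    refine ⟨k, h.1 ?_⟩
    change a • g ^ k • z = a • 0
    rw [smul_comm, hk, smul_zero]
  · intro x
    obtain ⟨z, n, rfl⟩ := exists_frac x
    obtain ⟨z, rfl⟩ := h.2 z
    exact ⟨frac z n, smul_frac _ _ _⟩

lemma bijective_smul_term {M : GrMod 𝒜} {a : A} (h : Function.Bijective fun x : M => a • x)
    (m : ℕ) : Function.Bijective fun x : (term hf m).obj M => a • x := by
  have h' := fun s : Fin m ↪o Fin r => bijective_smul_localizedModule h (prodF f s)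
  refine ⟨fun x y hxy => funext fun s => (h' s).1 (congrFun hxy s), fun x => ?_⟩
  choose y hy using fun s => (h' s).2 (x s)
  exact ⟨y, funext hy⟩

lemma bijective_pow_smul {X : Type*} [AddCommGroup X] [Module A X] {a : A}
    (h : Function.Bijective fun x : X => a • x) (k : ℕ) :
    Function.Bijective fun x : X => a ^ k • x := by
  induction k with
  | zero =>
    simp only [pow_zero, one_smul]
    exact Function.bijective_id
  | succ k ih =>
    have : (fun x : X => a ^ (k + 1) • x) = (fun x => a ^ k • x) ∘ fun x => a • x :=
      funext fun x => by simp only [Function.comp_apply, smul_smul, pow_succ]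
    rw [this]
    exact ih.comp h

/-- A cocycle becomes a coboundary after multiplication by a power of `f i`. That power acts
bijectively on all terms of the complex, so it can be divided out. -/
lemma acyclic_ext_of_bijective {M : GrMod 𝒜} {i : Fin r}
    (h : Function.Bijective fun x : M => f i • x) : ((ext hf).obj M).Acyclic := by
  intro m
  rw [HomologicalComplex.exactAt_iff' _ ((ComplexShape.up ℕ).prev m) m (m + 1) rfl
    (by simp), exact_iff]
  intro x hx
  obtain ⟨k, y, hk⟩ := exists_pow_smul_eq_ext_d hf M m x hx i
  obtain ⟨y, rfl⟩ := (bijective_pow_smul (bijective_smul_term hf h _) k).2 y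
  refine ⟨y, (bijective_pow_smul (bijective_smul_term hf h m) k).1 ?_⟩
  exact (map_smul _ _ _).symm.trans hk.symm

lemma bijective_smul_of_dvd {a g : A} (h : a ∣ g) (X : Type*) [AddCommGroup X] [Module A X] :
    Function.Bijective fun x : LocalizedModule (Submonoid.powers g) X => a • x :=
  (Module.End.isUnit_iff _).1 (isUnit_of_dvd h X ⟨a, 1, pow_one a⟩)

/-- The term is a finite biproduct of localizations, and on the factor of index `s` the element `f
(s 0)` is invertible. -/
lemma acyclic_ext_term (M : GrMod 𝒜) (m : ℕ) :
    ((ext hf).obj ((term hf (m + 1)).obj M)).Acyclic := by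
  intro q
  rw [HomologicalComplex.exactAt_iff_isZero_homology]
  have := Abelian.hasFiniteBiproducts (C := GrMod 𝒜)
  let X : (Fin (m + 1) ↪o Fin r) → GrMod 𝒜 := fun s => (loc (prodF_mem hf s)).obj M
  let H := ext hf ⋙ HomologicalComplex.homologyFunctor (GrMod 𝒜) (ComplexShape.up ℕ) q
  have h : IsZero (H.obj (⨁ X)) := Tot.isZero_obj_biproduct H X fun s => by
    refine (HomologicalComplex.exactAt_iff_isZero_homology _ _).1
      (acyclic_ext_of_bijective hf (i := s 0) ?_ q)
    exact bijective_smul_of_dvd (Finset.dvd_prod_of_mem _ (Finset.mem_univ (0 : Fin (m + 1)))) M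
  exact h.of_iso (H.mapIso (piIsoBiproduct X))

/-- A nonempty product of the `f i` is divisible by some `f i`, hence nilpotent on each element of
`M`. The term of index `0`, which is `M` itself, must be excluded. -/
lemma isZero_term_of_torPos (hI : Ideal.span (Set.range f) = idealPos 𝒜) (m : ℕ) (M : GrMod 𝒜)
    (hM : torPos 𝒜 M) : IsZero ((term hf (m + 1)).obj M) := by
  rw [IsZero.iff_id_eq_zero]
  ext x
  funext s
  obtain ⟨y, n, hy⟩ := exists_frac (f := prodF f s) (x s)
  refine hy.trans ((frac_eq_zero_iff _ _).2 ?_)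
  obtain ⟨k, hk⟩ := (torPos_iff_of_span hI M).1 hM (s 0) y
  have hd : f (s 0) ^ k ∣ prodF f s ^ k :=
    pow_dvd_pow_of_dvd (Finset.dvd_prod_of_mem _ (Finset.mem_univ (0 : Fin (m + 1)))) k
  obtain ⟨c, hc⟩ := hd
  exact ⟨k, by rw [hc, mul_comm, mul_smul, hk, smul_zero]⟩

/-- There is no strictly increasing sequence of more than `r` indices, so the product is empty. -/
lemma isZero_term (m : ℕ) (hm : r < m) (M : GrMod 𝒜) : IsZero ((term hf m).obj M) := by
  rw [IsZero.iff_id_eq_zero]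
  ext x
  funext s
  have := Fintype.card_le_of_injective s s.injective
  simp at this
  omega

/-- The map from `M` to its localization at the empty product. -/
def toTermZero (M : GrMod 𝒜) : M ⟶ (term hf 0).obj M where
  lin := LinearMap.pi fun s => LocalizedModule.mkLinearMap (Submonoid.powers (prodF f s)) M
  map_deg := fun {i x} hx s _ => ⟨0, x, by simpa using hx,
    congrArg (LocalizedModule.mk x) (Subtype.ext (pow_zero _).symm)⟩

lemma toTermZero_apply (M : GrMod 𝒜) (x : M) (s : Fin 0 ↪o Fin r) :
    (toTermZero hf M).lin x s = frac x 0 :=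
  congrArg (LocalizedModule.mk x) (Subtype.ext (pow_zero _).symm)

/-- There is exactly one empty sequence, and inverting its product `1` changes nothing. -/
lemma bijective_toTermZero (M : GrMod 𝒜) : Function.Bijective (toTermZero hf M).lin := by
  have h₁ : ∀ s : Fin 0 ↪o Fin r, prodF f s = 1 := fun s => Finset.prod_empty
  let s₀ : Fin 0 ↪o Fin r := Fin.castLEOrderEmb (Nat.zero_le r)
  constructor
  · intro x y hxy
    have h : (frac x 0 : LocalizedModule (Submonoid.powers (prodF f s₀)) M) = frac y 0 := by
      rw [← toTermZero_apply hf M x s₀, hxy, toTermZero_apply hf M y s₀]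
    obtain ⟨k, hk⟩ := (frac_eq_iff _ _ _).1 h
    simpa [h₁] using hk
  · intro z
    obtain ⟨x, n, hx⟩ := exists_frac (f := prodF f s₀) (z s₀)
    refine ⟨x, funext fun s => ?_⟩
    obtain rfl : s = s₀ := DFunLike.ext _ _ fun l => l.elim0
    rw [toTermZero_apply]
    refine Eq.trans ?_ hx.symm
    exact congrArg (LocalizedModule.mk x) (Subtype.ext (by simp [h₁]))

/-- The term of degree `0` of the extended Čech complex of `M` is `M`. -/
def zeroIso (M : GrMod 𝒜) : M ≅ (term hf 0).obj M :=
  have := isIso_of_bijective _ (bijective_toTermZero hf M)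
  asIso (toTermZero hf M)

/-- Multiplication by the sign `(-1) ^ q`. -/
def signIso {C : Type*} [Category C] [Preadditive C] (q : ℕ) (X : C) : X ≅ X where
  hom := (-1 : ℤ) ^ q • 𝟙 X
  inv := (-1 : ℤ) ^ q • 𝟙 X
  hom_inv_id := by simp [smul_smul, ← mul_pow]
  inv_hom_id := by simp [smul_smul, ← mul_pow]

/-- The extended Čech complex is the augmented Čech complex. -/
def augmentation : Tot.Augmentation (cech hf) (ext hf) where
  zeroIso M := zeroIso hf M
  -- The differentials of the two complexes are opposite, so the identification must alternate in
  -- sign.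
  succIso M q := signIso q ((term hf (q + 1)).obj M)
  zero_naturality {M N} g := by
    ext x
    refine funext fun s => ?_
    refine (toTermZero_apply hf N (g.lin x) s).trans ?_
    refine (locMap_frac (prodF_mem hf s) g x 0).symm.trans ?_
    exact congrArg (locMap (prodF_mem hf s) g).lin (toTermZero_apply hf M x s).symm
  succ_naturality {M N} g q := by
    change (term hf (q + 1)).map g ≫ ((-1 : ℤ) ^ q • 𝟙 _) =
      ((-1 : ℤ) ^ q • 𝟙 _) ≫ (term hf (q + 1)).map g
    simp
  comm M q := by
    rw [ext_d, cech_d]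
    change ((-1 : ℤ) ^ q • 𝟙 _) ≫ (diff hf (q + 1)).app M =
      (-(diff hf (q + 1)).app M) ≫ ((-1 : ℤ) ^ (q + 1) • 𝟙 _)
    simp [pow_succ]

end Cech

namespace Tot.Augmentation

variable {C : Type*} [Category C] [Abelian C] {F F' G : C ⥤ CochainComplex C ℕ}

/-- Augmentations may be transported along isomorphisms. -/
def ofIso (a : Augmentation F G) (e : F' ≅ F) : Augmentation F' G where
  zeroIso := a.zeroIso
  succIso X q := HomologicalComplex.Hom.isoApp (e.app X) q ≪≫ a.succIso X q
  zero_naturality := a.zero_naturality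
  succ_naturality {X Y} g q := by
    have h := congrArg (fun k => HomologicalComplex.Hom.f k q) (e.hom.naturality g)
    have h : (F'.map g).f q ≫ (e.hom.app Y).f q = (e.hom.app X).f q ≫ (F.map g).f q := h
    change (F'.map g).f q ≫ (e.hom.app Y).f q ≫ (a.succIso Y q).hom =
      ((e.hom.app X).f q ≫ (a.succIso X q).hom) ≫ (G.map g).f (q + 1)
    rw [← Category.assoc, h, Category.assoc, Category.assoc, a.succ_naturality]
  comm X q := by
    change ((e.hom.app X).f q ≫ (a.succIso X q).hom) ≫ _ =
      _ ≫ (e.hom.app X).f (q + 1) ≫ (a.succIso X (q + 1)).hom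
    rw [Category.assoc, a.comm, HomologicalComplex.Hom.comm_assoc]

end Tot.Augmentation

section

variable {C : Type*} [Category C] [Abelian C] (P : ObjectProperty C) [P.IsSerreClass]

instance : (SerreQuotient.functor P).EssSurj :=
  Localization.essSurj (SerreQuotient.functor P) P.isoModSerre

end

/-! ### The Čech resolution on the Serre quotient. -/

namespace Cech

open GrMod

variable {A : Type u} [CommRing A] {𝒜 : ℤ → AddSubgroup A} [SetLike.GradedMonoid 𝒜]
  {r : ℕ} {f : Fin r → A} {d : Fin r → ℤ} (hf : ∀ i, f i ∈ 𝒜 (d i))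

instance (m : ℕ) : PreservesFiniteLimits (term hf m) :=
  have h : PreservesFiniteLimits (term hf m) ∧ PreservesFiniteColimits (term hf m) :=
    ((term hf m).exact_tfae.out 1 3).1 (term_exact hf m)
  h.1

instance (m : ℕ) : PreservesFiniteColimits (term hf m) :=
  have h : PreservesFiniteLimits (term hf m) ∧ PreservesFiniteColimits (term hf m) :=
    ((term hf m).exact_tfae.out 1 3).1 (term_exact hf m)
  h.2

variable (hI : Ideal.span (Set.range f) = idealPos 𝒜)

include hI in
-- An exact functor inverts the isomorphisms modulo a Serre subcategory as soon as it kills that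
-- subcategory.
lemma isInvertedBy_term (m : ℕ) : (torPos 𝒜).isoModSerre.IsInvertedBy (term hf (m + 1)) := by
  rw [ObjectProperty.isoModSerre_isInvertedBy_iff]
  exact fun M hM => isZero_term_of_torPos hf hI m M hM

include hI in
lemma isInvertedBy_cech : (torPos 𝒜).isoModSerre.IsInvertedBy (cech hf) := by
  intro M N g hg
  have : ∀ q, IsIso (((cech hf).map g).f q) := fun q => isInvertedBy_term hf hI q g hg
  exact HomologicalComplex.Hom.isIso_of_components _

/-- The functor `Q⁺Gr(A) ⥤ Ch(Gr(A))` induced by the Čech complex. -/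
def quotCech : QGr 𝒜 ⥤ CochainComplex (GrMod 𝒜) ℕ :=
  Localization.lift (cech hf) (isInvertedBy_cech hf hI) (SerreQuotient.functor (torPos 𝒜))

/-- `quotCech` is induced by the Čech complex. -/
def facQuotCech : SerreQuotient.functor (torPos 𝒜) ⋙ quotCech hf hI ≅ cech hf :=
  Localization.fac _ _ _

instance : (quotCech hf hI).Additive := by
  refine (Localization.functor_additive_iff (SerreQuotient.functor (torPos 𝒜))
    (torPos 𝒜).isoModSerre (quotCech hf hI)).2 ?_
  exact Functor.additive_of_iso (facQuotCech hf hI).symm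

/-- Exactness of a functor on the Serre quotient can be tested after composing with the quotient
functor, where it becomes exactness of localization. -/
lemma quotCech_exact (q : ℕ) (S : ShortComplex (QGr 𝒜)) (hS : S.Exact) :
    (S.map (quotCech hf hI ⋙ HomologicalComplex.eval _ _ q)).Exact := by
  let e : SerreQuotient.functor (torPos 𝒜) ⋙ quotCech hf hI ⋙
      HomologicalComplex.eval _ (ComplexShape.up ℕ) q ≅ term hf (q + 1) :=
    Functor.isoWhiskerRight (facQuotCech hf hI) (HomologicalComplex.eval _ _ q)
  have h₁ : PreservesFiniteLimits (quotCech hf hI ⋙ HomologicalComplex.eval _ _ q) := by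
    rw [← ObjectProperty.SerreClassLocalization.preservesFiniteLimits_comp_iff
      (SerreQuotient.functor (torPos 𝒜)) (torPos 𝒜)]
    exact preservesFiniteLimits_of_natIso e.symm
  have h₂ : PreservesFiniteColimits (quotCech hf hI ⋙ HomologicalComplex.eval _ _ q) := by
    rw [← ObjectProperty.SerreClassLocalization.preservesFiniteColimits_comp_iff
      (SerreQuotient.functor (torPos 𝒜)) (torPos 𝒜)]
    exact preservesFiniteColimits_of_natIso e.symm
  exact hS.map _

/-- The extended Čech complex as an augmentation. -/
def quotAugmentation :
    Tot.Augmentation (SerreQuotient.functor (torPos 𝒜) ⋙ quotCech hf hI) (ext hf) :=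
  (augmentation hf).ofIso (facQuotCech hf hI)

/-- The degree `0` part of the image of the Čech complex in the quotient. -/
abbrev quotCechZero : QGr 𝒜 ⥤ QGr 𝒜 :=
  quotCech hf hI ⋙ HomologicalComplex.eval _ _ 0 ⋙ SerreQuotient.functor (torPos 𝒜)

/-- The augmentation of the Čech complex, before localization. -/
def quotθPre : SerreQuotient.functor (torPos 𝒜) ⟶
    SerreQuotient.functor (torPos 𝒜) ⋙ quotCechZero hf hI where
  app M := (SerreQuotient.functor (torPos 𝒜)).map ((quotAugmentation hf hI).map M)
  naturality M N g := by
    refine ((SerreQuotient.functor (torPos 𝒜)).map_comp _ _).symm.trans ?_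
    refine Eq.trans ?_ ((SerreQuotient.functor (torPos 𝒜)).map_comp _ _)
    exact congrArg _ ((quotAugmentation hf hI).map_naturality g)

/-- The augmentation of the Čech complex of an object of the quotient. -/
def quotθ : 𝟭 (QGr 𝒜) ⟶ quotCechZero hf hI :=
  Localization.liftNatTrans (SerreQuotient.functor (torPos 𝒜)) (torPos 𝒜).isoModSerre _ _ _ _
    (quotθPre hf hI)

lemma quotθ_app (M : GrMod 𝒜) : (quotθ hf hI).app ((SerreQuotient.functor (torPos 𝒜)).obj M) =
    (SerreQuotient.functor (torPos 𝒜)).map ((quotAugmentation hf hI).map M) := by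
  refine (Localization.liftNatTrans_app (SerreQuotient.functor (torPos 𝒜))
    (torPos 𝒜).isoModSerre _ _ _ _ _ M).trans ?_
  exact (Category.id_comp _).trans (Category.comp_id _)

/-- The resolution of the objects of `Q⁺Gr(A)` by Čech complexes. -/
def resolution : Tot.Resolution (SerreQuotient.functor (torPos 𝒜)) r where
  E := quotCech hf hI
  G := ext hf
  exact_E := quotCech_exact hf hI
  a := quotAugmentation hf hI
  θ Y := (quotθ hf hI).app Y
  θ_naturality g := (quotθ hf hI).naturality g
  θ_obj M := quotθ_app hf hI M
  isZero Y := by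
    let M := (SerreQuotient.functor (torPos 𝒜)).objPreimage Y
    have e : (quotCech hf hI).obj Y ≅ (cech hf).obj M :=
      (quotCech hf hI).mapIso ((SerreQuotient.functor (torPos 𝒜)).objObjPreimageIso Y).symm ≪≫
        (facQuotCech hf hI).app M
    -- Degree `r` of the Čech complex is the term indexed by sequences of length `r + 1`, of which
    -- there are none.
    exact IsZero.of_iso (isZero_term hf (r + 1) (by omega) M)
      (HomologicalComplex.Hom.isoApp e r)
  acyclic_map M := acyclic_map_ext hf hI M
  acyclic Y q := by
    let M := (SerreQuotient.functor (torPos 𝒜)).objPreimage Y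
    have e : (quotCech hf hI).obj Y ≅ (cech hf).obj M :=
      (quotCech hf hI).mapIso ((SerreQuotient.functor (torPos 𝒜)).objObjPreimageIso Y).symm ≪≫
        (facQuotCech hf hI).app M
    exact fun n => (acyclic_ext_term hf M q n).of_iso
      ((ext hf).mapIso (HomologicalComplex.Hom.isoApp e q).symm)

end Cech

/-! ### Restriction to the categories `D^♠`. -/

section RestrictedAdjunction

variable {C D : Type*} [Category C] [Category D] {L : C ⥤ D} {R : D ⥤ C} (adj : L ⊣ R)
  (P : ObjectProperty C) (P' : ObjectProperty D) (hL : ∀ X : P.FullSubcategory, P' (L.obj X.obj))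
  (hR : ∀ Y : P'.FullSubcategory, P (R.obj Y.obj))

/-- The restriction of an adjunction to full subcategories. -/
def restrictAdjunction : P'.lift (P.ι ⋙ L) hL ⊣ P.lift (P'.ι ⋙ R) hR :=
  Adjunction.mkOfUnitCounit
    { unit :=
        { app := fun X => P.fullyFaithfulι.preimage (Y := ⟨_, hR ⟨_, hL X⟩⟩) (adj.unit.app X.obj)
          naturality := fun _ _ g => P.ι.map_injective (adj.unit.naturality g.hom) }
      counit :=
        { app := fun Y => P'.fullyFaithfulι.preimage (X := ⟨_, hL ⟨_, hR Y⟩⟩)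
            (adj.counit.app Y.obj)
          naturality := fun _ _ g => P'.ι.map_injective (adj.counit.naturality g.hom) }
      left_triangle := by
        ext X
        change L.map (adj.unit.app X.obj) ≫ 𝟙 _ ≫ adj.counit.app (L.obj X.obj) = 𝟙 _
        rw [Category.id_comp]
        exact adj.left_triangle_components X.obj
      right_triangle := by
        ext Y
        change adj.unit.app (R.obj Y.obj) ≫ 𝟙 _ ≫ R.map (adj.counit.app Y.obj) = 𝟙 _
        rw [Category.id_comp]
        exact adj.right_triangle_components Y.obj }

lemma isIso_restrictAdjunction_unit_app_iff (X : P.FullSubcategory) :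
    IsIso ((restrictAdjunction adj P P' hL hR).unit.app X) ↔ IsIso (adj.unit.app X.obj) :=
  (isIso_iff_of_reflects_iso _ P.ι).symm

lemma isIso_restrictAdjunction_counit [IsIso adj.counit] :
    IsIso (restrictAdjunction adj P P' hL hR).counit := by
  rw [NatTrans.isIso_iff_isIso_app]
  intro Y
  rw [← isIso_iff_of_reflects_iso _ P'.ι]
  exact inferInstanceAs (IsIso (adj.counit.app Y.obj))

end RestrictedAdjunction

/-! ### The kernel of the quotient functor on derived categories. -/

section Kernel

variable {C : Type*} [Category C] [Abelian C] (S : ObjectProperty C) [S.IsSerreClass]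
  [HasDerivedCategory.{w} C] [HasDerivedCategory.{w'} (SerreQuotient S)]

/-- The quotient functor is exact, so it commutes with cohomology, and it sends exactly the objects
of `S` to zero. -/
lemma isZero_phiStar_obj_iff (X : DerivedCategory C) : IsZero ((phiStar S).obj X) ↔
    ∀ n : ℤ, S ((DerivedCategory.homologyFunctor C n).obj X) := by
  obtain ⟨K, ⟨e⟩⟩ := DerivedCategory.exists_iso_Q_obj X
  have h₁ : IsZero ((phiStar S).obj X) ↔ IsZero (DerivedCategory.Q.obj
      (((SerreQuotient.functor S).mapHomologicalComplex (ComplexShape.up ℤ)).obj K)) :=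
    ((phiStar S).mapIso e.symm ≪≫
      (SerreQuotient.functor S).mapDerivedCategoryFactors.app K).isZero_iff
  rw [h₁, DerivedCategory.isZero_Q_obj_iff]
  refine forall_congr' fun n => ?_
  rw [HomologicalComplex.exactAt_iff_isZero_homology]
  have h₂ : ((((SerreQuotient.functor S).mapHomologicalComplex (ComplexShape.up ℤ)).obj K).homology n) ≅
      (SerreQuotient.functor S).obj (K.homology n) :=
    (K.sc n).mapHomologyIso (SerreQuotient.functor S)
  rw [h₂.isZero_iff, ObjectProperty.SerreClassLocalization.isZero_obj_iff _ S]
  exact S.prop_iff_of_iso (((DerivedCategory.homologyFunctorFactors C n).app K).symm ≪≫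
    (DerivedCategory.homologyFunctor C n).mapIso e)

lemma isZero_fullSubcategory_iff {T : Type*} [Category T] [HasZeroMorphisms T]
    {P : ObjectProperty T} (X : P.FullSubcategory) : IsZero X ↔ IsZero X.obj :=
  ⟨fun h => P.ι.map_isZero h, fun h => IsZero.of_full_of_faithful_of_isZero P.ι X h⟩

lemma dCohomologyIn_iff (b : Spade) (X : DCat C b) :
    dCohomologyIn S b X ↔ IsZero ((phiStarD S b).obj X) := by
  rw [isZero_fullSubcategory_iff]
  exact (isZero_phiStar_obj_iff S X.obj).symm

end Kernel

/-! ### Trivial complexes, the Čech functor and the main theorem. -/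

section Main

variable {A : Type u} [CommRing A] {𝒜 : ℤ → AddSubgroup A} [SetLike.GradedMonoid 𝒜]
  {r : ℕ} {f : Fin r → A} {d : Fin r → ℤ} (hf : ∀ i, f i ∈ 𝒜 (d i))
  [HasDerivedCategory.{w} (GrMod 𝒜)]

/-- `RΓ_I` is induced by the total complexes of extended Čech complexes. -/
def rGammaFac : DerivedCategory.Q ⋙ rGamma hf ≅
    Tot.functor r (Cech.ext hf) ⋙ DerivedCategory.Q :=
  Localization.fac _ _ _

/-- `Č_I` is induced by the total complexes of Čech complexes. -/
def cechDFac : DerivedCategory.Q ⋙ cechD hf ≅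
    Tot.functor r (Cech.cech hf) ⋙ DerivedCategory.Q :=
  Localization.fac _ _ _

variable [HasDerivedCategory.{w'} (QGr 𝒜)] (hI : Ideal.span (Set.range f) = idealPos 𝒜)

/-- Both conditions say that the total extended Čech complex is acyclic: it represents `RΓ_I`, and
it is a shifted cone of the unit. -/
lemma isZero_rGamma_obj_iff (X : DerivedCategory (GrMod 𝒜)) :
    IsZero ((rGamma hf).obj X) ↔ IsIso ((Cech.resolution hf hI).adj.unit.app X) := by
  obtain ⟨K, ⟨e⟩⟩ := DerivedCategory.exists_iso_Q_obj X
  rw [((rGamma hf).mapIso e.symm ≪≫ (rGammaFac hf).app K).isZero_iff,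
    ← NatTrans.isIso_app_iff_of_iso _ e, Tot.Resolution.isIso_adj_unit_app_iff]
  exact DerivedCategory.isZero_Q_obj_iff _

/-- `φ^* ⋙ Rφ_*` is the Čech functor. -/
def phiStarCompRIso : phiStar (torPos 𝒜) ⋙ (Cech.resolution hf hI).R ≅ cechD hf :=
  (Cech.resolution hf hI).compRIso (Cech.facQuotCech hf hI) (cechDFac hf)

/-- The adjunction between `φ^*` and `Rφ_*` on `D^♠`. -/
def adjD (b : Spade) : phiStarD (torPos 𝒜) b ⊣
    (dProp (GrMod 𝒜) b).lift ((dProp (QGr 𝒜) b).ι ⋙ (Cech.resolution hf hI).R)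
      (fun Y => Tot.dProp_of_fac (Cech.resolution hf hI).facR b Y.obj Y.property) :=
  restrictAdjunction (Cech.resolution hf hI).adj (dProp (GrMod 𝒜) b) (dProp (QGr 𝒜) b) _ _

instance (b : Spade) : IsIso (adjD hf hI b).counit :=
  isIso_restrictAdjunction_counit (Cech.resolution hf hI).adj _ _ _ _

lemma trivD_iff (b : Spade) (X : DCat (GrMod 𝒜) b) :
    trivD hf b X ↔ IsIso ((adjD hf hI b).unit.app X) :=
  (isZero_rGamma_obj_iff hf hI X.obj).trans
    (isIso_restrictAdjunction_unit_app_iff (Cech.resolution hf hI).adj _ _ _ _ X).symm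

include hI in
-- The trivial complexes are those with invertible unit, that is, the essential image of the right
-- adjoint, which is a component of the semi-orthogonal decomposition.
lemma isTriangulated_trivD (b : Spade) : (trivD hf b).IsTriangulated := by
  have h := essImage_eq_of_isIso_unit (adjD.{u, w, w'} hf hI b) (trivD_iff hf hI b)
  rw [← h]
  exact (isSemiorthogonalDecomposition_of_adjunction (adjD hf hI b)
    (dCohomologyIn_iff (torPos 𝒜) b)).isTriangulated₁

end Main

end

theorem mainTheorem7 {A : Type u} [CommRing A] (𝒜 : ℤ → AddSubgroup A) [GradedRing 𝒜]
    [HasDerivedCategory.{w} (GrMod 𝒜)] [HasDerivedCategory.{w'} (QGr 𝒜)]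
    {r : ℕ} (f : Fin r → A) (d : Fin r → ℤ) (hf : ∀ i, f i ∈ 𝒜 (d i))
    (hI : Ideal.span (Set.range f) = idealPos 𝒜) :
    (∀ b : Spade, IsDLocalizing.{w, w'} (torPos 𝒜) b) ∧
    ∃ (R : DerivedCategory (QGr 𝒜) ⥤ DerivedCategory (GrMod 𝒜)) (adj : phiStar (torPos 𝒜) ⊣ R),
      IsIso adj.counit ∧ R.Full ∧ R.Faithful ∧
      ∀ b : Spade, ∃ (Rb : DCat (QGr 𝒜) b ⥤ DCat (GrMod 𝒜) b) (adjb : phiStarD (torPos 𝒜) b ⊣ Rb),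
        IsIso adjb.counit ∧
        Nonempty (Rb ⋙ (dProp (GrMod 𝒜) b).ι ≅ (dProp (QGr 𝒜) b).ι ⋙ R) ∧
        IsSemiorthogonalDecomposition Rb.essImage (dCohomologyIn (torPos 𝒜) b) ∧
        (∃ hC : ∀ X : DCat (GrMod 𝒜) b, dProp (GrMod 𝒜) b ((cechD hf).obj X.obj),
          Nonempty (phiStarD (torPos 𝒜) b ⋙ Rb ≅
            (dProp (GrMod 𝒜) b).lift ((dProp (GrMod 𝒜) b).ι ⋙ cechD hf) hC)) ∧
        ∃ (_ : (trivD hf b).IsTriangulated) (e : (trivD hf b).FullSubcategory ≌ DCat (QGr 𝒜) b),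
          Nonempty (e.functor ≅ (trivD hf b).ι ⋙ phiStarD (torPos 𝒜) b) ∧
          Nonempty (e.inverse ⋙ (trivD hf b).ι ≅ Rb) ∧
          ((trivD hf b).ι ⋙ phiStarD (torPos 𝒜) b).IsTriangulated := by
  -- Each functor on `D^♠` is chosen as the restriction of the one on `D`, so the required
  -- compatibilities are identities.
  refine ⟨fun b => ⟨_, adjD hf hI b, inferInstance⟩, _, (Cech.resolution hf hI).adj,
    inferInstance, (Cech.resolution hf hI).adj.fullyFaithfulROfIsIsoCounit.full,
    (Cech.resolution hf hI).adj.fullyFaithfulROfIsIsoCounit.faithful,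
    fun b => ⟨_, adjD hf hI b, inferInstance, ⟨Iso.refl _⟩,
      isSemiorthogonalDecomposition_of_adjunction (adjD hf hI b)
        (dCohomologyIn_iff (torPos 𝒜) b),
      ⟨fun X => Tot.dProp_of_fac (cechDFac hf) b X.obj X.property,
        ⟨NatIso.ofComponents
          (fun X => (dProp (GrMod 𝒜) b).fullyFaithfulι.preimageIso
            ((phiStarCompRIso hf hI).app X.obj))
          (fun g => (dProp (GrMod 𝒜) b).ι.map_injective
            ((phiStarCompRIso hf hI).hom.naturality g.hom))⟩⟩,
      isTriangulated_trivD hf hI b,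
      equivalenceOfIsIsoUnit (adjD hf hI b) (trivD_iff hf hI b),
      ⟨Iso.refl _⟩, ⟨Iso.refl _⟩, ?_⟩⟩
  -- What remains is exactness of the restricted `φ^*`: the inclusion of a triangulated subcategory
  -- followed by an exact functor.
  have := isTriangulated_trivD hf hI b
  infer_instance
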